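/- Let $(M,g)$ be a smooth $n$-dimensional Riemannian manifold, let $\pi:T^*M\to M$ be its cotangent bundle, and let $u,v:[0,\infty)\to\mathbb R$ be smooth functions with $u(t)>0$ and $u(t)+2tv(t)>0$ for all $t\ge 0$. Every local chart $(U,x^1,\dots,x^n)$ of $M$ induces a chart $(\pi^{-1}(U),q^1,\dots,q^n,p_1,\dots,p_n)$ of $T^*M$. Let $g_{ij}$ be the components of $g$, $(g^{ij})$ the inverse matrix, $\Gamma^k_{ij}$ the Christoffel symbols, and $R^h_{kij}$ the components of the curvature tensor, with $R(\partial/\partial x^i,\partial/\partial x^j)\,\partial/\partial x^k=R^h_{kij}\,\partial/\partial x^h$ (summation convention throughout). Put $\Gamma^0_{ij}=p_k\Gamma^k_{ij}$, $R^0_{kij}=p_hR^h_{kij}$, $g^{0i}=p_hg^{hi}$, $$\partial^i=\frac{\partial}{\partial p_i},\qquad \delta_i=\frac{\partial}{\partial q^i}+\Gamma^0_{ih}\frac{\partial}{\partial p_h},\qquad t=\tfrac12 g^{ik}p_ip_k,\qquad G_{ij}=u(t)g_{ij}+v(t)p_ip_j,$$ let $(H^{ij})$ be the inverse of the matrix $(G_{ij})$,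 put $w=-\frac{v}{u(u+2tv)}$ as a function of $t$, and let $G=G_{ij}\,dq^i dq^j+H^{ij}\,Dp_i Dp_j$ with $Dp_i=dp_i-\Gamma^0_{ij}dq^j$ be the corresponding Riemannian metric on $T^*M$ (the natural lift of diagonal type of $g$). An M-tensor field of type $(r,s)$ on $T^*M$ is a system of components, with $r$ upper and $s$ lower indices, assigned to the induced charts, which are smooth functions of $(q,p)$ and change under a change of charts like the components of a tensor field of type $(r,s)$ on $M$. Then the Levi-Civita connection $\nabla$ of $G$ is given in the adapted local frame $(\partial^1,\dots,\partial^n,\delta_1,\dots,\delta_n)$ of any induced chart by $$\nabla_{\partial^i}\partial^j=Q^{ij}_h\partial^h,\qquad \nabla_{\delta_i}\partial^j=-\Gamma^j_{ih}\partial^h+P^{hj}_i\delta_h,$$ $$\nabla_{\partial^i}\delta_j=P^{hi}_j\delta_h,\qquad \nabla_{\delta_i}\delta_j=\Gamma^h_{ij}\delta_h+S_{hij}\partial^h,$$ where $Q^{ij}_h$, $P^{hi}_j$, $S_{hij}$ are M-tensor fields on $T^*M$ (of types $(2,1)$, $(2,1)$, $(0,3)$), defined by $$Q^{ij}_h=\tfrac12G_{hk}(\partial^iH^{jk}+\partial^jH^{ik}-\partial^kH^{ij}),\qquad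 P^{hi}_j=\tfrac12H^{hk}(\partial^iG_{jk}-H^{il}R^0_{ljk}),$$ $$S_{hij}=-\tfrac12G_{hk}\partial^kG_{ij}+\tfrac12R^0_{hij}.$$ Moreover, if $(M,g)$ has constant sectional curvature $c$, then at every point of $\pi^{-1}(U)$ with $v(t)\neq0$ (the expressions below divide by $v$ and $w$), where $u,v,w$ and their derivatives $u',v',w'$ are taken at $t$, $$Q^{ij}_h=-\frac{u'}{2u}(\delta^i_hg^{0j}+\delta^j_hg^{0i})-\frac{v(u'+2u^2w)}{2u^3w}g^{ij}p_h-\frac{v(2u'w+uw')}{2u^2w}g^{0i}g^{0j}p_h,$$ $$P^{hi}_j=\frac{u'}{2u}\delta^h_jg^{0i}-\frac{(c+uv)w}{2v}\delta^i_jg^{0h}+\frac{uv-c}{2u^2}g^{ih}p_j+\frac{vw(uv-c)+uw(u'v-uv')}{2uv}g^{0i}g^{0h}p_j,$$ $$S_{hij}=\frac{c-uv}{2}g_{jh}p_i-\frac{c+uv}{2}g_{ih}p_j+\frac{u'v}{2uw}g_{ij}p_h+\frac{v(v'-2uvw)}{2uw}p_hp_ip_j.$$ -/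

import Mathlib

open Bundle
open scoped Manifold ContDiff

noncomputable section

namespace NaturalLift

/-- The model space `ℝⁿ`. -/
abbrev Model (n : ℕ) : Type := EuclideanSpace ℝ (Fin n)

/-- The total space `T*M` of the cotangent bundle: pairs of a point `x` of `M` and a linear form on
the tangent space at `x`, with its topology and smooth structure as a vector bundle over `M`. -/
abbrev Cotangent (n : ℕ) (M : Type*) [TopologicalSpace M] [ChartedSpace (Model n) M]
    [IsManifold (𝓡 n) ∞ M] : Type _ :=
  TotalSpace (Model n →L[ℝ] ℝ)
    (fun x : M => TangentSpace (𝓡 n) x →L[ℝ] Bundle.Trivial M ℝ x)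

/-- The model with corners (without boundary) of the `2n`-dimensional manifold `T*M`. -/
abbrev cotModel (n : ℕ) : ModelWithCorners ℝ (Model n × (Model n →L[ℝ] ℝ))
    (ModelProd (Model n) (Model n →L[ℝ] ℝ)) :=
  (𝓡 n).prod 𝓘(ℝ, Model n →L[ℝ] ℝ)

/-- Smooth Riemannian metrics on `M`. -/
abbrev Metric (n : ℕ) (M : Type*) [TopologicalSpace M] [ChartedSpace (Model n) M]
    [IsManifold (𝓡 n) ∞ M] : Type _ :=
  ContMDiffRiemannianMetric (𝓡 n) ∞ (Model n) (TangentSpace (𝓡 n) : M → Type _)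

/-- Local charts of `M` (used below only when they belong to the maximal smooth atlas). -/
abbrev Chart (n : ℕ) (M : Type*) [TopologicalSpace M] : Type _ :=
  OpenPartialHomeomorph M (Model n)

variable {n : ℕ} {M : Type*} [TopologicalSpace M] [ChartedSpace (Model n) M]
  [IsManifold (𝓡 n) ∞ M]

/-! Local coordinates on the base manifold. -/

/-- The constant vector field with value `e` on a normed space. -/
def constField {F : Type*} [NormedAddCommGroup F] [NormedSpace ℝ F] (e : F) (y : F) :
    TangentSpace 𝓘(ℝ, F) y := e

/-- The coordinate vector field `∂/∂xⁱ` of the chart `φ`. -/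
def coordField (φ : Chart n M) (i : Fin n) (x : M) : TangentSpace (𝓡 n) x :=
  VectorField.mpullback (𝓡 n) 𝓘(ℝ, Model n) φ (constField (EuclideanSpace.single i (1 : ℝ))) x

/-- The partial derivative `∂f/∂xⁱ` of a function on `M` in the chart `φ`. -/
def partialBase (φ : Chart n M) (i : Fin n) (f : M → ℝ) (x : M) : ℝ :=
  mvfderiv (𝓡 n) f x (coordField φ i x)

/-- The components `g_{ij}` of the metric. -/
def gLow (g : Metric n M) (φ : Chart n M) (i j : Fin n) (x : M) : ℝ :=
  g.inner x (coordField φ i x) (coordField φ j x)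

/-- The entries `g^{ij}` of the inverse of the matrix `(g_{ij})`. -/
def gUp (g : Metric n M) (φ : Chart n M) (i j : Fin n) (x : M) : ℝ :=
  (Matrix.of fun k l => gLow g φ k l x)⁻¹ i j

/-- The Christoffel symbols `Γ^k_{ij}` of the Levi-Civita connection of `g`. -/
def christoffel (g : Metric n M) (φ : Chart n M) (k i j : Fin n) (x : M) : ℝ :=
  (1 / 2) * ∑ l, gUp g φ k l x *
    (partialBase φ i (gLow g φ l j) x + partialBase φ j (gLow g φ l i) x
      - partialBase φ l (gLow g φ i j) x)

/-- The components `R^h_{kij}` of the curvature tensor of `g`, with the convention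
`R(∂_i, ∂_j) ∂_k = R^h_{kij} ∂_h` for `R(X, Y) = [∇_X, ∇_Y] - ∇_{[X, Y]}`. -/
def curvature (g : Metric n M) (φ : Chart n M) (h k i j : Fin n) (x : M) : ℝ :=
  partialBase φ i (christoffel g φ h j k) x - partialBase φ j (christoffel g φ h i k) x
    + ∑ l, (christoffel g φ h i l x * christoffel g φ l j k x
      - christoffel g φ h j l x * christoffel g φ l i k x)

/-- `(M, g)` has constant sectional curvature `c`: in local coordinates,
`g(R(X, Y)Y, X) = c (g(X, X) g(Y, Y) - g(X, Y)²)` for all tangent vectors `X = ξⁱ∂_i`,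
`Y = ηⁱ∂_i` at all points. (If `X`, `Y` are linearly dependent, both sides vanish.) -/
def HasConstantSectionalCurvature (g : Metric n M) (c : ℝ) : Prop :=
  ∀ φ ∈ IsManifold.maximalAtlas (𝓡 n) ∞ M, ∀ x ∈ φ.source, ∀ ξ η : Fin n → ℝ,
    ∑ h, ∑ l, ∑ k, ∑ i, ∑ j,
        gLow g φ h l x * curvature g φ l k i j x * ξ i * η j * η k * ξ h
      = c * ((∑ i, ∑ j, gLow g φ i j x * ξ i * ξ j) * (∑ i, ∑ j, gLow g φ i j x * η i * η j)
          - (∑ i, ∑ j, gLow g φ i j x * ξ i * η j) ^ 2)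

/-! Induced local coordinates and adapted frames on the cotangent bundle. -/

/-- The coordinate function `q^i = x^i ∘ π` of the chart of `T*M` induced by `φ`. -/
def qCoord (φ : Chart n M) (i : Fin n) (p : Cotangent n M) : ℝ := φ p.proj i

/-- The coordinate function `p_i` of the chart of `T*M` induced by `φ`, i.e. the value of the
linear form `p` on `∂/∂x^i`. -/
def pCoord (φ : Chart n M) (i : Fin n) (p : Cotangent n M) : ℝ := p.2 (coordField φ i p.proj)

/-- The chart `(q^1, …, q^n, p_1, …, p_n)` of `T*M` induced by `φ`, with domain `π⁻¹(U)`. -/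
def inducedChart (φ : Chart n M) (p : Cotangent n M) : Model n × Model n :=
  (WithLp.toLp 2 fun i => qCoord φ i p, WithLp.toLp 2 fun i => pCoord φ i p)

/-- The coordinate vector field `∂/∂q^i` on `T*M`. -/
def dqField (φ : Chart n M) (i : Fin n) (p : Cotangent n M) : TangentSpace (cotModel n) p :=
  VectorField.mpullback (cotModel n) 𝓘(ℝ, Model n × Model n) (inducedChart φ)
    (constField ((EuclideanSpace.single i (1 : ℝ), 0) : Model n × Model n)) p

/-- The coordinate vector field `∂^i = ∂/∂p_i` on `T*M`. -/
def vert (φ : Chart n M) (i : Fin n) (p : Cotangent n M) : TangentSpace (cotModel n) p :=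
  VectorField.mpullback (cotModel n) 𝓘(ℝ, Model n × Model n) (inducedChart φ)
    (constField ((0, EuclideanSpace.single i (1 : ℝ)) : Model n × Model n)) p

/-- `Γ^0_{ij} = p_k Γ^k_{ij}`. -/
def christoffel0 (g : Metric n M) (φ : Chart n M) (i j : Fin n) (p : Cotangent n M) : ℝ :=
  ∑ k, pCoord φ k p * christoffel g φ k i j p.proj

/-- `R^0_{kij} = p_h R^h_{kij}`. -/
def curvature0 (g : Metric n M) (φ : Chart n M) (k i j : Fin n) (p : Cotangent n M) : ℝ :=
  ∑ h, pCoord φ h p * curvature g φ h k i j p.proj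

/-- The horizontal vector field `δ_i = δ/δq^i = ∂/∂q^i + Γ^0_{ih} ∂/∂p_h`. -/
def horiz (g : Metric n M) (φ : Chart n M) (i : Fin n) (p : Cotangent n M) :
    TangentSpace (cotModel n) p :=
  dqField φ i p + ∑ h, christoffel0 g φ i h p • vert φ h p

/-- The derivative `∂^i f` of a function on `T*M`. -/
def dVert (φ : Chart n M) (i : Fin n) (f : Cotangent n M → ℝ) (p : Cotangent n M) : ℝ :=
  mvfderiv (cotModel n) f p (vert φ i p)

/-- The 1-form `dq^i` on `T*M`. -/
def dq (φ : Chart n M) (i : Fin n) (p : Cotangent n M) (X : TangentSpace (cotModel n) p) : ℝ :=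
  mvfderiv (cotModel n) (qCoord φ i) p X

/-- The absolute differential `Dp_i = dp_i - Γ^0_{ij} dq^j`. -/
def Dp (g : Metric n M) (φ : Chart n M) (i : Fin n) (p : Cotangent n M)
    (X : TangentSpace (cotModel n) p) : ℝ :=
  mvfderiv (cotModel n) (pCoord φ i) p X - ∑ j, christoffel0 g φ i j p * dq φ j p X

/-! The natural lift of diagonal type. -/

/-- `g^{0i} = p_h g^{hi}`. -/
def gUp0 (g : Metric n M) (φ : Chart n M) (i : Fin n) (p : Cotangent n M) : ℝ :=
  ∑ h, pCoord φ h p * gUp g φ h i p.proj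

/-- The energy density `t = ‖p‖² / 2 = g^{ik} p_i p_k / 2`. -/
def energy (g : Metric n M) (φ : Chart n M) (p : Cotangent n M) : ℝ :=
  (1 / 2) * ∑ i, ∑ k, gUp g φ i k p.proj * pCoord φ i p * pCoord φ k p

/-- `G_{ij} = u(t) g_{ij} + v(t) p_i p_j`. -/
def GLow (g : Metric n M) (u v : ℝ → ℝ) (φ : Chart n M) (i j : Fin n) (p : Cotangent n M) : ℝ :=
  u (energy g φ p) * gLow g φ i j p.proj + v (energy g φ p) * pCoord φ i p * pCoord φ j p

/-- The entries `H^{ij}` of the inverse of the matrix `(G_{ij})`. -/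
def HUp (g : Metric n M) (u v : ℝ → ℝ) (φ : Chart n M) (i j : Fin n) (p : Cotangent n M) : ℝ :=
  (Matrix.of fun k l => GLow g u v φ k l p)⁻¹ i j

/-- `w = - v / (u (u + 2 t v))`, as a function of `t`. -/
def wFun (u v : ℝ → ℝ) (t : ℝ) : ℝ := - v t / (u t * (u t + 2 * t * v t))

/-- The bilinear form `G_{ij} dq^i dq^j + H^{ij} Dp_i Dp_j` on the tangent space of `T*M` at `p`,
written in the chart induced by `φ`. -/
def diagonalForm (g : Metric n M) (u v : ℝ → ℝ) (φ : Chart n M) (p : Cotangent n M)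
    (X Y : TangentSpace (cotModel n) p) : ℝ :=
  (∑ i, ∑ j, GLow g u v φ i j p * dq φ i p X * dq φ j p Y)
    + ∑ i, ∑ j, HUp g u v φ i j p * Dp g φ i p X * Dp g φ j p Y

/-- The diagonal lift metric `G` on `T*M`. Its value at `p` does not depend on the chart around
`π(p)` in which the bilinear form is written; the preferred chart is used here. -/
def liftMetric (g : Metric n M) (u v : ℝ → ℝ) (p : Cotangent n M)
    (X Y : TangentSpace (cotModel n) p) : ℝ :=
  diagonalForm g u v (chartAt (Model n) p.proj) p X Y

/-- A connection on the manifold `T*M`; `nabla Y p (X p)` is the value of `∇_X Y` at `p`. -/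
abbrev Connection (n : ℕ) (M : Type*) [TopologicalSpace M] [ChartedSpace (Model n) M]
    [IsManifold (𝓡 n) ∞ M] : Type _ :=
  CovariantDerivative (cotModel n) (Model n × (Model n →L[ℝ] ℝ))
    (TangentSpace (cotModel n) : Cotangent n M → Type _)

/-- `nabla` is the Levi-Civita connection of the metric `G` on `T*M`: it is torsion-free and
`X (G(Y, Z)) = G(∇_X Y, Z) + G(Y, ∇_X Z)`. -/
def IsLeviCivita (G : ∀ p : Cotangent n M, TangentSpace (cotModel n) p →
    TangentSpace (cotModel n) p → ℝ) (nabla : Connection n M) : Prop :=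
  nabla.torsion = 0 ∧
  ∀ (p : Cotangent n M) (X : TangentSpace (cotModel n) p)
    (Y Z : ∀ q : Cotangent n M, TangentSpace (cotModel n) q),
    MDifferentiableAt (cotModel n) (cotModel n).tangent
      (fun q => (⟨q, Y q⟩ : TangentBundle (cotModel n) (Cotangent n M))) p →
    MDifferentiableAt (cotModel n) (cotModel n).tangent
      (fun q => (⟨q, Z q⟩ : TangentBundle (cotModel n) (Cotangent n M))) p →
    mvfderiv (cotModel n) (fun q => G q (Y q) (Z q)) p X
      = G p (nabla Y p X) (Z p) + G p (Y p) (nabla Z p X)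

/-! M-tensor fields. -/

/-- A system of components, with `r` upper and `s` lower indices, assigned to the charts of `M`,
each component being a function on `T*M` (considered over the domain of the chart only). -/
abbrev MComponents (n : ℕ) (M : Type*) [TopologicalSpace M] [ChartedSpace (Model n) M]
    [IsManifold (𝓡 n) ∞ M] (r s : ℕ) : Type _ :=
  Chart n M → (Fin r → Fin n) → (Fin s → Fin n) → Cotangent n M → ℝ

/-- The components `T` define an M-tensor field of type `(r, s)` on `T*M`: they are smooth on the
domains `π⁻¹(U)` of the induced charts and change like the components of a tensor field of type
`(r, s)` on the base manifold. -/
def IsMTensorField {r s : ℕ} (T : MComponents n M r s) : Prop :=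
  (∀ φ ∈ IsManifold.maximalAtlas (𝓡 n) ∞ M, ∀ a b,
    ContMDiffOn (cotModel n) 𝓘(ℝ) ∞ (T φ a b) {p | p.proj ∈ φ.source}) ∧
  ∀ φ ∈ IsManifold.maximalAtlas (𝓡 n) ∞ M, ∀ ψ ∈ IsManifold.maximalAtlas (𝓡 n) ∞ M,
    ∀ p : Cotangent n M, p.proj ∈ φ.source → p.proj ∈ ψ.source → ∀ a b,
      T ψ a b p = ∑ a' : Fin r → Fin n, ∑ b' : Fin s → Fin n,
        (∏ k, partialBase φ (a' k) (fun x => ψ x (a k)) p.proj)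
          * (∏ k, partialBase ψ (b k) (fun x => φ x (b' k)) p.proj) * T φ a' b' p

/-- `Q^{ij}_h = ½ G_{hk} (∂^i H^{jk} + ∂^j H^{ik} - ∂^k H^{ij})`. -/
def Qt (g : Metric n M) (u v : ℝ → ℝ) (φ : Chart n M) (i j h : Fin n) (p : Cotangent n M) : ℝ :=
  (1 / 2) * ∑ k, GLow g u v φ h k p *
    (dVert φ i (HUp g u v φ j k) p + dVert φ j (HUp g u v φ i k) p
      - dVert φ k (HUp g u v φ i j) p)

/-- `P^{hi}_j = ½ H^{hk} (∂^i G_{jk} - H^{il} R^0_{ljk})`. -/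
def Pt (g : Metric n M) (u v : ℝ → ℝ) (φ : Chart n M) (h i j : Fin n) (p : Cotangent n M) : ℝ :=
  (1 / 2) * ∑ k, HUp g u v φ h k p *
    (dVert φ i (GLow g u v φ j k) p - ∑ l, HUp g u v φ i l p * curvature0 g φ l j k p)

/-- `S_{hij} = -½ G_{hk} ∂^k G_{ij} + ½ R^0_{hij}`. -/
def St (g : Metric n M) (u v : ℝ → ℝ) (φ : Chart n M) (h i j : Fin n) (p : Cotangent n M) : ℝ :=
  -(1 / 2) * ∑ k, GLow g u v φ h k p * dVert φ k (GLow g u v φ i j) p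
    + (1 / 2) * curvature0 g φ h i j p

/-- The Kronecker symbol. -/
def kron (i j : Fin n) : ℝ := if i = j then 1 else 0

/-- The derivative of a function on `[0, ∞)` (one-sided at `0`). -/
def deriv0 (f : ℝ → ℝ) (t : ℝ) : ℝ := derivWithin f (Set.Ici 0) t

end NaturalLift

end

/-! A connection `nabla` with the Levi-Civita properties is given, and Koszul's formula determines
it. The formula is evaluated on the adapted frame ∂^i, δ_i. Since (dq^i, Dp_i) is the dual coframe,
G is block diagonal with blocks G_ij on the δ_i and H^ij on the ∂^i. Only two inputs are therefore
needed: the brackets of the frame and the derivatives of the two blocks.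

The brackets are [∂^i, ∂^j] = 0, [∂^i, δ_j] = Γ^i_{jh} ∂^h and [δ_i, δ_j] = R^0_{hij} ∂^h
(`mlieBracket_vert_vert`, `mlieBracket_vert_horiz`, `mlieBracket_horiz_horiz`); the last one is how
curvature enters. The blocks are parallel in horizontal directions: δ_k t = 0 because the connection
of g is metric, so δ_k G_ij has the shape of ∂_k g_ij, and differentiating HG = 1 gives the same for
H (`mvfderiv_energy_horiz`, `mvfderiv_GLow_horiz`, `mvfderiv_HUp_horiz`). In `koszul` the
Christoffel terms then either cancel or assemble to the expected Γ, and what remains are vertical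
derivatives of G and H and the curvature: exactly Q, P and S. A vector is recovered from its scalar
products by `eq_of_liftMetric`.

The metric is defined through the preferred chart at each point, so chart independence is needed
before computing in an arbitrary chart (`liftMetric_eq`). It rests on the transformation law of the
Christoffel symbols (`christoffel_change`), which makes Dp_i change tensorially (`Dp_change`).

The M-tensor property is not checked on the formulas for Q, P, S but read off from `nabla`, which
knows no charts. The frames of two charts differ by Jacobians that depend on the base point only, so
the inhomogeneous Leibniz term vanishes along ∂^i; along δ_i it is horizontal and invisible to the
vertical component S (`Qt_change`, `Pt_change`, `St_change`).

For constant sectional curvature, polarisation gives R^h_{kij} = c(δ^h_i g_kj − δ^h_j g_ki)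
(`curvature_of_const`). The Sherman–Morrison formula gives H^ij = g^ij/u + w g^{0i} g^{0j}
(`HUp_eq`). The explicit components are then finite contractions, with t eliminated through u + 2tv
= −v/(uw) (`add_two_mul_mul_eq`). -/

noncomputable section

namespace NaturalLift

/-! Smooth coordinate systems on open subsets of a manifold. -/

section Coordinates

variable {E H X F : Type*} [NormedAddCommGroup E] [NormedSpace ℝ E] [TopologicalSpace H]
  {I : ModelWithCorners ℝ E H} [TopologicalSpace X] [ChartedSpace H X]
  [NormedAddCommGroup F] [NormedSpace ℝ F]

/-- `Φ` is a smooth coordinate system on the open set `s`, with open range `t` and smooth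
inverse `J`. -/
structure IsCoord (I : ModelWithCorners ℝ E H) (Φ : X → F) (J : F → X) (s : Set X) (t : Set F) :
    Prop where
  isOpen_source : IsOpen s
  isOpen_target : IsOpen t
  mapsTo : Set.MapsTo Φ s t
  mapsTo_inv : Set.MapsTo J t s
  left_inv : ∀ x ∈ s, J (Φ x) = x
  right_inv : ∀ y ∈ t, Φ (J y) = y
  contMDiffOn : ContMDiffOn I 𝓘(ℝ, F) ∞ Φ s
  contMDiffOn_inv : ContMDiffOn 𝓘(ℝ, F) I ∞ J t

/-- The coordinate vector field of `Φ` in the direction `e`. -/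
def coordVec (I : ModelWithCorners ℝ E H) (Φ : X → F) (e : F) (x : X) : TangentSpace I x :=
  VectorField.mpullback I 𝓘(ℝ, F) Φ (constField e) x

namespace IsCoord

variable {Φ : X → F} {J : F → X} {s : Set X} {t : Set F}

lemma two_le_infty : (2 : WithTop ℕ∞) ≤ ∞ :=
  WithTop.coe_le_coe.2 (le_top : (2 : ℕ∞) ≤ ⊤)

lemma three_le_infty : (3 : WithTop ℕ∞) ≤ ∞ :=
  WithTop.coe_le_coe.2 (le_top : (3 : ℕ∞) ≤ ⊤)

lemma contMDiffAt (h : IsCoord I Φ J s t) {x : X} (hx : x ∈ s) :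
    ContMDiffAt I 𝓘(ℝ, F) ∞ Φ x :=
  h.contMDiffOn.contMDiffAt (h.isOpen_source.mem_nhds hx)

lemma contMDiffAt_inv (h : IsCoord I Φ J s t) {y : F} (hy : y ∈ t) :
    ContMDiffAt 𝓘(ℝ, F) I ∞ J y :=
  h.contMDiffOn_inv.contMDiffAt (h.isOpen_target.mem_nhds hy)

lemma mdifferentiableAt (h : IsCoord I Φ J s t) {x : X} (hx : x ∈ s) :
    MDifferentiableAt I 𝓘(ℝ, F) Φ x :=
  (h.contMDiffAt hx).mdifferentiableAt (by simp)

lemma mdifferentiableAt_inv (h : IsCoord I Φ J s t) {y : F} (hy : y ∈ t) :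
    MDifferentiableAt 𝓘(ℝ, F) I J y :=
  (h.contMDiffAt_inv hy).mdifferentiableAt (by simp)

/-- Chain rule for `Φ ∘ J`, which is the identity near `Φ x` because the target is open. With
`inv_comp` this exhibits the derivative of `J` as a two-sided inverse of that of `Φ`. -/
lemma comp_inv (h : IsCoord I Φ J s t) {x : X} (hx : x ∈ s) :
    (mfderiv I 𝓘(ℝ, F) Φ x).comp (mfderiv 𝓘(ℝ, F) I J (Φ x))
      = ContinuousLinearMap.id ℝ (TangentSpace 𝓘(ℝ, F) (Φ x)) := by
  have hy := h.mapsTo hx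
  have h1 : mfderiv 𝓘(ℝ, F) 𝓘(ℝ, F) (Φ ∘ J) (Φ x)
      = ContinuousLinearMap.id ℝ (TangentSpace 𝓘(ℝ, F) (Φ x)) := by
    rw [← mfderiv_id]
    apply Filter.EventuallyEq.mfderiv_eq
    filter_upwards [h.isOpen_target.mem_nhds hy] with y hy'
    exact h.right_inv y hy'
  rw [← h1]
  have h2 := mfderiv_comp_of_eq (h.mdifferentiableAt hx) (h.mdifferentiableAt_inv hy)
    (h.left_inv x hx)
  rw [h2, h.left_inv x hx]

lemma inv_comp (h : IsCoord I Φ J s t) {x : X} (hx : x ∈ s) :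
    (mfderiv 𝓘(ℝ, F) I J (Φ x)).comp (mfderiv I 𝓘(ℝ, F) Φ x)
      = ContinuousLinearMap.id ℝ (TangentSpace I x) := by
  have hy := h.mapsTo hx
  have h1 : mfderiv I I (J ∘ Φ) x = ContinuousLinearMap.id ℝ (TangentSpace I x) := by
    rw [← mfderiv_id]
    apply Filter.EventuallyEq.mfderiv_eq
    filter_upwards [h.isOpen_source.mem_nhds hx] with y hy'
    exact h.left_inv y hy'
  rw [← h1]
  symm
  exact mfderiv_comp x (h.mdifferentiableAt_inv hy) (h.mdifferentiableAt hx)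

/-- Coordinate fields are pullbacks, defined with `ContinuousLinearMap.inverse`, which is zero on
maps that are not invertible; this excludes that default value. -/
lemma isInvertible (h : IsCoord I Φ J s t) {x : X} (hx : x ∈ s) :
    (mfderiv I 𝓘(ℝ, F) Φ x).IsInvertible :=
  ContinuousLinearMap.IsInvertible.of_inverse (h.comp_inv hx) (h.inv_comp hx)

lemma coordVec_eq (h : IsCoord I Φ J s t) {x : X} (hx : x ∈ s) (e : F) :
    coordVec I Φ e x = mfderiv 𝓘(ℝ, F) I J (Φ x) e := by
  rw [coordVec, VectorField.mpullback_apply,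
    ContinuousLinearMap.inverse_eq (h.comp_inv hx) (h.inv_comp hx)]
  rfl

lemma mvfderiv_coordVec (h : IsCoord I Φ J s t) {x : X} (hx : x ∈ s) (e : F) :
    mvfderiv I Φ x (coordVec I Φ e x) = e := by
  rw [h.coordVec_eq hx]
  have := congrArg (fun L => L e) (h.comp_inv hx)
  exact this

lemma coordVec_mvfderiv (h : IsCoord I Φ J s t) {x : X} (hx : x ∈ s) (v : TangentSpace I x) :
    coordVec I Φ (mvfderiv I Φ x v) x = v := by
  rw [h.coordVec_eq hx]
  have := congrArg (fun L => L v) (h.inv_comp hx)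
  exact this

/-- Chain rule with `J`: a coordinate derivative on the manifold is an ordinary directional
derivative of the coordinate expression `f ∘ J`. Smoothness and commutation of coordinate
derivatives reduce to this. -/
lemma mvfderiv_apply_coordVec (h : IsCoord I Φ J s t) {x : X} (hx : x ∈ s) {G : Type*}
    [NormedAddCommGroup G] [NormedSpace ℝ G] {f : X → G}
    (hf : MDifferentiableAt I 𝓘(ℝ, G) f x) (e : F) :
    mvfderiv I f x (coordVec I Φ e x) = fderiv ℝ (f ∘ J) (Φ x) e := by
  rw [h.coordVec_eq hx, ← mfderiv_eq_fderiv]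
  have := mfderiv_comp_apply_of_eq (Φ x) hf (h.mdifferentiableAt_inv (h.mapsTo hx))
    (h.left_inv x hx) e
  erw [this]
  rw [h.left_inv x hx]
  rfl

/-- Needs no coordinate system: `inverse` is a linear map even where it takes its default value. -/
lemma coordVec_add (e e' : F) (x : X) :
    coordVec I Φ (e + e') x = coordVec I Φ e x + coordVec I Φ e' x :=
  map_add _ _ _

lemma coordVec_smul (c : ℝ) (e : F) (x : X) :
    coordVec I Φ (c • e) x = c • coordVec I Φ e x :=
  map_smul _ _ _

lemma coordVec_sum {ι : Type*} (A : Finset ι) (e : ι → F) (x : X) :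
    coordVec I Φ (∑ i ∈ A, e i) x = ∑ i ∈ A, coordVec I Φ (e i) x :=
  map_sum (mfderiv I 𝓘(ℝ, F) Φ x).inverse e A

lemma contDiffOn_comp_inv (h : IsCoord I Φ J s t) {G : Type*}
    [NormedAddCommGroup G] [NormedSpace ℝ G] {f : X → G} (hf : ContMDiffOn I 𝓘(ℝ, G) ∞ f s) :
    ContDiffOn ℝ ∞ (f ∘ J) t :=
  (hf.comp h.contMDiffOn_inv h.mapsTo_inv).contDiffOn

lemma mdifferentiableAt_of_contMDiffOn (h : IsCoord I Φ J s t) {G : Type*}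
    [NormedAddCommGroup G] [NormedSpace ℝ G] {f : X → G} (hf : ContMDiffOn I 𝓘(ℝ, G) ∞ f s)
    {x : X} (hx : x ∈ s) : MDifferentiableAt I 𝓘(ℝ, G) f x :=
  (hf.contMDiffAt (h.isOpen_source.mem_nhds hx)).mdifferentiableAt (by simp)

/-- The derivative of a smooth function along a coordinate vector field is smooth. -/
lemma contMDiffOn_mvfderiv (h : IsCoord I Φ J s t) {G : Type*}
    [NormedAddCommGroup G] [NormedSpace ℝ G] {f : X → G} (hf : ContMDiffOn I 𝓘(ℝ, G) ∞ f s)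
    (e : F) : ContMDiffOn I 𝓘(ℝ, G) ∞ (fun x => mvfderiv I f x (coordVec I Φ e x)) s := by
  have h1 : ContDiffOn ℝ ∞ (fun y => fderiv ℝ (f ∘ J) y e) t :=
    ((h.contDiffOn_comp_inv hf).fderiv_of_isOpen h.isOpen_target (by simp)).clm_apply
      contDiffOn_const
  refine (h1.contMDiffOn.comp h.contMDiffOn h.mapsTo).congr fun x hx => ?_
  exact h.mvfderiv_apply_coordVec hx (h.mdifferentiableAt_of_contMDiffOn hf hx) e

/-- Derivatives along two coordinate vector fields commute. -/
lemma mvfderiv_comm (h : IsCoord I Φ J s t) {f : X → ℝ} (hf : ContMDiffOn I 𝓘(ℝ) ∞ f s)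
    {x : X} (hx : x ∈ s) (e e' : F) :
    mvfderiv I (fun z => mvfderiv I f z (coordVec I Φ e z)) x (coordVec I Φ e' x)
      = mvfderiv I (fun z => mvfderiv I f z (coordVec I Φ e' z)) x (coordVec I Φ e x) := by
  have hy := h.mapsTo hx
  have key : ∀ e e' : F,
      mvfderiv I (fun z => mvfderiv I f z (coordVec I Φ e z)) x (coordVec I Φ e' x)
        = fderiv ℝ (fderiv ℝ (f ∘ J)) (Φ x) e' e := by
    intro e e'
    rw [h.mvfderiv_apply_coordVec hx
      (h.mdifferentiableAt_of_contMDiffOn (h.contMDiffOn_mvfderiv hf e) hx)]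
    have h1 : ((fun z => mvfderiv I f z (coordVec I Φ e z)) ∘ J)
        =ᶠ[nhds (Φ x)] fun y => fderiv ℝ (f ∘ J) y e := by
      filter_upwards [h.isOpen_target.mem_nhds hy] with y hy'
      have hJ := h.mapsTo_inv hy'
      have := h.mvfderiv_apply_coordVec hJ (h.mdifferentiableAt_of_contMDiffOn hf hJ) e
      rw [h.right_inv y hy'] at this
      exact this
    rw [h1.fderiv_eq, fderiv_clm_apply]
    · simp
    · have := ((h.contDiffOn_comp_inv hf).fderiv_of_isOpen h.isOpen_target (m := ∞) (by simp))
      exact (this.contDiffAt (h.isOpen_target.mem_nhds hy)).differentiableAt (by simp)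
    · exact differentiableAt_const _
  rw [key, key]
  -- Schwarz's theorem; over ℝ the required `minSmoothness` is just 2.
  have hs : IsSymmSndFDerivAt ℝ (f ∘ J) (Φ x) :=
    ((h.contDiffOn_comp_inv hf).contDiffAt (h.isOpen_target.mem_nhds hy)).isSymmSndFDerivAt
      (by rw [minSmoothness_of_isRCLikeNormedField]; exact two_le_infty)
  exact hs.eq e' e

variable [IsManifold I ∞ X] [CompleteSpace E]

lemma contMDiffAt_constField (e y : F) :
    ContMDiffAt 𝓘(ℝ, F) 𝓘(ℝ, F).tangent ∞
      (fun y => (⟨y, constField e y⟩ : TangentBundle 𝓘(ℝ, F) F)) y := by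
  rw [contMDiffAt_vectorSpace_iff_contDiffAt]
  exact contDiffAt_const

/-- Coordinate vector fields are smooth. -/
lemma contMDiffAt_coordVec (h : IsCoord I Φ J s t) {x : X} (hx : x ∈ s) (e : F) :
    ContMDiffAt I I.tangent ∞
      (fun x => (⟨x, coordVec I Φ e x⟩ : TangentBundle I X)) x :=
  ContMDiffAt.mpullback_vectorField_preimage (contMDiffAt_constField e (Φ x))
    (h.contMDiffAt hx) (h.isInvertible hx) (by simp)



/-- Coordinate vector fields commute. -/
lemma mlieBracket_coordVec (h : IsCoord I Φ J s t) {x : X} (hx : x ∈ s) (e e' : F) :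
    VectorField.mlieBracket I (coordVec I Φ e) (coordVec I Φ e') x = 0 := by
  have : IsManifold I (minSmoothness ℝ 3) X := by
    rw [minSmoothness_of_isRCLikeNormedField]
    exact IsManifold.of_le (n := ∞) three_le_infty
  -- Naturality of the Lie bracket under pullback by `Φ`, applied to two constant fields, whose
  -- bracket is zero.
  have h1 := VectorField.mpullback_mlieBracket (I := I) (I' := 𝓘(ℝ, F)) (f := Φ) (x₀ := x) (n := ∞)
    (V := constField e) (W := constField e')
    ((contMDiffAt_constField e (Φ x)).mdifferentiableAt (by simp))
    ((contMDiffAt_constField e' (Φ x)).mdifferentiableAt (by simp)) (h.contMDiffAt hx)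
    (by rw [minSmoothness_of_isRCLikeNormedField]; exact two_le_infty)
  have h2 : VectorField.mlieBracket 𝓘(ℝ, F) (constField e) (constField e') = 0 := by
    rw [← VectorField.mlieBracketWithin_univ, VectorField.mlieBracketWithin_eq_lieBracketWithin]
    have key : ∀ e e' : F, VectorField.lieBracketWithin ℝ (fun _ : F => e) (fun _ => e') Set.univ
        = 0 := by
      intro e e'
      ext y
      simp [VectorField.lieBracketWithin_univ, VectorField.lieBracket]
    exact key e e'
  rw [h2, VectorField.mpullback_zero] at h1
  exact h1.symm

end IsCoord

end Coordinates

end NaturalLift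

end

noncomputable section

namespace NaturalLift

variable {n : ℕ} {M : Type*} [TopologicalSpace M] [ChartedSpace (Model n) M]
  [IsManifold (𝓡 n) ∞ M]

lemma mvfderiv_clm_comp {E H X F G : Type*} [NormedAddCommGroup E] [NormedSpace ℝ E]
    [TopologicalSpace H] {I : ModelWithCorners ℝ E H} [TopologicalSpace X] [ChartedSpace H X]
    [NormedAddCommGroup F] [NormedSpace ℝ F] [NormedAddCommGroup G] [NormedSpace ℝ G]
    (L : F →L[ℝ] G) {f : X → F} {x : X} (hf : MDifferentiableAt I 𝓘(ℝ, F) f x)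
    (v : TangentSpace I x) : mvfderiv I (fun x => L (f x)) x v = L (mvfderiv I f x v) := by
  have h := mfderiv_comp x (I := I) (I' := 𝓘(ℝ, F)) (g := L) L.mdifferentiableAt hf
  have h' := congrArg (fun A => A v) h
  rw [L.mfderiv_eq] at h'
  exact h'

/-! Calculus in a chart of the base manifold. -/

variable {φ ψ : Chart n M}

omit [IsManifold (𝓡 n) ∞ M] in
lemma isCoord_chart (hφ : φ ∈ IsManifold.maximalAtlas (𝓡 n) ∞ M) :
    IsCoord (𝓡 n) φ φ.symm φ.source φ.target where
  isOpen_source := φ.open_source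
  isOpen_target := φ.open_target
  mapsTo := φ.mapsTo
  mapsTo_inv := φ.symm.mapsTo
  left_inv _ hx := φ.left_inv hx
  right_inv _ hy := φ.right_inv hy
  contMDiffOn := contMDiffOn_of_mem_maximalAtlas hφ
  contMDiffOn_inv := contMDiffOn_symm_of_mem_maximalAtlas hφ

omit [IsManifold (𝓡 n) ∞ M] in
lemma coordField_eq (φ : Chart n M) (i : Fin n) :
    coordField φ i = coordVec (𝓡 n) φ (EuclideanSpace.single i (1 : ℝ)) := rfl

omit [IsManifold (𝓡 n) ∞ M] in
lemma contMDiffOn_chart_apply (hφ : φ ∈ IsManifold.maximalAtlas (𝓡 n) ∞ M) (i : Fin n) :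
    ContMDiffOn (𝓡 n) 𝓘(ℝ) ∞ (fun x => φ x i) φ.source :=
  (EuclideanSpace.proj i : Model n →L[ℝ] ℝ).contMDiff.comp_contMDiffOn
    (isCoord_chart hφ).contMDiffOn

omit [IsManifold (𝓡 n) ∞ M] in
lemma mdifferentiableAt_chart_apply (hφ : φ ∈ IsManifold.maximalAtlas (𝓡 n) ∞ M) {x : M}
    (hx : x ∈ φ.source) (i : Fin n) : MDifferentiableAt (𝓡 n) 𝓘(ℝ) (fun x => φ x i) x :=
  (isCoord_chart hφ).mdifferentiableAt_of_contMDiffOn (contMDiffOn_chart_apply hφ i) hx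

omit [IsManifold (𝓡 n) ∞ M] in
lemma mvfderiv_chart_apply (hφ : φ ∈ IsManifold.maximalAtlas (𝓡 n) ∞ M) {x : M}
    (hx : x ∈ φ.source) (i : Fin n) (X : TangentSpace (𝓡 n) x) :
    mvfderiv (𝓡 n) (fun x => φ x i) x X = mvfderiv (𝓡 n) φ x X i :=
  mvfderiv_clm_comp (EuclideanSpace.proj i : Model n →L[ℝ] ℝ) ((isCoord_chart hφ).mdifferentiableAt hx) X

omit [IsManifold (𝓡 n) ∞ M] in
lemma partialBase_chart_apply (hφ : φ ∈ IsManifold.maximalAtlas (𝓡 n) ∞ M) {x : M}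
    (hx : x ∈ φ.source) (i j : Fin n) :
    partialBase φ i (fun x => φ x j) x = kron i j := by
  rw [partialBase, mvfderiv_chart_apply hφ hx, coordField_eq,
    (isCoord_chart hφ).mvfderiv_coordVec hx]
  simp [kron, eq_comm]

omit [IsManifold (𝓡 n) ∞ M] in
lemma tangent_expand (hφ : φ ∈ IsManifold.maximalAtlas (𝓡 n) ∞ M) {x : M}
    (hx : x ∈ φ.source) (X : TangentSpace (𝓡 n) x) :
    X = ∑ i, mvfderiv (𝓡 n) (fun x => φ x i) x X • coordField φ i x := by
  conv_lhs => rw [← (isCoord_chart hφ).coordVec_mvfderiv hx X]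
  have : (mvfderiv (𝓡 n) φ x X : Model n)
      = ∑ i, mvfderiv (𝓡 n) φ x X i • EuclideanSpace.single i (1 : ℝ) := by
    ext k
    simp [Pi.single_apply]
  rw [this, IsCoord.coordVec_sum]
  refine Finset.sum_congr rfl fun i _ => ?_
  rw [IsCoord.coordVec_smul, mvfderiv_chart_apply hφ hx]
  rfl

-- The coefficients produced by `tangent_expand` are by definition the partial derivatives. Nothing
-- is asked of `ψ`, since its coordinate field at `x` is in any case some tangent vector.
omit [IsManifold (𝓡 n) ∞ M] in
lemma coordField_change (hφ : φ ∈ IsManifold.maximalAtlas (𝓡 n) ∞ M) {x : M}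
    (hx : x ∈ φ.source) (ψ : Chart n M) (i : Fin n) :
    coordField ψ i x = ∑ a, partialBase ψ i (fun x => φ x a) x • coordField φ a x :=
  tangent_expand hφ hx _

omit [IsManifold (𝓡 n) ∞ M] in
lemma partialBase_change (hφ : φ ∈ IsManifold.maximalAtlas (𝓡 n) ∞ M) {x : M}
    (hx : x ∈ φ.source) (ψ : Chart n M) (i : Fin n) (f : M → ℝ) :
    partialBase ψ i f x = ∑ a, partialBase ψ i (fun x => φ x a) x * partialBase φ a f x := by
  conv_lhs => rw [partialBase, coordField_change hφ hx ψ i]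
  simp [partialBase]

omit [IsManifold (𝓡 n) ∞ M] in
lemma contMDiffOn_partialBase (hφ : φ ∈ IsManifold.maximalAtlas (𝓡 n) ∞ M) {f : M → ℝ}
    (hf : ContMDiffOn (𝓡 n) 𝓘(ℝ) ∞ f φ.source) (i : Fin n) :
    ContMDiffOn (𝓡 n) 𝓘(ℝ) ∞ (partialBase φ i f) φ.source :=
  (isCoord_chart hφ).contMDiffOn_mvfderiv hf _

omit [IsManifold (𝓡 n) ∞ M] in
lemma partialBase_comm (hφ : φ ∈ IsManifold.maximalAtlas (𝓡 n) ∞ M) {f : M → ℝ}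
    (hf : ContMDiffOn (𝓡 n) 𝓘(ℝ) ∞ f φ.source) {x : M} (hx : x ∈ φ.source) (i j : Fin n) :
    partialBase φ i (partialBase φ j f) x = partialBase φ j (partialBase φ i f) x :=
  (isCoord_chart hφ).mvfderiv_comm hf hx _ _

lemma contMDiffAt_coordField (hφ : φ ∈ IsManifold.maximalAtlas (𝓡 n) ∞ M) {x : M}
    (hx : x ∈ φ.source) (i : Fin n) :
    ContMDiffAt (𝓡 n) (𝓡 n).tangent ∞
      (fun x => (⟨x, coordField φ i x⟩ : TangentBundle (𝓡 n) M)) x :=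
  (isCoord_chart hφ).contMDiffAt_coordVec hx _

/-! The induced chart of the cotangent bundle. -/

lemma contMDiffAt_cotangent_proj (p : Cotangent n M) :
    ContMDiffAt (cotModel n) (𝓡 n) ∞ (fun p : Cotangent n M => p.proj) p :=
  (contMDiff_proj (fun x : M => TangentSpace (𝓡 n) x →L[ℝ] Bundle.Trivial M ℝ x)).contMDiffAt

/-- `p_i` pairs the tautological section of the pulled back cotangent bundle with the smooth field
∂/∂x^i ∘ π, and evaluation in vector bundles is smooth. -/
lemma contMDiffAt_pCoord (hφ : φ ∈ IsManifold.maximalAtlas (𝓡 n) ∞ M) {p : Cotangent n M}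
    (hp : p.proj ∈ φ.source) (i : Fin n) :
    ContMDiffAt (cotModel n) 𝓘(ℝ) ∞ (pCoord φ i) p := by
  have h1 : ContMDiffAt (cotModel n) (cotModel n) ∞
      (fun p : Cotangent n M => TotalSpace.mk' (Model n →L[ℝ] ℝ)
        (E := fun x : M => TangentSpace (𝓡 n) x →L[ℝ] Bundle.Trivial M ℝ x) p.proj p.2) p :=
    contMDiffAt_id
  have h2 : ContMDiffAt (cotModel n) (𝓡 n).tangent ∞
      (fun p : Cotangent n M => TotalSpace.mk' (Model n) (E := (TangentSpace (𝓡 n) : M → Type _))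
        p.proj (coordField φ i p.proj)) p :=
    (contMDiffAt_coordField hφ hp i).comp p (contMDiffAt_cotangent_proj p)
  have h3 := ContMDiffAt.clm_bundle_apply h1 h2
  rw [contMDiffAt_totalSpace] at h3
  exact h3.2

/-- The point of the cotangent bundle with given induced coordinates. -/
def inducedInv (φ : Chart n M) (y : Model n × Model n) : Cotangent n M :=
  ⟨φ.symm y.1, mvfderiv (𝓡 n) (fun x => ∑ i, y.2 i * φ x i) (φ.symm y.1)⟩

/-- The form with components p_i is the differential at the base point of the function ∑ p_i x^i
with frozen coefficients. Smoothness thus becomes smooth dependence of a differential on parameters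
and base point. -/
lemma contMDiffAt_inducedInv (hφ : φ ∈ IsManifold.maximalAtlas (𝓡 n) ∞ M)
    {y : Model n × Model n} (hy : y.1 ∈ φ.target) :
    ContMDiffAt 𝓘(ℝ, Model n × Model n) (cotModel n) ∞ (inducedInv φ) y := by
  have hg : ContMDiffAt 𝓘(ℝ, Model n × Model n) (𝓡 n) ∞
      (fun y : Model n × Model n => φ.symm y.1) y :=
    ((isCoord_chart hφ).contMDiffAt_inv hy).comp y contDiff_fst.contMDiff.contMDiffAt
  rw [contMDiffAt_hom_bundle]
  refine ⟨hg, ?_⟩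
  have hf : ContMDiffAt (𝓘(ℝ, Model n × Model n).prod (𝓡 n)) 𝓘(ℝ) ∞
      (Function.uncurry fun (y : Model n × Model n) (x : M) => ∑ i, y.2 i * φ x i)
      (y, φ.symm y.1) := by
    have hx : φ.symm y.1 ∈ φ.source := φ.map_target hy
    refine ContMDiffAt.sum fun i _ => ContMDiffAt.mul ?_ ?_
    · have : ContDiff ℝ ∞ fun y : Model n × Model n => y.2 i := by fun_prop
      have h' : ContMDiffAt 𝓘(ℝ, Model n × Model n) 𝓘(ℝ) ∞
          (fun y : Model n × Model n => y.2 i) y := this.contMDiff y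
      exact ContMDiffAt.comp (I' := 𝓘(ℝ, Model n × Model n)) (y, φ.symm y.1) h'
        (contMDiffAt_fst (I := 𝓘(ℝ, Model n × Model n)) (J := 𝓡 n))
    · exact ((contMDiffOn_chart_apply hφ i).contMDiffAt (φ.open_source.mem_nhds hx)).comp
        (y, φ.symm y.1) (contMDiffAt_snd (I := 𝓘(ℝ, Model n × Model n)) (J := 𝓡 n))
  have := ContMDiffAt.mfderiv (fun (y : Model n × Model n) (x : M) => ∑ i, y.2 i * φ x i)
    (fun y => φ.symm y.1) hf hg (m := ∞) (by simp)
  convert this using 2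
  simp [inTangentCoordinates, ContinuousLinearMap.inCoordinates, inducedInv]
  rfl

lemma mdifferentiableAt_fun_sum {E H X ι : Type*} [NormedAddCommGroup E] [NormedSpace ℝ E]
    [TopologicalSpace H] {I : ModelWithCorners ℝ E H} [TopologicalSpace X] [ChartedSpace H X]
    {A : Finset ι} {f : ι → X → ℝ} {x : X}
    (hf : ∀ i ∈ A, MDifferentiableAt I 𝓘(ℝ) (f i) x) :
    MDifferentiableAt I 𝓘(ℝ) (fun x => ∑ i ∈ A, f i x) x := by
  classical
  induction A using Finset.induction_on with
  | empty => simpa using mdifferentiableAt_const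
  | insert a A ha ih =>
    simp only [Finset.sum_insert ha]
    exact (hf a (Finset.mem_insert_self _ _)).add
      (ih fun i hi => hf i (Finset.mem_insert_of_mem hi))

lemma mvfderiv_sum {E H X ι : Type*} [NormedAddCommGroup E] [NormedSpace ℝ E]
    [TopologicalSpace H] {I : ModelWithCorners ℝ E H} [TopologicalSpace X] [ChartedSpace H X]
    {A : Finset ι} {f : ι → X → ℝ} {x : X}
    (hf : ∀ i ∈ A, MDifferentiableAt I 𝓘(ℝ) (f i) x) (v : TangentSpace I x) :
    mvfderiv I (fun x => ∑ i ∈ A, f i x) x v = ∑ i ∈ A, mvfderiv I (f i) x v := by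
  classical
  induction A using Finset.induction_on with
  | empty => simp [mvfderiv_const]
  | insert a A ha ih =>
    have h1 : MDifferentiableAt I 𝓘(ℝ) (fun x => ∑ i ∈ A, f i x) x :=
      mdifferentiableAt_fun_sum fun i hi => hf i (Finset.mem_insert_of_mem hi)
    simp only [Finset.sum_insert ha]
    rw [mvfderiv_fun_add (hf a (Finset.mem_insert_self _ _)) h1]
    simp [ih fun i hi => hf i (Finset.mem_insert_of_mem hi)]

omit [IsManifold (𝓡 n) ∞ M] in
lemma coordForm_apply (hφ : φ ∈ IsManifold.maximalAtlas (𝓡 n) ∞ M) {x : M}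
    (hx : x ∈ φ.source) (c : Fin n → ℝ) (X : TangentSpace (𝓡 n) x) :
    mvfderiv (𝓡 n) (fun x => ∑ i, c i * φ x i) x X
      = ∑ i, c i * mvfderiv (𝓡 n) (fun x => φ x i) x X := by
  rw [mvfderiv_sum]
  · refine Finset.sum_congr rfl fun i _ => ?_
    rw [mvfderiv_fun_mul mdifferentiableAt_const (mdifferentiableAt_chart_apply hφ hx i)]
    simp [mvfderiv_const]
  · exact fun i _ => mdifferentiableAt_const.mul (mdifferentiableAt_chart_apply hφ hx i)

omit [IsManifold (𝓡 n) ∞ M] in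
lemma coordForm_coordField (hφ : φ ∈ IsManifold.maximalAtlas (𝓡 n) ∞ M) {x : M}
    (hx : x ∈ φ.source) (c : Fin n → ℝ) (k : Fin n) :
    mvfderiv (𝓡 n) (fun x => ∑ i, c i * φ x i) x (coordField φ k x) = c k := by
  rw [coordForm_apply hφ hx]
  have h : ∀ i, mvfderiv (𝓡 n) (fun x => φ x i) x (coordField φ k x) = kron k i :=
    fun i => partialBase_chart_apply hφ hx k i
  simp [h, kron]

lemma isCoord_inducedChart (hφ : φ ∈ IsManifold.maximalAtlas (𝓡 n) ∞ M) :
    IsCoord (cotModel n) (inducedChart φ : Cotangent n M → _) (inducedInv φ)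
      {p | p.proj ∈ φ.source} {y | y.1 ∈ φ.target} where
  isOpen_source := φ.open_source.preimage
    (contMDiff_proj (n := 0) (IB := 𝓡 n)
      (fun x : M => TangentSpace (𝓡 n) x →L[ℝ] Bundle.Trivial M ℝ x)).continuous
  isOpen_target := φ.open_target.preimage continuous_fst
  mapsTo p hp := φ.mapsTo hp
  mapsTo_inv y hy := φ.map_target hy
  left_inv := by
    rintro ⟨x, η⟩ hx
    -- The base point `φ.symm (φ x)` cannot be rewritten to `x` inside the dependent pair, so it is
    -- replaced by a variable and then substituted.
    have key : ∀ x', x' = x → (⟨x', mvfderiv (𝓡 n)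
        (fun z => ∑ i, η (coordField φ i x) * φ z i) x'⟩ : Cotangent n M) = ⟨x, η⟩ := by
      rintro _ rfl
      congr 1
      ext X
      erw [coordForm_apply hφ hx]
      conv_rhs => rw [tangent_expand hφ hx X]
      simp [mul_comm]
    exact key _ (φ.left_inv hx)
  right_inv y hy := by
    have hx : φ.symm y.1 ∈ φ.source := φ.map_target hy
    refine Prod.ext ?_ ?_
    · exact φ.right_inv hy
    · ext i
      exact coordForm_coordField hφ hx y.2 i
  contMDiffOn := by
    intro p hp
    refine ContMDiffAt.contMDiffWithinAt (ContMDiffAt.prodMk_space ?_ ?_)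
    · exact ((isCoord_chart hφ).contMDiffAt hp).comp p (contMDiffAt_cotangent_proj p)
    · refine (PiLp.contDiff_toLp (p := 2) (𝕜 := ℝ) (E := fun _ : Fin n => ℝ)).contMDiff.contMDiffAt.comp
        p (contMDiffAt_pi_space.2 fun i => contMDiffAt_pCoord hφ hp i)
  contMDiffOn_inv y hy := (contMDiffAt_inducedInv hφ hy).contMDiffWithinAt

end NaturalLift

end

noncomputable section

namespace NaturalLift

variable {n : ℕ} {M : Type*} [TopologicalSpace M] [ChartedSpace (Model n) M]
  [IsManifold (𝓡 n) ∞ M] {φ ψ : Chart n M}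

/-! Calculus in an induced chart of the cotangent bundle. -/

lemma vert_eq (φ : Chart n M) (i : Fin n) :
    (vert φ i : ∀ _ : Cotangent n M, _) = coordVec (cotModel n) (inducedChart φ)
      ((0, EuclideanSpace.single i (1 : ℝ)) : Model n × Model n) := rfl

lemma dqField_eq (φ : Chart n M) (i : Fin n) :
    (dqField φ i : ∀ _ : Cotangent n M, _) = coordVec (cotModel n) (inducedChart φ)
      ((EuclideanSpace.single i (1 : ℝ), 0) : Model n × Model n) := rfl

lemma contMDiffAt_comp_proj {f : M → ℝ} {p : Cotangent n M}
    (hf : ContMDiffAt (𝓡 n) 𝓘(ℝ) ∞ f p.proj) :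
    ContMDiffAt (cotModel n) 𝓘(ℝ) ∞ (fun p : Cotangent n M => f p.proj) p :=
  hf.comp p (contMDiffAt_cotangent_proj p)

lemma mvfderiv_qCoord (hφ : φ ∈ IsManifold.maximalAtlas (𝓡 n) ∞ M) {p : Cotangent n M}
    (hp : p.proj ∈ φ.source) (i : Fin n) (X : TangentSpace (cotModel n) p) :
    mvfderiv (cotModel n) (qCoord φ i) p X
      = (mvfderiv (cotModel n) (inducedChart φ) p X).1 i :=
  mvfderiv_clm_comp ((EuclideanSpace.proj i : Model n →L[ℝ] ℝ).comp
    (ContinuousLinearMap.fst ℝ (Model n) (Model n)))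
    ((isCoord_inducedChart hφ).mdifferentiableAt hp) X

lemma mvfderiv_pCoord (hφ : φ ∈ IsManifold.maximalAtlas (𝓡 n) ∞ M) {p : Cotangent n M}
    (hp : p.proj ∈ φ.source) (i : Fin n) (X : TangentSpace (cotModel n) p) :
    mvfderiv (cotModel n) (pCoord φ i) p X
      = (mvfderiv (cotModel n) (inducedChart φ) p X).2 i :=
  mvfderiv_clm_comp ((EuclideanSpace.proj i : Model n →L[ℝ] ℝ).comp
    (ContinuousLinearMap.snd ℝ (Model n) (Model n)))
    ((isCoord_inducedChart hφ).mdifferentiableAt hp) X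

lemma kron_comm (i j : Fin n) : kron i j = kron j i := by simp [kron, eq_comm]

lemma mvfderiv_qCoord_vert (hφ : φ ∈ IsManifold.maximalAtlas (𝓡 n) ∞ M) {p : Cotangent n M}
    (hp : p.proj ∈ φ.source) (i j : Fin n) :
    mvfderiv (cotModel n) (qCoord φ j) p (vert φ i p) = 0 := by
  rw [mvfderiv_qCoord hφ hp, vert_eq, (isCoord_inducedChart hφ).mvfderiv_coordVec hp]
  simp

lemma mvfderiv_qCoord_dqField (hφ : φ ∈ IsManifold.maximalAtlas (𝓡 n) ∞ M) {p : Cotangent n M}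
    (hp : p.proj ∈ φ.source) (i j : Fin n) :
    mvfderiv (cotModel n) (qCoord φ j) p (dqField φ i p) = kron i j := by
  rw [mvfderiv_qCoord hφ hp, dqField_eq, (isCoord_inducedChart hφ).mvfderiv_coordVec hp]
  simp [kron, eq_comm]

lemma mvfderiv_pCoord_vert (hφ : φ ∈ IsManifold.maximalAtlas (𝓡 n) ∞ M) {p : Cotangent n M}
    (hp : p.proj ∈ φ.source) (i j : Fin n) :
    mvfderiv (cotModel n) (pCoord φ j) p (vert φ i p) = kron i j := by
  rw [mvfderiv_pCoord hφ hp, vert_eq, (isCoord_inducedChart hφ).mvfderiv_coordVec hp]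
  simp [kron, eq_comm]

lemma mvfderiv_pCoord_dqField (hφ : φ ∈ IsManifold.maximalAtlas (𝓡 n) ∞ M) {p : Cotangent n M}
    (hp : p.proj ∈ φ.source) (i j : Fin n) :
    mvfderiv (cotModel n) (pCoord φ j) p (dqField φ i p) = 0 := by
  rw [mvfderiv_pCoord hφ hp, dqField_eq, (isCoord_inducedChart hφ).mvfderiv_coordVec hp]
  simp

lemma cotangent_expand (hφ : φ ∈ IsManifold.maximalAtlas (𝓡 n) ∞ M) {p : Cotangent n M}
    (hp : p.proj ∈ φ.source) (X : TangentSpace (cotModel n) p) :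
    X = ∑ i, mvfderiv (cotModel n) (qCoord φ i) p X • dqField φ i p
      + ∑ i, mvfderiv (cotModel n) (pCoord φ i) p X • vert φ i p := by
  conv_lhs => rw [← (isCoord_inducedChart hφ).coordVec_mvfderiv hp X]
  have key : ∀ z : Model n × Model n, z
      = ∑ i, z.1 i • ((EuclideanSpace.single i (1 : ℝ), 0) : Model n × Model n)
        + ∑ i, z.2 i • ((0, EuclideanSpace.single i (1 : ℝ)) : Model n × Model n) := by
    rintro ⟨a, b⟩
    refine Prod.ext ?_ ?_ <;> ext k <;>
      simp [Prod.fst_sum, Prod.snd_sum, Pi.single_apply]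
  rw [key (mvfderiv (cotModel n) (inducedChart φ) p X), IsCoord.coordVec_add,
    IsCoord.coordVec_sum, IsCoord.coordVec_sum]
  simp only [IsCoord.coordVec_smul, ← mvfderiv_qCoord hφ hp, ← mvfderiv_pCoord hφ hp]
  rfl

lemma mvfderiv_comp_proj (hφ : φ ∈ IsManifold.maximalAtlas (𝓡 n) ∞ M) {p : Cotangent n M}
    (hp : p.proj ∈ φ.source) {f : M → ℝ} (hf : MDifferentiableAt (𝓡 n) 𝓘(ℝ) f p.proj)
    (X : TangentSpace (cotModel n) p) :
    mvfderiv (cotModel n) (fun p : Cotangent n M => f p.proj) p X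
      = ∑ a, partialBase φ a f p.proj * mvfderiv (cotModel n) (qCoord φ a) p X := by
  have hπ : MDifferentiableAt (cotModel n) (𝓡 n) (fun p : Cotangent n M => p.proj) p :=
    (contMDiffAt_cotangent_proj p).mdifferentiableAt (by simp)
  -- Kept general in `f`: the chain rule through π is used for the given function and, read
  -- backwards, for each coordinate function.
  have h1 := fun (f : M → ℝ) (hf : MDifferentiableAt (𝓡 n) 𝓘(ℝ) f p.proj) =>
    mvfderiv_comp_apply (I := 𝓡 n) (I' := cotModel n) p (f := fun p : Cotangent n M => p.proj)
      (g := f) hf hπ X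
  have h2 := h1 f hf
  rw [tangent_expand hφ hp (mfderiv (cotModel n) (𝓡 n) (fun p : Cotangent n M => p.proj) p X)]
    at h2
  refine h2.trans ?_
  rw [map_sum]
  refine Finset.sum_congr rfl fun a _ => ?_
  rw [map_smul, smul_eq_mul, mul_comm]
  congr 1
  exact (h1 _ (mdifferentiableAt_chart_apply hφ hp a)).symm

lemma contMDiffAt_vert (hφ : φ ∈ IsManifold.maximalAtlas (𝓡 n) ∞ M) {p : Cotangent n M}
    (hp : p.proj ∈ φ.source) (i : Fin n) :
    ContMDiffAt (cotModel n) (cotModel n).tangent ∞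
      (fun q => (⟨q, vert φ i q⟩ : TangentBundle (cotModel n) (Cotangent n M))) p :=
  (isCoord_inducedChart hφ).contMDiffAt_coordVec hp _

lemma contMDiffAt_dqField (hφ : φ ∈ IsManifold.maximalAtlas (𝓡 n) ∞ M) {p : Cotangent n M}
    (hp : p.proj ∈ φ.source) (i : Fin n) :
    ContMDiffAt (cotModel n) (cotModel n).tangent ∞
      (fun q => (⟨q, dqField φ i q⟩ : TangentBundle (cotModel n) (Cotangent n M))) p :=
  (isCoord_inducedChart hφ).contMDiffAt_coordVec hp _

lemma mlieBracket_vert_vert (hφ : φ ∈ IsManifold.maximalAtlas (𝓡 n) ∞ M) {p : Cotangent n M}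
    (hp : p.proj ∈ φ.source) (i j : Fin n) :
    VectorField.mlieBracket (cotModel n) (vert φ i) (vert φ j) p = 0 :=
  (isCoord_inducedChart hφ).mlieBracket_coordVec hp _ _

lemma mlieBracket_vert_dqField (hφ : φ ∈ IsManifold.maximalAtlas (𝓡 n) ∞ M) {p : Cotangent n M}
    (hp : p.proj ∈ φ.source) (i j : Fin n) :
    VectorField.mlieBracket (cotModel n) (vert φ i) (dqField φ j) p = 0 :=
  (isCoord_inducedChart hφ).mlieBracket_coordVec hp _ _

lemma mlieBracket_dqField_dqField (hφ : φ ∈ IsManifold.maximalAtlas (𝓡 n) ∞ M)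
    {p : Cotangent n M} (hp : p.proj ∈ φ.source) (i j : Fin n) :
    VectorField.mlieBracket (cotModel n) (dqField φ i) (dqField φ j) p = 0 :=
  (isCoord_inducedChart hφ).mlieBracket_coordVec hp _ _

/-! ### Brackets and covariant derivatives of combinations of vector fields. -/

lemma mdifferentiableAt_sum_smul {E H X ι : Type*} [NormedAddCommGroup E] [NormedSpace ℝ E]
    [TopologicalSpace H] {I : ModelWithCorners ℝ E H} [TopologicalSpace X] [ChartedSpace H X]
    [IsManifold I ∞ X] {A : Finset ι} {f : ι → X → ℝ} {V : ι → ∀ x : X, TangentSpace I x} {x : X}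
    (hf : ∀ i ∈ A, MDifferentiableAt I 𝓘(ℝ) (f i) x)
    (hV : ∀ i ∈ A, MDifferentiableAt I I.tangent
      (fun x => (⟨x, V i x⟩ : TangentBundle I X)) x) :
    MDifferentiableAt I I.tangent
      (fun x => (⟨x, (∑ i ∈ A, f i • V i) x⟩ : TangentBundle I X)) x := by
  have : IsManifold I 1 X := IsManifold.of_le (n := ∞) (by simp)
  have h := MDifferentiableAt.sum_section (s := A) (t := fun i => f i • V i)
    fun i hi => (hf i hi).smul_section (hV i hi)
  simpa only [Finset.sum_apply] using h

/-- The Lie bracket with a combination of vector fields. -/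
lemma mlieBracket_sum_smul {E H X ι : Type*} [NormedAddCommGroup E] [NormedSpace ℝ E]
    [CompleteSpace E]
    [TopologicalSpace H] {I : ModelWithCorners ℝ E H} [TopologicalSpace X] [ChartedSpace H X]
    [IsManifold I ∞ X] {A : Finset ι} {f : ι → X → ℝ} {V : ι → ∀ x : X, TangentSpace I x} {x : X}
    (hf : ∀ i ∈ A, MDifferentiableAt I 𝓘(ℝ) (f i) x)
    (hV : ∀ i ∈ A, MDifferentiableAt I I.tangent
      (fun x => (⟨x, V i x⟩ : TangentBundle I X)) x) (W : ∀ x : X, TangentSpace I x) :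
    VectorField.mlieBracket I W (∑ i ∈ A, f i • V i) x
      = ∑ i ∈ A, (mvfderiv I (f i) x (W x) • V i x
          + f i x • VectorField.mlieBracket I W (V i) x) := by
  classical
  have : IsManifold I (minSmoothness ℝ 2) X := by
    rw [minSmoothness_of_isRCLikeNormedField]
    exact IsManifold.of_le (n := ∞) IsCoord.two_le_infty
  have : IsManifold I 1 X := IsManifold.of_le (n := ∞) (by simp)
  induction A using Finset.induction_on with
  | empty => simp
  | insert a A ha ih =>
    have hf' := fun i hi => hf i (Finset.mem_insert_of_mem hi)
    have hV' := fun i hi => hV i (Finset.mem_insert_of_mem hi)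
    have ha' := Finset.mem_insert_self a A
    rw [Finset.sum_insert ha, Finset.sum_insert ha, VectorField.mlieBracket_add_right,
      VectorField.mlieBracket_smul_right (hf a ha') (hV a ha'), ih hf' hV']
    · exact (hf a ha').smul_section (hV a ha')
    · exact mdifferentiableAt_sum_smul hf' hV'

/-- The covariant derivative of a combination of vector fields. -/
lemma covariantDerivative_sum_smul {E H X ι : Type*} [NormedAddCommGroup E] [NormedSpace ℝ E]
    [TopologicalSpace H] {I : ModelWithCorners ℝ E H} [TopologicalSpace X] [ChartedSpace H X]
    [IsManifold I ∞ X]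
    (nabla : CovariantDerivative I E (TangentSpace I : X → Type _))
    {A : Finset ι} {f : ι → X → ℝ} {V : ι → ∀ x : X, TangentSpace I x} {x : X}
    (hf : ∀ i ∈ A, MDifferentiableAt I 𝓘(ℝ) (f i) x)
    (hV : ∀ i ∈ A, MDifferentiableAt I I.tangent
      (fun x => (⟨x, V i x⟩ : TangentBundle I X)) x) (w : TangentSpace I x) :
    nabla (∑ i ∈ A, f i • V i) x w
      = ∑ i ∈ A, (mvfderiv I (f i) x w • V i x + f i x • nabla (V i) x w) := by
  classical
  have : IsManifold I 1 X := IsManifold.of_le (n := ∞) (by simp)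
  have hn := nabla.isCovariantDerivativeOnUniv
  induction A using Finset.induction_on with
  | empty => simp
  | insert a A ha ih =>
    have hf' := fun i hi => hf i (Finset.mem_insert_of_mem hi)
    have hV' := fun i hi => hV i (Finset.mem_insert_of_mem hi)
    have ha' := Finset.mem_insert_self a A
    rw [Finset.sum_insert ha, Finset.sum_insert ha, hn.add, hn.leibniz (hV a ha') (hf a ha'),
      add_apply, ih hf' hV']
    · simp [add_comm]
    · exact (hf a ha').smul_section (hV a ha')
    · exact mdifferentiableAt_sum_smul hf' hV'

end NaturalLift

end

noncomputable section

namespace NaturalLift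

/-! Smoothness of the entries of an inverse matrix, and sums with the Kronecker symbol. -/

section MatrixSmooth

variable {E H X : Type*} [NormedAddCommGroup E] [NormedSpace ℝ E] [TopologicalSpace H]
  {I : ModelWithCorners ℝ E H} [TopologicalSpace X] [ChartedSpace H X] {s : Set X} {n : ℕ}

lemma contMDiffOn_det {A : X → Matrix (Fin n) (Fin n) ℝ}
    (hA : ∀ i j, ContMDiffOn I 𝓘(ℝ) ∞ (fun x => A x i j) s) :
    ContMDiffOn I 𝓘(ℝ) ∞ (fun x => (A x).det) s := by
  simp only [Matrix.det_apply']
  refine contMDiffOn_finsetSum fun σ _ => contMDiffOn_const.mul ?_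
  exact contMDiffOn_finsetProd fun i _ => hA _ _

/-- Cramer's rule: an entry of the inverse is a quotient of determinants, hence smooth in the
entries of the matrix. -/
lemma contMDiffOn_inv_apply {A : X → Matrix (Fin n) (Fin n) ℝ}
    (hA : ∀ i j, ContMDiffOn I 𝓘(ℝ) ∞ (fun x => A x i j) s) (hdet : ∀ x ∈ s, (A x).det ≠ 0)
    (i j : Fin n) : ContMDiffOn I 𝓘(ℝ) ∞ (fun x => (A x)⁻¹ i j) s := by
  have h1 : (fun x => (A x)⁻¹ i j)
      = fun x => (A x).det⁻¹ * ((A x).updateRow j (Pi.single i 1)).det := by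
    ext x
    rw [Matrix.inv_def, Ring.inverse_eq_inv', Matrix.smul_apply, Matrix.adjugate_apply,
      smul_eq_mul]
  rw [h1]
  refine ((contMDiffOn_det hA).inv₀ hdet).mul (contMDiffOn_det fun k l => ?_)
  by_cases hk : k = j
  · subst hk
    simpa using contMDiffOn_const
  · simpa [Matrix.updateRow_ne hk] using hA k l

end MatrixSmooth

section Kron

variable {n : ℕ}

@[simp] lemma sum_kron_mul (i : Fin n) (f : Fin n → ℝ) : ∑ j, kron i j * f j = f i := by
  simp [kron]

@[simp] lemma sum_kron_mul' (i : Fin n) (f : Fin n → ℝ) : ∑ j, kron j i * f j = f i := by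
  simp [kron]

@[simp] lemma sum_mul_kron (i : Fin n) (f : Fin n → ℝ) : ∑ j, f j * kron i j = f i := by
  simp [kron]

@[simp] lemma sum_mul_kron' (i : Fin n) (f : Fin n → ℝ) : ∑ j, f j * kron j i = f i := by
  simp [kron]

/-- A matrix with a left inverse can be cancelled. -/
lemma eq_of_sum_mul_eq {A B : Fin n → Fin n → ℝ}
    (hBA : ∀ i j, ∑ k, B i k * A k j = kron i j) {f g : Fin n → ℝ}
    (h : ∀ k, ∑ j, A k j * f j = ∑ j, A k j * g j) (i : Fin n) : f i = g i := by
  have key : ∀ f : Fin n → ℝ, f i = ∑ k, B i k * ∑ j, A k j * f j := by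
    intro f
    simp only [Finset.mul_sum]
    rw [Finset.sum_comm]
    simp only [← mul_assoc, ← Finset.sum_mul, hBA, sum_kron_mul]
  rw [key f, key g]
  simp only [h]

end Kron

/-! ### Partial derivatives and changes of charts on the base manifold. -/

section Base

variable {n : ℕ} {M : Type*} [TopologicalSpace M] [ChartedSpace (Model n) M]
  {φ ψ : Chart n M}

lemma partialBase_fun_mul {f h : M → ℝ} {x : M} (hf : MDifferentiableAt (𝓡 n) 𝓘(ℝ) f x)
    (hh : MDifferentiableAt (𝓡 n) 𝓘(ℝ) h x) (i : Fin n) :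
    partialBase φ i (fun x => f x * h x) x = f x * partialBase φ i h x
      + h x * partialBase φ i f x := by
  simp [partialBase, mvfderiv_fun_mul hf hh]

lemma partialBase_fun_sum {ι : Type*} {A : Finset ι} {f : ι → M → ℝ} {x : M}
    (hf : ∀ i ∈ A, MDifferentiableAt (𝓡 n) 𝓘(ℝ) (f i) x) (k : Fin n) :
    partialBase φ k (fun x => ∑ i ∈ A, f i x) x = ∑ i ∈ A, partialBase φ k (f i) x :=
  mvfderiv_sum hf _

lemma partialBase_congr {f h : M → ℝ} {s : Set M} (hs : IsOpen s) {x : M} (hx : x ∈ s)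
    (H : ∀ y ∈ s, f y = h y) (i : Fin n) : partialBase φ i f x = partialBase φ i h x := by
  have h1 : f =ᶠ[nhds x] h := by
    filter_upwards [hs.mem_nhds hx] with y hy using H y hy
  rw [partialBase, partialBase, mvfderiv, mvfderiv, h1.mfderiv_eq, H x hx]

/-! The Jacobian matrix of a change of charts. -/

/-- The partial derivatives `∂y^a/∂x^i` of the coordinates of `ψ` with respect to those of `φ`. -/
def jac (φ ψ : Chart n M) (a i : Fin n) (x : M) : ℝ := partialBase φ i (fun x => ψ x a) x

/-- Chain rule for ∂y^a/∂y^b, expanded through the coordinates of `φ`. -/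
lemma jac_mul_jac (hφ : φ ∈ IsManifold.maximalAtlas (𝓡 n) ∞ M)
    (hψ : ψ ∈ IsManifold.maximalAtlas (𝓡 n) ∞ M) {x : M} (hx : x ∈ φ.source)
    (hx' : x ∈ ψ.source) (a b : Fin n) :
    ∑ i, jac φ ψ a i x * jac ψ φ i b x = kron a b := by
  have h := partialBase_change hφ hx ψ b (fun x => ψ x a)
  rw [partialBase_chart_apply hψ hx'] at h
  rw [kron_comm, h]
  simp only [jac, mul_comm]

lemma coordField_jac (hψ : ψ ∈ IsManifold.maximalAtlas (𝓡 n) ∞ M) {x : M} (hx : x ∈ ψ.source)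
    (φ : Chart n M) (i : Fin n) :
    coordField φ i x = ∑ a, jac φ ψ a i x • coordField ψ a x :=
  coordField_change hψ hx φ i

lemma partialBase_jac (hψ : ψ ∈ IsManifold.maximalAtlas (𝓡 n) ∞ M) {x : M} (hx : x ∈ ψ.source)
    (φ : Chart n M) (i : Fin n) (f : M → ℝ) :
    partialBase φ i f x = ∑ a, jac φ ψ a i x * partialBase ψ a f x :=
  partialBase_change hψ hx φ i f

/-- On the overlap the coordinate functions of `ψ` are smooth on the whole domain of the coordinate
system, so the commutation of coordinate derivatives applies to them; this yields
`partialBase_jac_symm`. -/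
lemma isCoord_chart_inter (hφ : φ ∈ IsManifold.maximalAtlas (𝓡 n) ∞ M) (ψ : Chart n M) :
    IsCoord (𝓡 n) φ φ.symm (φ.source ∩ ψ.source) (φ.target ∩ φ.symm ⁻¹' ψ.source) := by
  have h := isCoord_chart hφ
  exact
    { isOpen_source := φ.open_source.inter ψ.open_source
      isOpen_target := φ.isOpen_inter_preimage_symm ψ.open_source
      mapsTo := fun y hy => ⟨h.mapsTo hy.1, by simpa [φ.left_inv hy.1] using hy.2⟩
      mapsTo_inv := fun y hy => ⟨h.mapsTo_inv hy.1, hy.2⟩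
      left_inv := fun y hy => h.left_inv y hy.1
      right_inv := fun y hy => h.right_inv y hy.1
      contMDiffOn := h.contMDiffOn.mono Set.inter_subset_left
      contMDiffOn_inv := h.contMDiffOn_inv.mono Set.inter_subset_left }

lemma contMDiffAt_jac (hφ : φ ∈ IsManifold.maximalAtlas (𝓡 n) ∞ M)
    (hψ : ψ ∈ IsManifold.maximalAtlas (𝓡 n) ∞ M) {x : M} (hx : x ∈ φ.source)
    (hx' : x ∈ ψ.source) (a i : Fin n) : ContMDiffAt (𝓡 n) 𝓘(ℝ) ∞ (jac φ ψ a i) x :=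
  ((isCoord_chart_inter hφ ψ).contMDiffOn_mvfderiv
    ((contMDiffOn_chart_apply hψ a).mono Set.inter_subset_right)
    (EuclideanSpace.single i (1 : ℝ))).contMDiffAt
      ((φ.open_source.inter ψ.open_source).mem_nhds ⟨hx, hx'⟩)

lemma partialBase_jac_symm (hφ : φ ∈ IsManifold.maximalAtlas (𝓡 n) ∞ M)
    (hψ : ψ ∈ IsManifold.maximalAtlas (𝓡 n) ∞ M) {x : M} (hx : x ∈ φ.source)
    (hx' : x ∈ ψ.source) (a i j : Fin n) :
    partialBase φ j (jac φ ψ a i) x = partialBase φ i (jac φ ψ a j) x :=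
  (isCoord_chart_inter hφ ψ).mvfderiv_comm
    ((contMDiffOn_chart_apply hψ a).mono Set.inter_subset_right) ⟨hx, hx'⟩ _ _

end Base

variable {n : ℕ} {M : Type*} [TopologicalSpace M] [ChartedSpace (Model n) M]
  [IsManifold (𝓡 n) ∞ M] {φ ψ : Chart n M} {g : Metric n M}

/-! The metric and its inverse in a chart. -/

lemma gLow_symm (g : Metric n M) (φ : Chart n M) (i j : Fin n) (x : M) :
    gLow g φ i j x = gLow g φ j i x := g.symm x _ _

lemma contMDiffOn_gLow (hφ : φ ∈ IsManifold.maximalAtlas (𝓡 n) ∞ M) (i j : Fin n) :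
    ContMDiffOn (𝓡 n) 𝓘(ℝ) ∞ (gLow g φ i j) φ.source := by
  intro x hx
  have h := ContMDiffAt.clm_bundle_apply₂ (b := fun x : M => x) (x := x)
    (E₃ := Bundle.Trivial M ℝ) (g.contMDiff x)
    (contMDiffAt_coordField hφ hx i) (contMDiffAt_coordField hφ hx j)
  rw [contMDiffAt_totalSpace] at h
  exact h.2.contMDiffWithinAt

lemma mdifferentiableAt_gLow (hφ : φ ∈ IsManifold.maximalAtlas (𝓡 n) ∞ M) {x : M}
    (hx : x ∈ φ.source) (i j : Fin n) : MDifferentiableAt (𝓡 n) 𝓘(ℝ) (gLow g φ i j) x :=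
  (isCoord_chart hφ).mdifferentiableAt_of_contMDiffOn (contMDiffOn_gLow hφ i j) hx

lemma inner_coordField_sum (g : Metric n M) (φ : Chart n M) (x : M) (c d : Fin n → ℝ) :
    g.inner x (∑ i, c i • coordField φ i x) (∑ j, d j • coordField φ j x)
      = ∑ i, ∑ j, c i * d j * gLow g φ i j x := by
  simp only [map_sum, map_smul, sum_apply, smul_apply, smul_eq_mul, gLow, Finset.mul_sum]
  rw [Finset.sum_comm]
  refine Finset.sum_congr rfl fun i _ => Finset.sum_congr rfl fun j _ => ?_
  ring

lemma posDef_gLow (hφ : φ ∈ IsManifold.maximalAtlas (𝓡 n) ∞ M) {x : M} (hx : x ∈ φ.source) :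
    (Matrix.of fun i j => gLow g φ i j x).PosDef := by
  refine Matrix.PosDef.of_dotProduct_mulVec_pos ?_ fun c hc => ?_
  · ext i j
    exact gLow_symm g φ j i x
  · have hv : ∑ i, c i • coordField φ i x ≠ 0 := by
      intro h0
      apply hc
      ext k
      have h1 := congrArg (mvfderiv (𝓡 n) (fun x => φ x k) x) h0
      have h2 : ∀ i, mvfderiv (𝓡 n) (fun x => φ x k) x (coordField φ i x) = kron i k :=
        fun i => partialBase_chart_apply hφ hx i k
      simp only [map_sum, map_smul, h2, smul_eq_mul, sum_mul_kron', map_zero] at h1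
      exact h1
    have h := g.pos x _ hv
    rw [inner_coordField_sum] at h
    refine h.trans_eq ?_
    simp only [dotProduct, Matrix.mulVec, Finset.mul_sum]
    refine Finset.sum_congr rfl fun i _ => Finset.sum_congr rfl fun j _ => ?_
    change c i * c j * gLow g φ i j x = c i * (gLow g φ i j x * c j)
    ring

lemma gUp_mul_gLow (hφ : φ ∈ IsManifold.maximalAtlas (𝓡 n) ∞ M) {x : M} (hx : x ∈ φ.source)
    (i j : Fin n) : ∑ k, gUp g φ i k x * gLow g φ k j x = kron i j := by
  have h := Matrix.nonsing_inv_mul (Matrix.of fun i j => gLow g φ i j x)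
    (posDef_gLow hφ hx).det_pos.ne'.isUnit
  have h' := congrFun (congrFun h i) j
  rw [Matrix.mul_apply, Matrix.one_apply] at h'
  exact h'

lemma gLow_mul_gUp (hφ : φ ∈ IsManifold.maximalAtlas (𝓡 n) ∞ M) {x : M} (hx : x ∈ φ.source)
    (i j : Fin n) : ∑ k, gLow g φ i k x * gUp g φ k j x = kron i j := by
  have h := Matrix.mul_nonsing_inv (Matrix.of fun i j => gLow g φ i j x)
    (posDef_gLow hφ hx).det_pos.ne'.isUnit
  have h' := congrFun (congrFun h i) j
  rw [Matrix.mul_apply, Matrix.one_apply] at h'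
  exact h'

lemma gUp_symm (g : Metric n M) (φ : Chart n M) (i j : Fin n) (x : M) :
    gUp g φ i j x = gUp g φ j i x := by
  have h : (Matrix.of fun i j => gLow g φ i j x).transpose = Matrix.of fun i j => gLow g φ i j x := by
    ext i j
    exact gLow_symm g φ j i x
  have h2 := Matrix.transpose_nonsing_inv (Matrix.of fun i j => gLow g φ i j x)
  rw [h] at h2
  exact congrFun (congrFun h2 j) i

lemma contMDiffOn_gUp (hφ : φ ∈ IsManifold.maximalAtlas (𝓡 n) ∞ M) (i j : Fin n) :
    ContMDiffOn (𝓡 n) 𝓘(ℝ) ∞ (gUp g φ i j) φ.source :=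
  contMDiffOn_inv_apply (fun i j => contMDiffOn_gLow hφ i j)
    (fun _ hx => (posDef_gLow hφ hx).det_pos.ne') i j

lemma contMDiffOn_christoffel (hφ : φ ∈ IsManifold.maximalAtlas (𝓡 n) ∞ M) (k i j : Fin n) :
    ContMDiffOn (𝓡 n) 𝓘(ℝ) ∞ (christoffel g φ k i j) φ.source := by
  have h := fun i j k => contMDiffOn_partialBase hφ (contMDiffOn_gLow (g := g) hφ i j) k
  refine contMDiffOn_const.mul (contMDiffOn_finsetSum fun l _ => (contMDiffOn_gUp hφ k l).mul ?_)
  exact ((h _ _ _).add (h _ _ _)).sub (h _ _ _)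

lemma contMDiffOn_curvature (hφ : φ ∈ IsManifold.maximalAtlas (𝓡 n) ∞ M) (h k i j : Fin n) :
    ContMDiffOn (𝓡 n) 𝓘(ℝ) ∞ (curvature g φ h k i j) φ.source := by
  have hc := fun k i j => contMDiffOn_christoffel (g := g) hφ k i j
  refine ((contMDiffOn_partialBase hφ (hc _ _ _) _).sub
    (contMDiffOn_partialBase hφ (hc _ _ _) _)).add (contMDiffOn_finsetSum fun l _ => ?_)
  exact ((hc _ _ _).mul (hc _ _ _)).sub ((hc _ _ _).mul (hc _ _ _))

lemma christoffel_symm (g : Metric n M) (φ : Chart n M) (k i j : Fin n) :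
    christoffel g φ k i j = christoffel g φ k j i := by
  have h : gLow g φ i j = gLow g φ j i := funext fun x => gLow_symm g φ i j x
  ext x
  simp only [christoffel, h]
  congr 1
  refine Finset.sum_congr rfl fun l _ => ?_
  ring

/-- Christoffel symbols of the first kind. -/
lemma gLow_mul_christoffel (hφ : φ ∈ IsManifold.maximalAtlas (𝓡 n) ∞ M) {x : M}
    (hx : x ∈ φ.source) (l i j : Fin n) :
    ∑ k, gLow g φ l k x * christoffel g φ k i j x
      = (1 / 2) * (partialBase φ i (gLow g φ l j) x + partialBase φ j (gLow g φ l i) x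
        - partialBase φ l (gLow g φ i j) x) := by
  simp only [christoffel, Finset.mul_sum]
  rw [Finset.sum_comm]
  have : ∀ m k, gLow g φ l k x * ((1 / 2) * (gUp g φ k m x *
      (partialBase φ i (gLow g φ m j) x + partialBase φ j (gLow g φ m i) x
        - partialBase φ m (gLow g φ i j) x)))
      = gLow g φ l k x * gUp g φ k m x * ((1 / 2) *
      (partialBase φ i (gLow g φ m j) x + partialBase φ j (gLow g φ m i) x
        - partialBase φ m (gLow g φ i j) x)) := fun m k => by ring
  simp only [this, ← Finset.sum_mul, gLow_mul_gUp hφ hx, sum_kron_mul]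

/-- The Levi-Civita connection of `g` is metric. -/
lemma partialBase_gLow (hφ : φ ∈ IsManifold.maximalAtlas (𝓡 n) ∞ M) {x : M}
    (hx : x ∈ φ.source) (k i j : Fin n) :
    partialBase φ k (gLow g φ i j) x
      = ∑ h, gLow g φ h j x * christoffel g φ h k i x
        + ∑ h, gLow g φ i h x * christoffel g φ h k j x := by
  have hs : ∀ i j, gLow g φ i j = gLow g φ j i := fun i j => funext fun x => gLow_symm g φ i j x
  have h1 : ∑ h, gLow g φ h j x * christoffel g φ h k i x
      = ∑ h, gLow g φ j h x * christoffel g φ h k i x := by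
    simp only [hs j]
  rw [h1, gLow_mul_christoffel hφ hx, gLow_mul_christoffel hφ hx, hs j i, hs i k, hs k j]
  ring

end NaturalLift

end

noncomputable section

namespace NaturalLift

/-! Index computations. -/

section Arrays

variable {n : ℕ}

lemma sum_rotate (f : Fin n → Fin n → Fin n → ℝ) :
    ∑ a, ∑ b, ∑ c, f a b c = ∑ c, ∑ a, ∑ b, f a b c :=
  (Finset.sum_congr rfl fun _ _ => Finset.sum_comm).trans Finset.sum_comm

/-- The transformation law of the Christoffel symbols, from that of the metric. -/
lemma christoffel_change_aux {A B G g : Fin n → Fin n → ℝ} {D dG dg Γ Γ' : Fin n → Fin n → Fin n → ℝ}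
    {H : Fin n → Fin n → ℝ}
    (hG : ∀ a b, G a b = G b a) (hD : ∀ a i k, D a i k = D a k i)
    (hAB : ∀ i j, ∑ a, A i a * B a j = kron i j)
    (hHG : ∀ i j, ∑ a, H i a * G a j = kron i j)
    (hg : ∀ i j, g i j = ∑ a, ∑ b, A a i * A b j * G a b)
    (hdg : ∀ k i j, dg k i j = ∑ a, ∑ b, (D a i k * A b j * G a b + A a i * D b j k * G a b
      + A a i * A b j * ∑ m, A m k * dG m a b))
    (hΓ : ∀ l i j, ∑ k, g l k * Γ k i j = (1 / 2) * (dg i l j + dg j l i - dg l i j))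
    (hΓ' : ∀ l i j, ∑ k, G l k * Γ' k i j = (1 / 2) * (dG i l j + dG j l i - dG l i j))
    (l i j : Fin n) :
    ∑ k, A l k * Γ k i j = D l i j + ∑ a, ∑ b, A a i * A b j * Γ' l a b := by
  have hS : ∀ k i j, dg k i j = ∑ c, A c j * ∑ a, G c a * D a i k
      + ∑ c, A c i * ∑ a, G c a * D a j k
      + ∑ a, ∑ b, A a i * A b j * ∑ m, A m k * dG m a b := by
    intro k i j
    rw [hdg]
    simp only [Finset.sum_add_distrib, Finset.mul_sum]
    congr 2
    · rw [Finset.sum_comm]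
      refine Finset.sum_congr rfl fun a _ => Finset.sum_congr rfl fun b _ => ?_
      rw [hG a b]; ring
    · refine Finset.sum_congr rfl fun a _ => Finset.sum_congr rfl fun b _ => ?_
      ring
  have hT1 : ∀ i l j, ∑ a, ∑ b, A a l * A b j * ∑ m, A m i * dG m a b
      = ∑ c, A c l * ∑ a, ∑ b, A a i * A b j * dG a c b := by
    intro i l j
    simp only [Finset.mul_sum]
    refine Finset.sum_congr rfl fun c _ => ?_
    rw [Finset.sum_comm]
    refine Finset.sum_congr rfl fun b _ => Finset.sum_congr rfl fun a _ => ?_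
    ring
  have hT2 : ∀ i l j, ∑ a, ∑ b, A a l * A b i * ∑ m, A m j * dG m a b
      = ∑ c, A c l * ∑ a, ∑ b, A a i * A b j * dG b c a := by
    intro i l j
    simp only [Finset.mul_sum]
    refine Finset.sum_congr rfl fun c _ => Finset.sum_congr rfl fun b _ =>
      Finset.sum_congr rfl fun a _ => ?_
    ring
  have hT3 : ∀ i l j, ∑ a, ∑ b, A a i * A b j * ∑ m, A m l * dG m a b
      = ∑ c, A c l * ∑ a, ∑ b, A a i * A b j * dG c a b := by
    intro i l j
    simp only [Finset.mul_sum]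
    rw [sum_rotate]
    refine Finset.sum_congr rfl fun c _ => Finset.sum_congr rfl fun b _ =>
      Finset.sum_congr rfl fun a _ => ?_
    ring
  -- Both the metric `G` and the Jacobian `A` can be cancelled, so the identity is tested after
  -- lowering `l` with `G` and contracting with `A`. There the left side is the first-kind
  -- Christoffel symbol of `g`.
  refine eq_of_sum_mul_eq (A := G) hHG (f := fun l => ∑ k, A l k * Γ k i j)
    (g := fun l => D l i j + ∑ a, ∑ b, A a i * A b j * Γ' l a b) (fun c => ?_) l
  refine eq_of_sum_mul_eq (A := fun l c => A c l) (B := fun i j => B j i)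
    (f := fun c => ∑ d, G c d * ∑ k, A d k * Γ k i j)
    (g := fun c => ∑ d, G c d * (D d i j + ∑ a, ∑ b, A a i * A b j * Γ' d a b)) ?_ (fun l => ?_) c
  · intro i j
    simpa only [mul_comm, kron_comm] using hAB j i
  · have e1 : ∑ c, A c l * ∑ d, G c d * ∑ k, A d k * Γ k i j = ∑ k, g l k * Γ k i j := by
      simp only [hg, Finset.mul_sum, Finset.sum_mul]
      rw [sum_rotate]
      refine Finset.sum_congr rfl fun c _ => Finset.sum_congr rfl fun b _ =>
        Finset.sum_congr rfl fun a _ => ?_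
      ring
    have e2 : ∀ c, ∑ d, G c d * ∑ a, ∑ b, A a i * A b j * Γ' d a b
        = ∑ a, ∑ b, A a i * A b j * ((1 / 2) * (dG a c b + dG b c a - dG c a b)) := by
      intro c
      simp only [← hΓ', Finset.mul_sum]
      rw [← sum_rotate]
      refine Finset.sum_congr rfl fun c _ => Finset.sum_congr rfl fun b _ =>
        Finset.sum_congr rfl fun a _ => ?_
      ring
    have e3 : ∀ c, ∑ a, ∑ b, A a i * A b j * ((1 / 2) * (dG a c b + dG b c a - dG c a b))
        = (1 / 2) * (∑ a, ∑ b, A a i * A b j * dG a c b + ∑ a, ∑ b, A a i * A b j * dG b c a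
          - ∑ a, ∑ b, A a i * A b j * dG c a b) := by
      intro c
      simp only [mul_sub, mul_add, Finset.sum_add_distrib, Finset.sum_sub_distrib,
        Finset.mul_sum]
      simp only [mul_left_comm]
    rw [e1, hΓ, hS, hS, hS]
    simp only [mul_add, Finset.sum_add_distrib, e2, e3, hT1 i l j, hT2 i l j, hT3 i l j]
    have e4 : ∑ x, A x l * (1 / 2 * (∑ a, ∑ b, A a i * A b j * dG a x b
        + ∑ a, ∑ b, A a i * A b j * dG b x a - ∑ a, ∑ b, A a i * A b j * dG x a b))
        = 1 / 2 * (∑ c, A c l * ∑ a, ∑ b, A a i * A b j * dG a c b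
          + ∑ c, A c l * ∑ a, ∑ b, A a i * A b j * dG b c a
          - ∑ c, A c l * ∑ a, ∑ b, A a i * A b j * dG c a b) := by
      rw [← Finset.sum_add_distrib, ← Finset.sum_sub_distrib, Finset.mul_sum]
      refine Finset.sum_congr rfl fun c _ => ?_
      ring
    -- Of the six terms with second derivatives `D`, four cancel by symmetry of `D` and the
    -- remaining two coincide, which absorbs the factor 1/2.
    simp only [e4, hD _ l i, hD _ l j, hD _ j i]
    ring

/-- The derivative of the inverse of a matrix with parallel entries is parallel. -/
lemma inverse_parallel {G H dG dH Γ : Fin n → Fin n → ℝ}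
    (hG : ∀ i j, G i j = G j i)
    (hHG : ∀ i j, ∑ k, H i k * G k j = kron i j)
    (hd : ∀ i j, ∑ k, (H i k * dG k j + G k j * dH i k) = 0)
    (hdG : ∀ i j, dG i j = ∑ h, G h j * Γ h i + ∑ h, G i h * Γ h j) (i j : Fin n) :
    dH i j = -(∑ h, Γ i h * H h j) - ∑ h, Γ j h * H i h := by
  refine eq_of_sum_mul_eq (A := G) hHG (f := fun j => dH i j)
    (g := fun j => -(∑ h, Γ i h * H h j) - ∑ h, Γ j h * H i h) (fun l => ?_) j
  have hGH : ∀ h, ∑ j, H h j * G l j = kron h l := fun h => by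
    rw [← hHG h l]
    simp only [hG l]
  -- The differentiated relation HG = 1, solved for the derivative of `H`.
  have h1 : ∑ j, G l j * dH i j = -∑ j, H i j * dG j l := by
    have := hd i l
    rw [Finset.sum_add_distrib] at this
    simp only [hG l]
    linarith
  have h2 : ∑ j, H i j * dG j l = ∑ j, G l j * ∑ h, Γ j h * H i h + Γ i l := by
    simp only [hdG, mul_add, Finset.sum_add_distrib, Finset.mul_sum]
    congr 1
    · rw [Finset.sum_comm]
      refine Finset.sum_congr rfl fun b _ => Finset.sum_congr rfl fun a _ => ?_
      rw [hG b l]; ring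
    · rw [Finset.sum_comm]
      simp only [← mul_assoc, ← Finset.sum_mul, hHG, sum_kron_mul]
  have h3 : ∑ j, G l j * ∑ h, Γ i h * H h j = Γ i l := by
    simp only [Finset.mul_sum]
    rw [Finset.sum_comm]
    have : ∀ h j, G l j * (Γ i h * H h j) = Γ i h * (H h j * G l j) := fun h j => by ring
    simp only [this, ← Finset.mul_sum, hGH, sum_mul_kron']
  rw [h1, h2]
  simp only [mul_sub, mul_neg, Finset.sum_sub_distrib, Finset.sum_neg_distrib, h3]
  ring

/-- The lowered curvature of a metric connection is antisymmetric in its first two indices. -/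
lemma curvature_antisymm_aux {G : Fin n → Fin n → ℝ} {Γ : Fin n → Fin n → Fin n → ℝ}
    {dΓ ddG : Fin n → Fin n → Fin n → Fin n → ℝ} {dG : Fin n → Fin n → Fin n → ℝ}
    {R : Fin n → Fin n → Fin n → Fin n → ℝ}
    (hG : ∀ i j, G i j = G j i)
    (hdG : ∀ k i j, dG k i j = ∑ h, G h j * Γ h k i + ∑ h, G i h * Γ h k j)
    (hddG : ∀ i j h k, ddG i j h k
      = ∑ a, (G a k * dΓ i a j h + Γ a j h * dG i a k)
        + ∑ a, (G h a * dΓ i a j k + Γ a j k * dG i h a))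
    (hsymm : ∀ i j h k, ddG i j h k = ddG j i h k)
    (hR : ∀ h k i j, R h k i j = dΓ i h j k - dΓ j h i k
      + ∑ l, (Γ h i l * Γ l j k - Γ h j l * Γ l i k)) (h k i j : Fin n) :
    ∑ l, G h l * R l k i j = -∑ l, G k l * R l h i j := by
  -- Differentiating metric compatibility once more gives three kinds of terms: `Q` with a
  -- derivative of Γ, and two quadratic ones. `P` is the one occurring in the curvature. `W` is
  -- invariant under exchanging both index pairs, so it drops out when the two second derivatives of
  -- `G` are compared.
  set P : Fin n → Fin n → Fin n → Fin n → ℝ :=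
    fun i j h k => ∑ a, ∑ b, G b k * Γ b i a * Γ a j h with hP
  set W : Fin n → Fin n → Fin n → Fin n → ℝ :=
    fun i j h k => ∑ a, ∑ b, G a b * Γ b i k * Γ a j h with hW
  set Q : Fin n → Fin n → Fin n → Fin n → ℝ :=
    fun i j h k => ∑ a, G h a * dΓ i a j k with hQ
  have hWs : ∀ i j h k, W i j h k = W j i k h := by
    intro i j h k
    simp only [hW]
    rw [Finset.sum_comm]
    refine Finset.sum_congr rfl fun b _ => Finset.sum_congr rfl fun a _ => ?_
    rw [hG a b]; ring
  have h1 : ∀ i j h k, ∑ a, (G a k * dΓ i a j h + Γ a j h * dG i a k)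
      = Q i j k h + P i j h k + W i j h k := by
    intro i j h k
    simp only [hdG, mul_add, Finset.sum_add_distrib, Finset.mul_sum, hP, hQ, hW, add_assoc]
    congr 1
    · simp only [hG k]
    · congr 1 <;>
      · refine Finset.sum_congr rfl fun b _ => Finset.sum_congr rfl fun a _ => ?_
        ring
  have hdGs : ∀ i h a, dG i h a = dG i a h := by
    intro i h a
    rw [hdG, hdG, add_comm]
    simp only [hG a, hG h]
  have h2 : ∀ i j h k, ddG i j h k = Q i j k h + P i j h k + W i j h k
      + (Q i j h k + P i j k h + W i j k h) := by
    intro i j h k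
    rw [hddG, h1, ← h1 i j k h]
    congr 1
    refine Finset.sum_congr rfl fun a _ => ?_
    rw [hG h a, hdGs i h a]
  have h3 : ∀ h k, ∑ l, G h l * R l k i j = Q i j h k - Q j i h k + (P i j k h - P j i k h) := by
    intro h k
    simp only [hR, mul_add, mul_sub, Finset.sum_add_distrib, Finset.sum_sub_distrib,
      Finset.mul_sum, hP, hQ]
    congr 1
    congr 1 <;>
    · rw [Finset.sum_comm]
      refine Finset.sum_congr rfl fun b _ => Finset.sum_congr rfl fun a _ => ?_
      rw [hG h a]; ring
  have h4 := hsymm i j h k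
  rw [h2, h2] at h4
  rw [h3, h3]
  linarith [hWs i j h k, hWs i j k h]

/-- For a torsion-free connection the derivative terms and the quadratic terms cancel separately in
the cyclic sum, each against its copy with the lower indices exchanged. -/
lemma bianchi_aux {Γ : Fin n → Fin n → Fin n → ℝ}
    {dΓ : Fin n → Fin n → Fin n → Fin n → ℝ}
    {R : Fin n → Fin n → Fin n → Fin n → ℝ}
    (hΓ : ∀ k i j, Γ k i j = Γ k j i) (hdΓ : ∀ m k i j, dΓ m k i j = dΓ m k j i)
    (hR : ∀ h k i j, R h k i j = dΓ i h j k - dΓ j h i k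
      + ∑ l, (Γ h i l * Γ l j k - Γ h j l * Γ l i k)) (h k i j : Fin n) :
    R h k i j + R h i j k + R h j k i = 0 := by
  simp only [hR, Finset.sum_sub_distrib]
  rw [hdΓ i h k j, hdΓ j h k i, hdΓ k h j i]
  have e : ∀ a b c : Fin n, ∑ l, Γ h a l * Γ l b c = ∑ l, Γ h a l * Γ l c b := fun a b c =>
    Finset.sum_congr rfl fun l _ => by rw [hΓ l b c]
  linarith [e i k j, e j k i, e k j i]

/-- An algebraic curvature tensor with vanishing sectional curvature is zero. -/
lemma eq_zero_of_sectional_eq_zero {D : Fin n → Fin n → Fin n → Fin n → ℝ}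
    (h12 : ∀ h k i j, D h k i j = -D k h i j) (h34 : ∀ h k i j, D h k i j = -D h k j i)
    (hB : ∀ h k i j, D h k i j + D h i j k + D h j k i = 0)
    (hsec : ∀ ξ η : Fin n → ℝ, ∑ h, ∑ k, ∑ i, ∑ j, D h k i j * ξ i * η j * η k * ξ h = 0)
    (h k i j : Fin n) : D h k i j = 0 := by
  -- Pair symmetry follows from the two antisymmetries by adding the four cyclic identities.
  have hpair : ∀ h k i j, D h k i j = D i j h k := by
    intro h k i j
    linarith [hB h k i j, hB k i j h, hB i j h k, hB j h k i, h12 h k i j, h12 h k j i,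
      h12 h i j k, h12 h i k j, h12 h j k i, h12 h j i k, h12 k i j h, h12 k i h j, h12 k j h i,
      h12 k j i h, h12 i j h k, h12 i j k h, h34 h k i j, h34 h i j k, h34 h j k i,
      h34 k i j h, h34 k j h i, h34 k h i j, h34 i j h k, h34 i h k j, h34 i k j h, h34 j i h k,
      h34 j h k i, h34 j k i h]
  -- Polarisation in both vectors: inclusion–exclusion over ξ among e_a, e_c, e_a + e_c and η among
  -- e_b, e_d, e_b + e_d.
  have hbas : ∀ a b c d : Fin n, D a b c d + D a d c b + D c b a d + D c d a b = 0 := by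
    intro a b c d
    have key := fun x y : Fin n → ℝ => hsec x y
    have e1 := key (fun m => kron a m) (fun m => kron b m)
    have e2 := key (fun m => kron a m) (fun m => kron d m)
    have e3 := key (fun m => kron c m) (fun m => kron b m)
    have e4 := key (fun m => kron c m) (fun m => kron d m)
    have e5 := key (fun m => kron a m) (fun m => kron b m + kron d m)
    have e6 := key (fun m => kron c m) (fun m => kron b m + kron d m)
    have e7 := key (fun m => kron a m + kron c m) (fun m => kron b m)
    have e8 := key (fun m => kron a m + kron c m) (fun m => kron d m)
    have e9 := key (fun m => kron a m + kron c m) (fun m => kron b m + kron d m)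
    simp only [mul_add, add_mul, Finset.sum_add_distrib, sum_mul_kron, ← Finset.sum_mul]
      at e1 e2 e3 e4 e5 e6 e7 e8 e9
    linarith
  -- Pair symmetry identifies the four terms of `hbas` two by two.
  have hlin : ∀ a b c d : Fin n, D a b c d = -D a d c b := by
    intro a b c d
    linarith [hbas a b c d, hpair a b c d, hpair a d c b]
  -- Antisymmetry in the second and fourth indices, with that in the last two, makes `D` invariant
  -- under cyclic permutation of `k, i, j`; the cyclic identity then reads 3D = 0.
  linarith [hB h k i j, hlin h k i j, hlin h i j k, hlin h j k i, h34 h k i j, h34 h i j k,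
    h34 h j k i, h34 h k j i, h34 h j i k, h34 h i k j]

end Arrays

end NaturalLift

end

noncomputable section

namespace NaturalLift

variable {n : ℕ} {M : Type*} [TopologicalSpace M] [ChartedSpace (Model n) M]
  [IsManifold (𝓡 n) ∞ M] {φ ψ : Chart n M} {g : Metric n M}

lemma mdifferentiableAt_fun_mul {E H X : Type*} [NormedAddCommGroup E] [NormedSpace ℝ E]
    [TopologicalSpace H] {I : ModelWithCorners ℝ E H} [TopologicalSpace X] [ChartedSpace H X]
    {f h : X → ℝ} {x : X} (hf : MDifferentiableAt I 𝓘(ℝ) f x)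
    (hh : MDifferentiableAt I 𝓘(ℝ) h x) : MDifferentiableAt I 𝓘(ℝ) (fun x => f x * h x) x :=
  hf.mul hh

/-! Change of charts on the base manifold, and curvature. -/

omit [IsManifold (𝓡 n) ∞ M] in
lemma mdifferentiableAt_jac (hφ : φ ∈ IsManifold.maximalAtlas (𝓡 n) ∞ M)
    (hψ : ψ ∈ IsManifold.maximalAtlas (𝓡 n) ∞ M) {x : M} (hx : x ∈ φ.source)
    (hx' : x ∈ ψ.source) (a i : Fin n) : MDifferentiableAt (𝓡 n) 𝓘(ℝ) (jac φ ψ a i) x :=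
  (contMDiffAt_jac hφ hψ hx hx' a i).mdifferentiableAt (by simp)

lemma gLow_change (hψ : ψ ∈ IsManifold.maximalAtlas (𝓡 n) ∞ M) {x : M} (hx : x ∈ ψ.source)
    (φ : Chart n M) (i j : Fin n) :
    gLow g φ i j x = ∑ a, ∑ b, jac φ ψ a i x * jac φ ψ b j x * gLow g ψ a b x := by
  rw [← inner_coordField_sum, ← coordField_jac hψ hx, ← coordField_jac hψ hx]
  rfl

lemma partialBase_gLow_change (hφ : φ ∈ IsManifold.maximalAtlas (𝓡 n) ∞ M)
    (hψ : ψ ∈ IsManifold.maximalAtlas (𝓡 n) ∞ M) {x : M} (hx : x ∈ φ.source)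
    (hx' : x ∈ ψ.source) (k i j : Fin n) :
    partialBase φ k (gLow g φ i j) x = ∑ a, ∑ b,
      (partialBase φ k (jac φ ψ a i) x * jac φ ψ b j x * gLow g ψ a b x
        + jac φ ψ a i x * partialBase φ k (jac φ ψ b j) x * gLow g ψ a b x
        + jac φ ψ a i x * jac φ ψ b j x
          * ∑ m, jac φ ψ m k x * partialBase ψ m (gLow g ψ a b) x) := by
  have hj := fun a i => mdifferentiableAt_jac hφ hψ hx hx' a i
  have hg := fun a b => mdifferentiableAt_gLow (g := g) hψ hx' a b
  rw [partialBase_congr ψ.open_source hx' (fun y hy => gLow_change hψ hy φ i j),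
    partialBase_fun_sum fun a _ => mdifferentiableAt_fun_sum fun b _ =>
      mdifferentiableAt_fun_mul (mdifferentiableAt_fun_mul (hj a i) (hj b j)) (hg a b)]
  refine Finset.sum_congr rfl fun a _ => ?_
  rw [partialBase_fun_sum fun b _ => mdifferentiableAt_fun_mul (mdifferentiableAt_fun_mul (hj a i) (hj b j)) (hg a b)]
  refine Finset.sum_congr rfl fun b _ => ?_
  rw [partialBase_fun_mul (mdifferentiableAt_fun_mul (hj a i) (hj b j)) (hg a b), partialBase_fun_mul (hj a i) (hj b j),
    ← partialBase_jac hψ hx']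
  ring

/-- The transformation law of the Christoffel symbols. -/
lemma christoffel_change (hφ : φ ∈ IsManifold.maximalAtlas (𝓡 n) ∞ M)
    (hψ : ψ ∈ IsManifold.maximalAtlas (𝓡 n) ∞ M) {x : M} (hx : x ∈ φ.source)
    (hx' : x ∈ ψ.source) (l i j : Fin n) :
    ∑ k, jac φ ψ l k x * christoffel g φ k i j x = partialBase φ j (jac φ ψ l i) x
      + ∑ a, ∑ b, jac φ ψ a i x * jac φ ψ b j x * christoffel g ψ l a b x :=
  christoffel_change_aux (A := fun a i => jac φ ψ a i x) (B := fun a i => jac ψ φ a i x)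
    (G := fun a b => gLow g ψ a b x) (g := fun a b => gLow g φ a b x)
    (H := fun a b => gUp g ψ a b x)
    (D := fun l i j => partialBase φ j (jac φ ψ l i) x)
    (dG := fun k i j => partialBase ψ k (gLow g ψ i j) x)
    (dg := fun k i j => partialBase φ k (gLow g φ i j) x)
    (Γ := fun k i j => christoffel g φ k i j x) (Γ' := fun k i j => christoffel g ψ k i j x)
    (fun a b => gLow_symm g ψ a b x) (fun a i k => partialBase_jac_symm hφ hψ hx hx' a i k)
    (jac_mul_jac hφ hψ hx hx') (gUp_mul_gLow hψ hx') (gLow_change hψ hx' φ)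
    (partialBase_gLow_change hφ hψ hx hx')
    (gLow_mul_christoffel hφ hx) (gLow_mul_christoffel hψ hx') l i j

lemma mdifferentiableAt_gUp (hφ : φ ∈ IsManifold.maximalAtlas (𝓡 n) ∞ M) {x : M}
    (hx : x ∈ φ.source) (i j : Fin n) : MDifferentiableAt (𝓡 n) 𝓘(ℝ) (gUp g φ i j) x :=
  (isCoord_chart hφ).mdifferentiableAt_of_contMDiffOn (contMDiffOn_gUp hφ i j) hx

lemma mdifferentiableAt_christoffel (hφ : φ ∈ IsManifold.maximalAtlas (𝓡 n) ∞ M) {x : M}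
    (hx : x ∈ φ.source) (k i j : Fin n) :
    MDifferentiableAt (𝓡 n) 𝓘(ℝ) (christoffel g φ k i j) x :=
  (isCoord_chart hφ).mdifferentiableAt_of_contMDiffOn (contMDiffOn_christoffel hφ k i j) hx

omit [IsManifold (𝓡 n) ∞ M] in
lemma partialBase_const (φ : Chart n M) (k : Fin n) (c : ℝ) (x : M) :
    partialBase φ k (fun _ => c) x = 0 := by
  simp [partialBase, mvfderiv_const]

lemma partialBase_gUp (hφ : φ ∈ IsManifold.maximalAtlas (𝓡 n) ∞ M) {x : M}
    (hx : x ∈ φ.source) (k i j : Fin n) :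
    partialBase φ k (gUp g φ i j) x = -(∑ h, christoffel g φ i k h x * gUp g φ h j x)
      - ∑ h, christoffel g φ j k h x * gUp g φ i h x := by
  refine inverse_parallel (G := fun i j => gLow g φ i j x) (H := fun i j => gUp g φ i j x)
    (dG := fun i j => partialBase φ k (gLow g φ i j) x)
    (dH := fun i j => partialBase φ k (gUp g φ i j) x)
    (Γ := fun i h => christoffel g φ i k h x) (fun i j => gLow_symm g φ i j x)
    (gUp_mul_gLow hφ hx) (fun i j => ?_) (fun i j => partialBase_gLow hφ hx k i j) i j
  have hu := fun i j => mdifferentiableAt_gUp (g := g) hφ hx i j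
  have hl := fun i j => mdifferentiableAt_gLow (g := g) hφ hx i j
  have h1 := partialBase_congr (φ := φ) φ.open_source hx
    (fun y hy => gUp_mul_gLow (g := g) hφ hy i j) k
  rw [partialBase_const, partialBase_fun_sum fun a _ => mdifferentiableAt_fun_mul (hu i a) (hl a j)] at h1
  rw [← h1]
  exact Finset.sum_congr rfl fun a _ => (partialBase_fun_mul (hu i a) (hl a j) k).symm

lemma curvature_swap (g : Metric n M) (φ : Chart n M) (h k i j : Fin n) (x : M) :
    curvature g φ h k i j x = -curvature g φ h k j i x := by
  simp only [curvature, Finset.sum_sub_distrib]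
  ring

lemma curvature_bianchi (g : Metric n M) (φ : Chart n M) (h k i j : Fin n) (x : M) :
    curvature g φ h k i j x + curvature g φ h i j k x + curvature g φ h j k i x = 0 :=
  bianchi_aux (Γ := fun k i j => christoffel g φ k i j x)
    (dΓ := fun m k i j => partialBase φ m (christoffel g φ k i j) x)
    (R := fun h k i j => curvature g φ h k i j x)
    (fun k i j => by rw [christoffel_symm]) (fun m k i j => by rw [christoffel_symm])
    (fun _ _ _ _ => rfl) h k i j

/-- The lowered curvature tensor is antisymmetric in its first two indices. -/
lemma curvature_antisymm (hφ : φ ∈ IsManifold.maximalAtlas (𝓡 n) ∞ M) {x : M}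
    (hx : x ∈ φ.source) (h k i j : Fin n) :
    ∑ l, gLow g φ h l x * curvature g φ l k i j x
      = -∑ l, gLow g φ k l x * curvature g φ l h i j x := by
  refine curvature_antisymm_aux (G := fun i j => gLow g φ i j x)
    (Γ := fun k i j => christoffel g φ k i j x)
    (dΓ := fun m k i j => partialBase φ m (christoffel g φ k i j) x)
    (dG := fun k i j => partialBase φ k (gLow g φ i j) x)
    (ddG := fun i j h k => partialBase φ i (partialBase φ j (gLow g φ h k)) x)
    (R := fun h k i j => curvature g φ h k i j x)
    (fun i j => gLow_symm g φ i j x) (partialBase_gLow hφ hx) (fun i j h k => ?_)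
    (fun i j h k => partialBase_comm hφ (contMDiffOn_gLow hφ h k) hx i j)
    (fun _ _ _ _ => rfl) h k i j
  have hΓ := fun k i j => mdifferentiableAt_christoffel (g := g) hφ hx k i j
  have hl := fun i j => mdifferentiableAt_gLow (g := g) hφ hx i j
  have hd1 : ∀ a, MDifferentiableAt (𝓡 n) 𝓘(ℝ)
      (fun y => gLow g φ a k y * christoffel g φ a j h y) x := fun a => (hl a k).mul (hΓ a j h)
  have hd2 : ∀ a, MDifferentiableAt (𝓡 n) 𝓘(ℝ)
      (fun y => gLow g φ h a y * christoffel g φ a j k y) x := fun a => (hl h a).mul (hΓ a j k)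
  rw [partialBase_congr φ.open_source hx (fun y hy => partialBase_gLow hφ hy j h k), partialBase,
    mvfderiv_fun_add (mdifferentiableAt_fun_sum fun a _ => hd1 a)
      (mdifferentiableAt_fun_sum fun a _ => hd2 a), add_apply]
  have e1 := partialBase_fun_sum (φ := φ) (A := Finset.univ) (fun a _ => hd1 a) i
  have e2 := partialBase_fun_sum (φ := φ) (A := Finset.univ) (fun a _ => hd2 a) i
  rw [partialBase] at e1 e2
  rw [e1, e2]
  congr 1
  · exact Finset.sum_congr rfl fun a _ => partialBase_fun_mul (hl a k) (hΓ a j h) i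
  · exact Finset.sum_congr rfl fun a _ => partialBase_fun_mul (hl h a) (hΓ a j k) i

/-- The curvature tensor of a manifold of constant sectional curvature. -/
lemma curvature_of_const {c : ℝ} (hc : HasConstantSectionalCurvature g c)
    (hφ : φ ∈ IsManifold.maximalAtlas (𝓡 n) ∞ M) {x : M}
    (hx : x ∈ φ.source) (h k i j : Fin n) :
    curvature g φ h k i j x = c * (kron h i * gLow g φ k j x - kron h j * gLow g φ k i x) := by
  have hs := fun i j => gLow_symm g φ i j x
  -- The difference between the lowered curvature and the constant curvature model is an algebraic
  -- curvature tensor with zero sectional curvature. The four arguments are its two antisymmetries,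
  -- its cyclic identity and the hypothesis on `g`.
  have hD := eq_zero_of_sectional_eq_zero
    (D := fun h k i j => ∑ l, gLow g φ h l x * curvature g φ l k i j x
      - c * (gLow g φ h i x * gLow g φ k j x - gLow g φ h j x * gLow g φ k i x))
    (fun h k i j => by
      simp only [curvature_antisymm hφ hx h k i j]
      ring)
    (fun h k i j => by
      simp only [curvature_swap g φ _ k i j, mul_neg, Finset.sum_neg_distrib]
      ring)
    (fun h k i j => by
      have e : ∑ l, gLow g φ h l x * curvature g φ l k i j x
          + ∑ l, gLow g φ h l x * curvature g φ l i j k x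
          + ∑ l, gLow g φ h l x * curvature g φ l j k i x = 0 := by
        simp only [← Finset.sum_add_distrib, ← mul_add, curvature_bianchi, mul_zero,
          Finset.sum_const_zero]
      rw [hs k j, hs k i, hs i j]
      linarith)
    (fun ξ η => by
      have e := hc φ hφ x hx ξ η
      have e1 : ∑ h, ∑ k, ∑ i, ∑ j, (∑ l, gLow g φ h l x * curvature g φ l k i j x)
          * ξ i * η j * η k * ξ h = ∑ h, ∑ l, ∑ k, ∑ i, ∑ j,
            gLow g φ h l x * curvature g φ l k i j x * ξ i * η j * η k * ξ h := by
        simp only [Finset.sum_mul]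
        refine Finset.sum_congr rfl fun h _ => ?_
        refine Eq.trans ?_ Finset.sum_comm
        exact Finset.sum_congr rfl fun k _ => sum_rotate _
      have e2 : (∑ i, ∑ j, gLow g φ i j x * ξ i * ξ j) * (∑ i, ∑ j, gLow g φ i j x * η i * η j)
          = ∑ h, ∑ k, ∑ i, ∑ j, gLow g φ h i x * gLow g φ k j x * ξ i * η j * η k * ξ h := by
        simp only [Finset.sum_mul_sum]
        refine Finset.sum_congr rfl fun h _ => Finset.sum_congr rfl fun k _ =>
          Finset.sum_congr rfl fun i _ => Finset.sum_congr rfl fun j _ => ?_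
        ring
      have e3 : ∑ i, ∑ j, gLow g φ i j x * ξ i * η j = ∑ k, ∑ i, gLow g φ k i x * η k * ξ i := by
        rw [Finset.sum_comm]
        refine Finset.sum_congr rfl fun k _ => Finset.sum_congr rfl fun i _ => ?_
        rw [hs k i]; ring
      have e4 : (∑ i, ∑ j, gLow g φ i j x * ξ i * η j) ^ 2
          = ∑ h, ∑ k, ∑ i, ∑ j, gLow g φ h j x * gLow g φ k i x * ξ i * η j * η k * ξ h := by
        rw [sq]
        nth_rewrite 2 [e3]
        simp only [Finset.sum_mul_sum]
        refine Finset.sum_congr rfl fun h _ => Finset.sum_congr rfl fun k _ => ?_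
        rw [Finset.sum_comm]
        refine Finset.sum_congr rfl fun i _ => Finset.sum_congr rfl fun j _ => ?_
        ring
      rw [← e1, e2, e4, ← sub_eq_zero] at e
      rw [← e]
      simp only [mul_sub, Finset.mul_sum, ← Finset.sum_sub_distrib]
      refine Finset.sum_congr rfl fun h _ => Finset.sum_congr rfl fun k _ =>
        Finset.sum_congr rfl fun i _ => Finset.sum_congr rfl fun j _ => ?_
      ring)
  -- The first index is raised again by cancelling the metric.
  refine eq_of_sum_mul_eq (A := fun i j => gLow g φ i j x) (gUp_mul_gLow hφ hx)
    (f := fun h => curvature g φ h k i j x)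
    (g := fun h => c * (kron h i * gLow g φ k j x - kron h j * gLow g φ k i x))
    (fun m => ?_) h
  have e1 := sub_eq_zero.1 (hD m k i j)
  rw [e1]
  have e2 : ∀ l, gLow g φ m l x * (c * (kron l i * gLow g φ k j x - kron l j * gLow g φ k i x))
      = gLow g φ m l x * kron l i * (c * gLow g φ k j x)
        - gLow g φ m l x * kron l j * (c * gLow g φ k i x) := fun l => by ring
  simp only [e2, Finset.sum_sub_distrib, ← Finset.sum_mul, sum_mul_kron']
  ring

end NaturalLift

end

noncomputable section

namespace NaturalLift

/-! ### Rules of calculus for functions, compositions with functions on [0, ∞), and combinations of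
fields. -/

section General

variable {E H X : Type*} [NormedAddCommGroup E] [NormedSpace ℝ E]
  [TopologicalSpace H] {I : ModelWithCorners ℝ E H} [TopologicalSpace X] [ChartedSpace H X]
  {f h : X → ℝ} {x : X}

lemma mdifferentiableAt_of_smooth {F : Type*} [NormedAddCommGroup F] [NormedSpace ℝ F]
    {f : X → F} (hf : ContMDiffAt I 𝓘(ℝ, F) ∞ f x) : MDifferentiableAt I 𝓘(ℝ, F) f x :=
  hf.mdifferentiableAt (by simp)

lemma mvfderiv_mul_apply (hf : ContMDiffAt I 𝓘(ℝ) ∞ f x) (hh : ContMDiffAt I 𝓘(ℝ) ∞ h x)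
    (v : TangentSpace I x) :
    mvfderiv I (fun x => f x * h x) x v = f x * mvfderiv I h x v + h x * mvfderiv I f x v := by
  rw [mvfderiv_fun_mul (mdifferentiableAt_of_smooth hf) (mdifferentiableAt_of_smooth hh)]
  rfl

lemma mvfderiv_add_apply (hf : ContMDiffAt I 𝓘(ℝ) ∞ f x) (hh : ContMDiffAt I 𝓘(ℝ) ∞ h x)
    (v : TangentSpace I x) :
    mvfderiv I (fun x => f x + h x) x v = mvfderiv I f x v + mvfderiv I h x v := by
  rw [mvfderiv_fun_add (mdifferentiableAt_of_smooth hf) (mdifferentiableAt_of_smooth hh)]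
  rfl

lemma mvfderiv_sum_apply {ι : Type*} {A : Finset ι} {f : ι → X → ℝ}
    (hf : ∀ i, ContMDiffAt I 𝓘(ℝ) ∞ (f i) x) (v : TangentSpace I x) :
    mvfderiv I (fun x => ∑ i ∈ A, f i x) x v = ∑ i ∈ A, mvfderiv I (f i) x v :=
  mvfderiv_sum (fun i _ => mdifferentiableAt_of_smooth (hf i)) v

lemma mvfderiv_congr_of_isOpen {s : Set X} (hs : IsOpen s) (hx : x ∈ s)
    (H : ∀ y ∈ s, f y = h y) : mvfderiv I f x = mvfderiv I h x := by
  have h1 : f =ᶠ[nhds x] h := by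
    filter_upwards [hs.mem_nhds hx] with y hy using H y hy
  rw [mvfderiv, mvfderiv, h1.mfderiv_eq, H x hx]

/-- Chain rule for a function on `[0, ∞)`. -/
lemma mvfderiv_comp_nonneg {u : ℝ → ℝ} (hu : ContDiffOn ℝ ∞ u (Set.Ici 0))
    (hf : ContMDiffAt I 𝓘(ℝ) ∞ f x) (hf0 : ∀ y, 0 ≤ f y) (v : TangentSpace I x) :
    mvfderiv I (fun y => u (f y)) x v = deriv0 u (f x) * mvfderiv I f x v := by
  have h1 : HasDerivWithinAt u (deriv0 u (f x)) (Set.Ici 0) (f x) :=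
    ((hu.differentiableOn (by simp)) (f x) (hf0 x)).hasDerivWithinAt
  have h2 : HasMFDerivWithinAt 𝓘(ℝ) 𝓘(ℝ) u (Set.Ici 0) (f x) _ :=
    h1.hasFDerivWithinAt.hasMFDerivWithinAt
  -- As `f` never leaves [0, ∞), the one-sided derivative of `u` composes with the derivative of `f`
  -- within the whole space. The result is a full derivative, also at points where `f` vanishes.
  have h3 := (mdifferentiableAt_of_smooth hf).hasMFDerivAt.hasMFDerivWithinAt (s := Set.univ)
  have h4 := (h2.comp x h3 (fun y _ => hf0 y))
  rw [hasMFDerivWithinAt_univ] at h4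
  have h5 := congrArg (fun L => L v) h4.mfderiv
  refine h5.trans ?_
  change mvfderiv I f x v * deriv0 u (f x) = _
  exact mul_comm _ _

/-- Smoothness of `u` on the closed half-line is enough, since `f` maps the whole space into it; on
T*M this covers the zero section. -/
lemma contMDiffAt_comp_nonneg {u : ℝ → ℝ} (hu : ContDiffOn ℝ ∞ u (Set.Ici 0))
    (hf : ContMDiffAt I 𝓘(ℝ) ∞ f x) (hf0 : ∀ y, 0 ≤ f y) :
    ContMDiffAt I 𝓘(ℝ) ∞ (fun y => u (f y)) x := by
  have h1 := (hu.contMDiffOn (f x) (hf0 x)).comp (s := Set.univ) x hf.contMDiffWithinAt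
    (fun y _ => hf0 y)
  rwa [contMDiffWithinAt_univ] at h1

lemma sum_smul_neg_sum_smul {V ι : Type*} [Fintype ι] [AddCommGroup V] [Module ℝ V]
    (v : ι → V) (a c : ι → ℝ) (d : ι → ι → ℝ) :
    ∑ h, (a h • v h + c h • -(∑ k, d h k • v k)) = ∑ k, (a k - ∑ h, c h * d h k) • v k := by
  simp only [smul_neg, Finset.smul_sum, smul_smul, sub_smul, Finset.sum_smul,
    Finset.sum_add_distrib, Finset.sum_sub_distrib, Finset.sum_neg_distrib]
  rw [Finset.sum_comm (f := fun k h => (c h * d h k) • v k), sub_eq_add_neg]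

lemma map_add_sum_smul {V ι : Type*} [Fintype ι] [AddCommGroup V] [Module ℝ V]
    [TopologicalSpace V] (L : V →L[ℝ] ℝ) (v₀ : V) (a : ι → ℝ) (v : ι → V) :
    L (v₀ + ∑ i, a i • v i) = L v₀ + ∑ i, a i * L (v i) := by
  simp

variable {ι : Type*} [Fintype ι] [IsManifold I ∞ X]

lemma mdifferentiableAt_add_sum_smul {a : ι → X → ℝ} {V : ι → ∀ x : X, TangentSpace I x}
    {V₀ : ∀ x : X, TangentSpace I x} (ha : ∀ i, MDifferentiableAt I 𝓘(ℝ) (a i) x)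
    (hV₀ : MDifferentiableAt I I.tangent (fun x => (⟨x, V₀ x⟩ : TangentBundle I X)) x)
    (hV : ∀ i, MDifferentiableAt I I.tangent (fun x => (⟨x, V i x⟩ : TangentBundle I X)) x) :
    MDifferentiableAt I I.tangent
      (fun x => (⟨x, V₀ x + ∑ i, a i x • V i x⟩ : TangentBundle I X)) x := by
  have : IsManifold I 1 X := IsManifold.of_le (n := ∞) (by simp)
  have h := mdifferentiableAt_add_section hV₀
    (mdifferentiableAt_sum_smul (A := Finset.univ) (fun i _ => ha i) (fun i _ => hV i))
  simpa only [Pi.add_apply, Finset.sum_apply, Pi.smul_apply'] using h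

lemma mlieBracket_add_sum_smul [CompleteSpace E] {a : ι → X → ℝ}
    {V : ι → ∀ x : X, TangentSpace I x}
    {V₀ : ∀ x : X, TangentSpace I x} (ha : ∀ i, MDifferentiableAt I 𝓘(ℝ) (a i) x)
    (hV₀ : MDifferentiableAt I I.tangent (fun x => (⟨x, V₀ x⟩ : TangentBundle I X)) x)
    (hV : ∀ i, MDifferentiableAt I I.tangent (fun x => (⟨x, V i x⟩ : TangentBundle I X)) x)
    (W : ∀ x : X, TangentSpace I x) :
    VectorField.mlieBracket I W (fun x => V₀ x + ∑ i, a i x • V i x) x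
      = VectorField.mlieBracket I W V₀ x + ∑ i, (mvfderiv I (a i) x (W x) • V i x
          + a i x • VectorField.mlieBracket I W (V i) x) := by
  have : IsManifold I (minSmoothness ℝ 2) X := by
    rw [minSmoothness_of_isRCLikeNormedField]
    exact IsManifold.of_le (n := ∞) IsCoord.two_le_infty
  have : IsManifold I 1 X := IsManifold.of_le (n := ∞) (by simp)
  have h0 : (fun x => V₀ x + ∑ i, a i x • V i x) = V₀ + ∑ i, a i • V i := by
    funext y
    simp only [Pi.add_apply, Finset.sum_apply, Pi.smul_apply']
  rw [h0, VectorField.mlieBracket_add_right hV₀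
    (mdifferentiableAt_sum_smul (fun i _ => ha i) (fun i _ => hV i)),
    mlieBracket_sum_smul (fun i _ => ha i) (fun i _ => hV i)]

end General

variable {n : ℕ} {M : Type*} [TopologicalSpace M] [ChartedSpace (Model n) M]
  [IsManifold (𝓡 n) ∞ M] {φ ψ : Chart n M} {g : Metric n M} {p : Cotangent n M}

/-! The adapted frame of the cotangent bundle. -/

lemma isOpen_cotangent_source (φ : Chart n M) : IsOpen {p : Cotangent n M | p.proj ∈ φ.source} :=
  φ.open_source.preimage (contMDiff_proj (n := 0) (IB := 𝓡 n)
    (fun x : M => TangentSpace (𝓡 n) x →L[ℝ] Bundle.Trivial M ℝ x)).continuous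

lemma contMDiffAt_comp_proj_of_contMDiffOn {f : M → ℝ}
    (hf : ContMDiffOn (𝓡 n) 𝓘(ℝ) ∞ f φ.source) (hp : p.proj ∈ φ.source) :
    ContMDiffAt (cotModel n) 𝓘(ℝ) ∞ (fun p : Cotangent n M => f p.proj) p :=
  contMDiffAt_comp_proj (hf.contMDiffAt (φ.open_source.mem_nhds hp))

variable (hφ : φ ∈ IsManifold.maximalAtlas (𝓡 n) ∞ M) (hp : p.proj ∈ φ.source)
include hφ hp

lemma contMDiffAt_christoffel0 (i j : Fin n) :
    ContMDiffAt (cotModel n) 𝓘(ℝ) ∞ (christoffel0 g φ i j) p :=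
  contMDiffAt_finsetSum fun k _ => (contMDiffAt_pCoord hφ hp k).mul
    (contMDiffAt_comp_proj_of_contMDiffOn (contMDiffOn_christoffel hφ k i j) hp)

lemma contMDiffAt_curvature0 (k i j : Fin n) :
    ContMDiffAt (cotModel n) 𝓘(ℝ) ∞ (curvature0 g φ k i j) p :=
  contMDiffAt_finsetSum fun h _ => (contMDiffAt_pCoord hφ hp h).mul
    (contMDiffAt_comp_proj_of_contMDiffOn (contMDiffOn_curvature hφ h k i j) hp)

lemma contMDiffAt_gUp0 (i : Fin n) :
    ContMDiffAt (cotModel n) 𝓘(ℝ) ∞ (gUp0 g φ i) p :=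
  contMDiffAt_finsetSum fun h _ => (contMDiffAt_pCoord hφ hp h).mul
    (contMDiffAt_comp_proj_of_contMDiffOn (contMDiffOn_gUp hφ h i) hp)

lemma mvfderiv_qCoord_horiz (i j : Fin n) :
    mvfderiv (cotModel n) (qCoord φ j) p (horiz g φ i p) = kron i j := by
  refine (map_add_sum_smul _ _ _ _).trans ?_
  simp [mvfderiv_qCoord_dqField hφ hp, mvfderiv_qCoord_vert hφ hp]

lemma mvfderiv_pCoord_horiz (i j : Fin n) :
    mvfderiv (cotModel n) (pCoord φ j) p (horiz g φ i p) = christoffel0 g φ i j p := by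
  refine (map_add_sum_smul _ _ _ _).trans ?_
  simp [mvfderiv_pCoord_dqField hφ hp, mvfderiv_pCoord_vert hφ hp]

lemma mvfderiv_proj_vert {f : M → ℝ} (hf : MDifferentiableAt (𝓡 n) 𝓘(ℝ) f p.proj) (i : Fin n) :
    mvfderiv (cotModel n) (fun p : Cotangent n M => f p.proj) p (vert φ i p) = 0 := by
  simp [mvfderiv_comp_proj hφ hp hf, mvfderiv_qCoord_vert hφ hp]

lemma mvfderiv_proj_horiz {f : M → ℝ} (hf : MDifferentiableAt (𝓡 n) 𝓘(ℝ) f p.proj) (i : Fin n) :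
    mvfderiv (cotModel n) (fun p : Cotangent n M => f p.proj) p (horiz g φ i p)
      = partialBase φ i f p.proj := by
  simp [mvfderiv_comp_proj hφ hp hf, mvfderiv_qCoord_horiz hφ hp]

/-- This and the next three evaluations say that (dq^i, Dp_i) is the coframe dual to (δ_i, ∂^i). -/
lemma dq_vert (i j : Fin n) : dq φ j p (vert φ i p) = 0 := mvfderiv_qCoord_vert hφ hp i j

lemma dq_horiz (i j : Fin n) : dq φ j p (horiz g φ i p) = kron i j :=
  mvfderiv_qCoord_horiz hφ hp i j

lemma Dp_vert (i j : Fin n) : Dp g φ j p (vert φ i p) = kron i j := by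
  simp [Dp, dq_vert hφ hp, mvfderiv_pCoord_vert hφ hp]

/-- The Γ^0 in δ_i cancels the one in Dp_j because the Christoffel symbols are symmetric in their
lower indices. -/
lemma Dp_horiz (i j : Fin n) : Dp g φ j p (horiz g φ i p) = 0 := by
  simp [Dp, dq_horiz hφ hp, mvfderiv_pCoord_horiz hφ hp, christoffel0,
    christoffel_symm g φ _ i j]

/-- Expansion of a tangent vector of `T*M` in the adapted frame. -/
lemma adapted_expand (g : Metric n M) (X : TangentSpace (cotModel n) p) :
    X = ∑ i, dq φ i p X • horiz g φ i p + ∑ i, Dp g φ i p X • vert φ i p := by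
  conv_lhs => rw [cotangent_expand hφ hp X]
  have h1 : ∑ i, dq φ i p X • ∑ h, christoffel0 g φ i h p • vert φ h p
      = ∑ i, (∑ j, christoffel0 g φ i j p * dq φ j p X) • vert φ i p := by
    simp only [Finset.smul_sum, Finset.sum_smul, smul_smul]
    rw [Finset.sum_comm]
    refine Finset.sum_congr rfl fun i _ => Finset.sum_congr rfl fun j _ => ?_
    have : christoffel0 g φ j i p = christoffel0 g φ i j p := by
      simp only [christoffel0, christoffel_symm g φ _ i j]
    rw [mul_comm, this]
  simp only [horiz, smul_add, Finset.sum_add_distrib, h1, Dp, sub_smul, Finset.sum_sub_distrib]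
  simp only [dq]
  abel

lemma mdifferentiableAt_horiz (i : Fin n) :
    MDifferentiableAt (cotModel n) (cotModel n).tangent
      (fun q => (⟨q, horiz g φ i q⟩ : TangentBundle (cotModel n) (Cotangent n M))) p := by
  exact mdifferentiableAt_add_sum_smul
    (fun h => mdifferentiableAt_of_smooth (contMDiffAt_christoffel0 (g := g) hφ hp i h))
    ((contMDiffAt_dqField hφ hp i).mdifferentiableAt (by simp))
    (fun h => (contMDiffAt_vert hφ hp h).mdifferentiableAt (by simp))

/-- Γ^0_{ij} is linear along the fibres, with coefficients Γ^k_{ij}. -/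
lemma dVert_christoffel0 (k i j : Fin n) :
    mvfderiv (cotModel n) (christoffel0 g φ i j) p (vert φ k p)
      = christoffel g φ k i j p.proj := by
  have h1 := fun m => contMDiffAt_comp_proj_of_contMDiffOn
    (contMDiffOn_christoffel (g := g) hφ m i j) hp
  have h2 := fun m => contMDiffAt_pCoord hφ hp m
  have h3 : ∀ m, mvfderiv (cotModel n)
      (fun p => pCoord φ m p * christoffel g φ m i j p.proj) p (vert φ k p)
      = christoffel g φ m i j p.proj * kron k m := fun m => by
    rw [mvfderiv_mul_apply (h2 m) (h1 m), mvfderiv_pCoord_vert hφ hp,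
      mvfderiv_proj_vert hφ hp (mdifferentiableAt_christoffel hφ hp m i j)]
    ring
  have h4 : mvfderiv (cotModel n) (christoffel0 g φ i j) p (vert φ k p) = _ :=
    mvfderiv_sum_apply (fun m => (h2 m).mul (h1 m)) _
  rw [h4]
  exact (Finset.sum_congr rfl fun m _ => h3 m).trans (by simp)

lemma mvfderiv_christoffel0_horiz (k i j : Fin n) :
    mvfderiv (cotModel n) (christoffel0 g φ i j) p (horiz g φ k p)
      = ∑ m, (pCoord φ m p * partialBase φ k (christoffel g φ m i j) p.proj
        + christoffel g φ m i j p.proj * christoffel0 g φ k m p) := by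
  have h1 := fun m => contMDiffAt_comp_proj_of_contMDiffOn
    (contMDiffOn_christoffel (g := g) hφ m i j) hp
  have h2 := fun m => contMDiffAt_pCoord hφ hp m
  have h3 : ∀ m, mvfderiv (cotModel n)
      (fun p => pCoord φ m p * christoffel g φ m i j p.proj) p (horiz g φ k p) = _ := fun m => by
    rw [mvfderiv_mul_apply (h2 m) (h1 m), mvfderiv_pCoord_horiz hφ hp,
      mvfderiv_proj_horiz hφ hp (mdifferentiableAt_christoffel hφ hp m i j)]
  have h4 : mvfderiv (cotModel n) (christoffel0 g φ i j) p (horiz g φ k p) = _ :=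
    mvfderiv_sum_apply (fun m => (h2 m).mul (h1 m)) _
  rw [h4]
  exact Finset.sum_congr rfl fun m _ => h3 m

/-- The Lie bracket of a vector field with `δ_j`. -/
lemma mlieBracket_horiz_right (g : Metric n M)
    (W : ∀ q : Cotangent n M, TangentSpace (cotModel n) q) (j : Fin n) :
    VectorField.mlieBracket (cotModel n) W (horiz g φ j) p
      = VectorField.mlieBracket (cotModel n) W (dqField φ j) p
        + ∑ h, (mvfderiv (cotModel n) (christoffel0 g φ j h) p (W p) • vert φ h p
          + christoffel0 g φ j h p • VectorField.mlieBracket (cotModel n) W (vert φ h) p) :=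
  mlieBracket_add_sum_smul
    (fun h => mdifferentiableAt_of_smooth (contMDiffAt_christoffel0 (g := g) hφ hp j h))
    ((contMDiffAt_dqField hφ hp j).mdifferentiableAt (by simp))
    (fun h => (contMDiffAt_vert hφ hp h).mdifferentiableAt (by simp)) W

lemma mlieBracket_vert_horiz (i j : Fin n) :
    VectorField.mlieBracket (cotModel n) (vert φ i) (horiz g φ j) p
      = ∑ h, christoffel g φ i j h p.proj • vert φ h p := by
  rw [mlieBracket_horiz_right hφ hp, mlieBracket_vert_dqField hφ hp, zero_add]
  refine Finset.sum_congr rfl fun h _ => ?_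
  rw [mlieBracket_vert_vert hφ hp, smul_zero, add_zero, dVert_christoffel0 hφ hp]

lemma mlieBracket_horiz_dqField (i j : Fin n) :
    VectorField.mlieBracket (cotModel n) (horiz g φ i) (dqField φ j) p
      = ∑ h, (-mvfderiv (cotModel n) (christoffel0 g φ i h) p (dqField φ j p)) • vert φ h p := by
  rw [VectorField.mlieBracket_swap_apply, mlieBracket_horiz_right hφ hp,
    mlieBracket_dqField_dqField hφ hp, zero_add, ← Finset.sum_neg_distrib]
  refine Finset.sum_congr rfl fun h _ => ?_
  rw [VectorField.mlieBracket_swap_apply, mlieBracket_vert_dqField hφ hp, neg_zero, smul_zero,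
    add_zero, neg_smul]

/-- Curvature measures the failure of the horizontal distribution to be integrable: the bracket is
vertical, and its coefficients antisymmetrise the derivatives of Γ^0 along δ_i and δ_j. -/
lemma mlieBracket_horiz_horiz (i j : Fin n) :
    VectorField.mlieBracket (cotModel n) (horiz g φ i) (horiz g φ j) p
      = ∑ h, curvature0 g φ h i j p • vert φ h p := by
  have hv : ∀ h, VectorField.mlieBracket (cotModel n) (horiz g φ i) (vert φ h) p
      = -∑ k, christoffel g φ h i k p.proj • vert φ k p := fun h => by
    rw [VectorField.mlieBracket_swap_apply, mlieBracket_vert_horiz hφ hp]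
  have hd : ∀ k, mvfderiv (cotModel n) (christoffel0 g φ i k) p (horiz g φ j p)
      = mvfderiv (cotModel n) (christoffel0 g φ i k) p (dqField φ j p)
        + ∑ h, christoffel0 g φ j h p * christoffel g φ h i k p.proj := fun k => by
    refine (map_add_sum_smul _ _ _ _).trans ?_
    simp only [dVert_christoffel0 hφ hp]
  have h1 := sum_smul_neg_sum_smul (fun h => vert φ h p)
    (fun h => mvfderiv (cotModel n) (christoffel0 g φ j h) p (horiz g φ i p))
    (fun h => christoffel0 g φ j h p) (fun h k => christoffel g φ h i k p.proj)
  rw [mlieBracket_horiz_right hφ hp, mlieBracket_horiz_dqField hφ hp]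
  simp only [hv]
  rw [h1, ← Finset.sum_add_distrib]
  refine Finset.sum_congr rfl fun k _ => ?_
  rw [← add_smul]
  congr 1
  -- Passing from ∂/∂q^j to δ_j produces a ΓΓ correction that cancels the contribution of the
  -- brackets of δ_i with the ∂^h.
  have h2 : -mvfderiv (cotModel n) (christoffel0 g φ i k) p (dqField φ j p)
      = -mvfderiv (cotModel n) (christoffel0 g φ i k) p (horiz g φ j p)
        + ∑ h, christoffel0 g φ j h p * christoffel g φ h i k p.proj := by
    rw [hd]; ring
  rw [h2, mvfderiv_christoffel0_horiz hφ hp, mvfderiv_christoffel0_horiz hφ hp]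
  have h3 : ∀ a b c : Fin n, ∑ m, christoffel g φ m a b p.proj * christoffel0 g φ c m p
      = ∑ m, pCoord φ m p * ∑ l, christoffel g φ m c l p.proj * christoffel g φ l a b p.proj :=
    fun a b c => by
      simp only [christoffel0, Finset.mul_sum]
      rw [Finset.sum_comm]
      exact Finset.sum_congr rfl fun _ _ => Finset.sum_congr rfl fun _ _ => by ring
  simp only [Finset.sum_add_distrib, h3, curvature0, curvature, mul_add, mul_sub,
    Finset.sum_sub_distrib]
  ring

end NaturalLift

end

noncomputable section

namespace NaturalLift

variable {n : ℕ} {M : Type*} [TopologicalSpace M] [ChartedSpace (Model n) M]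
  [IsManifold (𝓡 n) ∞ M] {φ ψ : Chart n M} {g : Metric n M} {u v : ℝ → ℝ} {p : Cotangent n M}

/-! The energy density and the matrices `G_{ij}`, `H^{ij}`. -/

lemma sum_gUp_mul_pCoord (g : Metric n M) (φ : Chart n M) (p : Cotangent n M) (i : Fin n) :
    ∑ k, gUp g φ i k p.proj * pCoord φ k p = gUp0 g φ i p :=
  Finset.sum_congr rfl fun k _ => by rw [gUp_symm, mul_comm]

lemma sum_gUp0_mul_pCoord (g : Metric n M) (φ : Chart n M) (p : Cotangent n M) :
    ∑ k, gUp0 g φ k p * pCoord φ k p = 2 * energy g φ p := by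
  simp only [gUp0, energy, Finset.sum_mul]
  rw [Finset.sum_comm]
  rw [← mul_assoc]
  norm_num
  exact Finset.sum_congr rfl fun i _ => Finset.sum_congr rfl fun k _ => by ring

/-- Only semidefinite, but valid at every point: outside the domain of the chart the coordinate
vectors may be dependent. -/
lemma posSemidef_gLow (g : Metric n M) (φ : Chart n M) (x : M) :
    (Matrix.of fun i j => gLow g φ i j x).PosSemidef := by
  refine Matrix.PosSemidef.of_dotProduct_mulVec_nonneg ?_ fun c => ?_
  · ext i j
    exact gLow_symm g φ j i x
  · have h : 0 ≤ g.inner x (∑ i, c i • coordField φ i x) (∑ i, c i • coordField φ i x) := by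
      rcases eq_or_ne (∑ i, c i • coordField φ i x) 0 with h0 | h0
      · simp [h0]
      · exact (g.pos x _ h0).le
    rw [inner_coordField_sum] at h
    refine h.trans_eq ?_
    simp only [dotProduct, Matrix.mulVec, Finset.mul_sum]
    refine Finset.sum_congr rfl fun i _ => Finset.sum_congr rfl fun j _ => ?_
    change c i * c j * gLow g φ i j x = c i * (gLow g φ i j x * c j)
    ring

/-- Stated for all `p`, even off the chart domain, because the rules for compositions with functions
on [0, ∞) ask for nonnegativity everywhere. -/
lemma energy_nonneg (g : Metric n M) (φ : Chart n M) (p : Cotangent n M) :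
    0 ≤ energy g φ p := by
  have h := (posSemidef_gLow g φ p.proj).inv.dotProduct_mulVec_nonneg
    (fun i => pCoord φ i p)
  have h2 : energy g φ p = (1 / 2) * (star (fun i => pCoord φ i p) ⬝ᵥ
      ((Matrix.of fun i j => gLow g φ i j p.proj)⁻¹.mulVec fun i => pCoord φ i p)) := by
    simp only [energy, dotProduct, Matrix.mulVec, Finset.mul_sum, Pi.star_apply, star_trivial]
    exact Finset.sum_congr rfl fun i _ => Finset.sum_congr rfl fun k _ => by rw [gUp]; ring
  rw [h2]
  positivity

lemma energy_eq (g : Metric n M) (φ : Chart n M) :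
    energy g φ = fun p => (1 / 2) * ∑ k, gUp0 g φ k p * pCoord φ k p := by
  funext p
  rw [sum_gUp0_mul_pCoord]
  ring

/-- The equation that characterises w: it makes the rank-one terms cancel in the product of H and G.
-/
lemma wFun_mul {t : ℝ} (hu : 0 < u t) (huv : 0 < u t + 2 * t * v t) :
    v t / u t + wFun u v t * (u t + 2 * t * v t) = 0 := by
  have h : u t * (u t + 2 * t * v t) ≠ 0 := (mul_pos hu huv).ne'
  have hu' := hu.ne'
  rw [wFun, div_mul_eq_mul_div, div_add_div _ _ hu' h, div_eq_zero_iff]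
  left
  ring

lemma contDiffOn_wFun (hu : ContDiffOn ℝ ∞ u (Set.Ici 0)) (hv : ContDiffOn ℝ ∞ v (Set.Ici 0))
    (hu_pos : ∀ t : ℝ, 0 ≤ t → 0 < u t) (huv_pos : ∀ t : ℝ, 0 ≤ t → 0 < u t + 2 * t * v t) :
    ContDiffOn ℝ ∞ (wFun u v) (Set.Ici 0) := by
  have h2 : ContDiffOn ℝ ∞ (fun t : ℝ => 2 * t) (Set.Ici 0) := by fun_prop
  exact hv.neg.div (hu.mul (hu.add (h2.mul hv)))
    fun t ht => (mul_pos (hu_pos t ht) (huv_pos t ht)).ne'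

lemma GLow_symm (g : Metric n M) (u v : ℝ → ℝ) (φ : Chart n M) (i j : Fin n) (p : Cotangent n M) :
    GLow g u v φ i j p = GLow g u v φ j i p := by
  simp only [GLow, gLow_symm g φ i j]
  ring

lemma HUp_symm (g : Metric n M) (u v : ℝ → ℝ) (φ : Chart n M) (i j : Fin n) (p : Cotangent n M) :
    HUp g u v φ i j p = HUp g u v φ j i p := by
  have h : (Matrix.of fun i j => GLow g u v φ i j p).transpose
      = Matrix.of fun i j => GLow g u v φ i j p := by
    ext i j
    exact GLow_symm g u v φ j i p
  have h2 := Matrix.transpose_nonsing_inv (Matrix.of fun i j => GLow g u v φ i j p)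
  rw [h] at h2
  exact congrFun (congrFun h2 j) i

/-! ### Derivatives of g^{0i} and of the energy density. -/

section

variable (hφ : φ ∈ IsManifold.maximalAtlas (𝓡 n) ∞ M) (hp : p.proj ∈ φ.source)
include hφ hp

lemma sum_gUp0_mul_gLow (j : Fin n) :
    ∑ k, gUp0 g φ k p * gLow g φ k j p.proj = pCoord φ j p := by
  simp only [gUp0, Finset.sum_mul]
  rw [Finset.sum_comm]
  simp only [mul_assoc, ← Finset.mul_sum, gUp_mul_gLow hφ hp, sum_mul_kron']

lemma contMDiffAt_energy : ContMDiffAt (cotModel n) 𝓘(ℝ) ∞ (energy g φ) p := by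
  rw [energy_eq]
  exact contMDiffAt_const.mul (contMDiffAt_finsetSum fun k _ =>
    (contMDiffAt_gUp0 hφ hp k).mul (contMDiffAt_pCoord hφ hp k))

lemma mvfderiv_gUp0 (i : Fin n) (X : TangentSpace (cotModel n) p) :
    mvfderiv (cotModel n) (gUp0 g φ i) p X
      = ∑ h, (pCoord φ h p * mvfderiv (cotModel n)
            (fun q : Cotangent n M => gUp g φ h i q.proj) p X
          + gUp g φ h i p.proj * mvfderiv (cotModel n) (pCoord φ h) p X) := by
  have h1 := fun h => contMDiffAt_pCoord hφ hp h
  have h2 := fun h => contMDiffAt_comp_proj_of_contMDiffOn (contMDiffOn_gUp (g := g) hφ h i) hp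
  have h3 : mvfderiv (cotModel n) (gUp0 g φ i) p X = _ :=
    mvfderiv_sum_apply (fun h => (h1 h).mul (h2 h)) X
  rw [h3]
  exact Finset.sum_congr rfl fun h _ => mvfderiv_mul_apply (h1 h) (h2 h) X

lemma mvfderiv_gUp0_vert (k i : Fin n) :
    mvfderiv (cotModel n) (gUp0 g φ i) p (vert φ k p) = gUp g φ k i p.proj := by
  rw [mvfderiv_gUp0 hφ hp]
  simp only [mvfderiv_proj_vert hφ hp (mdifferentiableAt_gUp hφ hp _ i),
    mvfderiv_pCoord_vert hφ hp]
  simp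

lemma mvfderiv_gUp0_horiz (k i : Fin n) :
    mvfderiv (cotModel n) (gUp0 g φ i) p (horiz g φ k p)
      = -∑ h, christoffel g φ i k h p.proj * gUp0 g φ h p := by
  rw [mvfderiv_gUp0 hφ hp]
  simp only [mvfderiv_proj_horiz hφ hp (mdifferentiableAt_gUp hφ hp _ i),
    mvfderiv_pCoord_horiz hφ hp, partialBase_gUp hφ hp]
  have h1 : ∑ h, pCoord φ h p * ∑ l, christoffel g φ h k l p.proj * gUp g φ l i p.proj
      = ∑ h, gUp g φ h i p.proj * christoffel0 g φ k h p := by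
    simp only [christoffel0, Finset.mul_sum]
    rw [Finset.sum_comm]
    exact Finset.sum_congr rfl fun _ _ => Finset.sum_congr rfl fun _ _ => by ring
  have h2 : ∑ h, pCoord φ h p * ∑ l, christoffel g φ i k l p.proj * gUp g φ h l p.proj
      = ∑ h, christoffel g φ i k h p.proj * gUp0 g φ h p := by
    simp only [gUp0, Finset.mul_sum]
    rw [Finset.sum_comm]
    exact Finset.sum_congr rfl fun _ _ => Finset.sum_congr rfl fun _ _ => by ring
  simp only [mul_sub, mul_neg, Finset.sum_add_distrib, Finset.sum_sub_distrib,
    Finset.sum_neg_distrib, h1, h2]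
  ring

lemma mvfderiv_energy (X : TangentSpace (cotModel n) p) :
    mvfderiv (cotModel n) (energy g φ) p X
      = (1 / 2) * ∑ k, (gUp0 g φ k p * mvfderiv (cotModel n) (pCoord φ k) p X
          + pCoord φ k p * mvfderiv (cotModel n) (gUp0 g φ k) p X) := by
  have h1 := fun h => contMDiffAt_pCoord hφ hp h
  have h2 := fun h => contMDiffAt_gUp0 (g := g) hφ hp h
  have h3 : ContMDiffAt (cotModel n) 𝓘(ℝ) ∞ (fun p => ∑ k, gUp0 g φ k p * pCoord φ k p) p :=
    contMDiffAt_finsetSum fun k _ => (h2 k).mul (h1 k)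
  have h4 : mvfderiv (cotModel n) (fun p => ∑ k, gUp0 g φ k p * pCoord φ k p) p X = _ :=
    mvfderiv_sum_apply (fun h => (h2 h).mul (h1 h)) X
  rw [energy_eq, mvfderiv_mul_apply contMDiffAt_const h3, h4]
  simp only [mvfderiv_const]
  rw [show ((0 : TangentSpace (cotModel n) p →L[ℝ] ℝ) X) = 0 from rfl, mul_zero, add_zero]
  congr 1
  exact Finset.sum_congr rfl fun h _ => mvfderiv_mul_apply (h2 h) (h1 h) X

lemma mvfderiv_energy_vert (i : Fin n) :
    mvfderiv (cotModel n) (energy g φ) p (vert φ i p) = gUp0 g φ i p := by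
  rw [mvfderiv_energy hφ hp]
  simp only [mvfderiv_gUp0_vert hφ hp, mvfderiv_pCoord_vert hφ hp, Finset.sum_add_distrib,
    sum_mul_kron]
  have : ∑ k, pCoord φ k p * gUp g φ i k p.proj = gUp0 g φ i p := by
    rw [← sum_gUp_mul_pCoord]
    exact Finset.sum_congr rfl fun _ _ => mul_comm _ _
  rw [this]
  ring

/-- The metric connection preserves the norm of covectors: the Γ^0 from δ_i p_k and the Γ from δ_i
g^{0k} cancel. -/
lemma mvfderiv_energy_horiz (i : Fin n) :
    mvfderiv (cotModel n) (energy g φ) p (horiz g φ i p) = 0 := by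
  rw [mvfderiv_energy hφ hp]
  simp only [mvfderiv_gUp0_horiz hφ hp, mvfderiv_pCoord_horiz hφ hp, Finset.sum_add_distrib]
  have : ∑ k, pCoord φ k p * -∑ h, christoffel g φ k i h p.proj * gUp0 g φ h p
      = -∑ k, gUp0 g φ k p * christoffel0 g φ i k p := by
    simp only [christoffel0, Finset.mul_sum, mul_neg, Finset.sum_neg_distrib]
    rw [Finset.sum_comm]
    congr 1
    exact Finset.sum_congr rfl fun _ _ => Finset.sum_congr rfl fun _ _ => by ring
  rw [this]
  ring

end

/-- The assumptions on the coefficient functions `u`, `v`. -/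
structure Admissible (u v : ℝ → ℝ) : Prop where
  smooth_left : ContDiffOn ℝ ∞ u (Set.Ici 0)
  smooth_right : ContDiffOn ℝ ∞ v (Set.Ici 0)
  pos : ∀ t : ℝ, 0 ≤ t → 0 < u t
  pos' : ∀ t : ℝ, 0 ≤ t → 0 < u t + 2 * t * v t

lemma deriv0_inv (h : Admissible u v) {t : ℝ} (ht : 0 ≤ t) :
    deriv0 (fun t => (u t)⁻¹) t = -deriv0 u t / u t ^ 2 :=
  derivWithin_fun_inv' ((h.smooth_left.differentiableOn (by simp)) t ht) (h.pos t ht).ne'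

/-! ### The matrix H as a rank-one perturbation, and the derivatives of G and H. -/

section

variable (hφ : φ ∈ IsManifold.maximalAtlas (𝓡 n) ∞ M) (hp : p.proj ∈ φ.source)
include hφ hp

/-- Sherman–Morrison: G is u times g plus a rank-one term, so its inverse is g⁻¹/u plus a rank-one
term. -/
lemma sum_inverse_mul_GLow (h : Admissible u v) (i j : Fin n) :
    ∑ k, (gUp g φ i k p.proj / u (energy g φ p)
      + wFun u v (energy g φ p) * gUp0 g φ i p * gUp0 g φ k p) * GLow g u v φ k j p = kron i j := by
  have ht := energy_nonneg g φ p
  have hu := h.pos _ ht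
  have h1 : ∀ k, (gUp g φ i k p.proj / u (energy g φ p)
      + wFun u v (energy g φ p) * gUp0 g φ i p * gUp0 g φ k p) * GLow g u v φ k j p
      = gUp g φ i k p.proj * gLow g φ k j p.proj
        + v (energy g φ p) / u (energy g φ p) * pCoord φ j p
            * (gUp g φ i k p.proj * pCoord φ k p)
        + wFun u v (energy g φ p) * u (energy g φ p) * gUp0 g φ i p
            * (gUp0 g φ k p * gLow g φ k j p.proj)
        + wFun u v (energy g φ p) * v (energy g φ p) * gUp0 g φ i p * pCoord φ j p
            * (gUp0 g φ k p * pCoord φ k p) := fun k => by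
    simp only [GLow]
    field_simp
    ring
  simp only [h1, Finset.sum_add_distrib, ← Finset.mul_sum,
    gUp_mul_gLow hφ hp, sum_gUp_mul_pCoord, sum_gUp0_mul_gLow hφ hp, sum_gUp0_mul_pCoord]
  -- What is left is the coefficient of g^{0i} p_j, namely v/u + w(u + 2tv).
  have := wFun_mul hu (h.pos' _ ht)
  linear_combination (gUp0 g φ i p * pCoord φ j p) * this

lemma HUp_eq (h : Admissible u v) (i j : Fin n) :
    HUp g u v φ i j p = gUp g φ i j p.proj / u (energy g φ p)
      + wFun u v (energy g φ p) * gUp0 g φ i p * gUp0 g φ j p := by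
  have hinv : (Matrix.of fun i j => gUp g φ i j p.proj / u (energy g φ p)
      + wFun u v (energy g φ p) * gUp0 g φ i p * gUp0 g φ j p)
        * (Matrix.of fun k l => GLow g u v φ k l p) = 1 := by
    ext i j
    rw [Matrix.mul_apply, Matrix.one_apply]
    exact sum_inverse_mul_GLow hφ hp h i j
  exact congrFun (congrFun (Matrix.inv_eq_left_inv hinv) i) j

lemma HUp_mul_GLow (h : Admissible u v) (i j : Fin n) :
    ∑ k, HUp g u v φ i k p * GLow g u v φ k j p = kron i j := by
  simp only [HUp_eq hφ hp h]
  exact sum_inverse_mul_GLow hφ hp h i j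

lemma GLow_mul_HUp (h : Admissible u v) (i j : Fin n) :
    ∑ k, GLow g u v φ i k p * HUp g u v φ k j p = kron i j := by
  rw [kron_comm, ← HUp_mul_GLow (g := g) hφ hp h]
  exact Finset.sum_congr rfl fun k _ => by rw [HUp_symm, GLow_symm, mul_comm]

lemma contMDiffAt_comp_energy {f : ℝ → ℝ} (hf : ContDiffOn ℝ ∞ f (Set.Ici 0)) :
    ContMDiffAt (cotModel n) 𝓘(ℝ) ∞ (fun q => f (energy g φ q)) p :=
  contMDiffAt_comp_nonneg hf (contMDiffAt_energy hφ hp) (energy_nonneg g φ)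

lemma contMDiffAt_GLow (h : Admissible u v) (i j : Fin n) :
    ContMDiffAt (cotModel n) 𝓘(ℝ) ∞ (GLow g u v φ i j) p :=
  ((contMDiffAt_comp_energy hφ hp h.smooth_left).mul
    (contMDiffAt_comp_proj_of_contMDiffOn (contMDiffOn_gLow hφ i j) hp)).add
  (((contMDiffAt_comp_energy hφ hp h.smooth_right).mul (contMDiffAt_pCoord hφ hp i)).mul
    (contMDiffAt_pCoord hφ hp j))

lemma mvfderiv_GLow (h : Admissible u v) (i j : Fin n) (X : TangentSpace (cotModel n) p) :
    mvfderiv (cotModel n) (GLow g u v φ i j) p X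
      = (deriv0 u (energy g φ p) * gLow g φ i j p.proj
          + deriv0 v (energy g φ p) * pCoord φ i p * pCoord φ j p)
            * mvfderiv (cotModel n) (energy g φ) p X
        + u (energy g φ p)
          * mvfderiv (cotModel n) (fun q : Cotangent n M => gLow g φ i j q.proj) p X
        + v (energy g φ p) * (pCoord φ i p * mvfderiv (cotModel n) (pCoord φ j) p X
          + pCoord φ j p * mvfderiv (cotModel n) (pCoord φ i) p X) := by
  have hu := contMDiffAt_comp_energy (g := g) hφ hp h.smooth_left
  have hv := contMDiffAt_comp_energy (g := g) hφ hp h.smooth_right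
  have hg := contMDiffAt_comp_proj_of_contMDiffOn (contMDiffOn_gLow (g := g) hφ i j) hp
  have hi := contMDiffAt_pCoord hφ hp i
  have hj := contMDiffAt_pCoord hφ hp j
  have h1 := mvfderiv_add_apply (hu.mul hg) ((hv.mul hi).mul hj) X
  have h2 := mvfderiv_mul_apply hu hg X
  have h3 := mvfderiv_mul_apply (hv.mul hi) hj X
  have h4 := mvfderiv_mul_apply hv hi X
  have h5 := mvfderiv_comp_nonneg h.smooth_left (contMDiffAt_energy (g := g) hφ hp)
    (energy_nonneg g φ) X
  have h6 := mvfderiv_comp_nonneg h.smooth_right (contMDiffAt_energy (g := g) hφ hp)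
    (energy_nonneg g φ) X
  refine h1.trans ((congrArg₂ (· + ·) h2 (h3.trans (congrArg₂ (· + ·) rfl
    (congrArg (pCoord φ j p * ·) h4)))).trans ?_)
  rw [h5, h6]
  simp only [Pi.mul_apply]
  ring

lemma dVert_GLow (h : Admissible u v) (k i j : Fin n) :
    dVert φ k (GLow g u v φ i j) p
      = gUp0 g φ k p * (deriv0 u (energy g φ p) * gLow g φ i j p.proj
          + deriv0 v (energy g φ p) * pCoord φ i p * pCoord φ j p)
        + v (energy g φ p) * (pCoord φ i p * kron k j + pCoord φ j p * kron k i) := by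
  rw [dVert, mvfderiv_GLow hφ hp h, mvfderiv_energy_vert hφ hp, mvfderiv_pCoord_vert hφ hp,
    mvfderiv_pCoord_vert hφ hp, mvfderiv_proj_vert hφ hp (mdifferentiableAt_gLow hφ hp i j)]
  ring

/-- The matrix `G_{ij}` is parallel in horizontal directions. -/
lemma mvfderiv_GLow_horiz (h : Admissible u v) (k i j : Fin n) :
    mvfderiv (cotModel n) (GLow g u v φ i j) p (horiz g φ k p)
      = ∑ l, GLow g u v φ l j p * christoffel g φ l k i p.proj
        + ∑ l, GLow g u v φ i l p * christoffel g φ l k j p.proj := by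
  rw [mvfderiv_GLow hφ hp h, mvfderiv_energy_horiz hφ hp, mvfderiv_pCoord_horiz hφ hp,
    mvfderiv_pCoord_horiz hφ hp, mvfderiv_proj_horiz hφ hp (mdifferentiableAt_gLow hφ hp i j),
    partialBase_gLow hφ hp]
  simp only [GLow, christoffel0, add_mul, Finset.sum_add_distrib, mul_add, Finset.mul_sum,
    mul_zero, zero_add]
  simp only [← mul_assoc]
  have e1 : ∑ x, v (energy g φ p) * pCoord φ i p * pCoord φ x p * christoffel g φ x k j p.proj
      + ∑ x, v (energy g φ p) * pCoord φ j p * pCoord φ x p * christoffel g φ x k i p.proj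
      = ∑ x, v (energy g φ p) * pCoord φ x p * pCoord φ j p * christoffel g φ x k i p.proj
      + ∑ x, v (energy g φ p) * pCoord φ i p * pCoord φ x p * christoffel g φ x k j p.proj := by
    rw [add_comm]
    congr 1
    exact Finset.sum_congr rfl fun _ _ => by ring
  linear_combination e1

lemma contMDiffAt_HUp_expr (h : Admissible u v) (i j : Fin n) :
    ContMDiffAt (cotModel n) 𝓘(ℝ) ∞ (fun q => gUp g φ i j q.proj * (u (energy g φ q))⁻¹
      + wFun u v (energy g φ q) * gUp0 g φ i q * gUp0 g φ j q) p := by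
  have hw := contDiffOn_wFun h.smooth_left h.smooth_right h.pos h.pos'
  have hu : ContDiffOn ℝ ∞ (fun t => (u t)⁻¹) (Set.Ici 0) :=
    h.smooth_left.inv fun t ht => (h.pos t ht).ne'
  exact ((contMDiffAt_comp_proj_of_contMDiffOn (contMDiffOn_gUp hφ i j) hp).mul
    (contMDiffAt_comp_energy hφ hp hu)).add
    (((contMDiffAt_comp_energy hφ hp hw).mul (contMDiffAt_gUp0 hφ hp i)).mul
      (contMDiffAt_gUp0 hφ hp j))

lemma contMDiffAt_HUp (h : Admissible u v) (i j : Fin n) :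
    ContMDiffAt (cotModel n) 𝓘(ℝ) ∞ (HUp g u v φ i j) p := by
  refine (contMDiffAt_HUp_expr (g := g) hφ hp h i j).congr_of_eventuallyEq ?_
  filter_upwards [(isOpen_cotangent_source φ).mem_nhds hp] with q hq
  rw [HUp_eq hφ hq h, div_eq_mul_inv]

lemma dVert_HUp (h : Admissible u v) (k i j : Fin n) :
    dVert φ k (HUp g u v φ i j) p
      = gUp0 g φ k p * (-deriv0 u (energy g φ p) / u (energy g φ p) ^ 2 * gUp g φ i j p.proj
          + deriv0 (wFun u v) (energy g φ p) * gUp0 g φ i p * gUp0 g φ j p)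
        + wFun u v (energy g φ p) * (gUp0 g φ i p * gUp g φ k j p.proj
          + gUp0 g φ j p * gUp g φ k i p.proj) := by
  -- The closed form of H is available only over the chart domain; that domain is open, so
  -- derivatives may be taken of it instead.
  have h0 := mvfderiv_congr_of_isOpen (I := cotModel n) (isOpen_cotangent_source φ) hp
    (f := HUp g u v φ i j) (h := fun q => gUp g φ i j q.proj * (u (energy g φ q))⁻¹
      + wFun u v (energy g φ q) * gUp0 g φ i q * gUp0 g φ j q)
    (fun q hq => by rw [HUp_eq hφ hq h, div_eq_mul_inv])
  have hw' := contDiffOn_wFun h.smooth_left h.smooth_right h.pos h.pos'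
  have hu' : ContDiffOn ℝ ∞ (fun t => (u t)⁻¹) (Set.Ici 0) :=
    h.smooth_left.inv fun t ht => (h.pos t ht).ne'
  have hu := contMDiffAt_comp_energy (g := g) hφ hp hu'
  have hw := contMDiffAt_comp_energy (g := g) hφ hp hw'
  have hg := contMDiffAt_comp_proj_of_contMDiffOn (contMDiffOn_gUp (g := g) hφ i j) hp
  have hi := contMDiffAt_gUp0 (g := g) hφ hp i
  have hj := contMDiffAt_gUp0 (g := g) hφ hp j
  have h1 := mvfderiv_add_apply (hg.mul hu) ((hw.mul hi).mul hj) (vert φ k p)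
  have h2 := mvfderiv_mul_apply hg hu (vert φ k p)
  have h3 := mvfderiv_mul_apply (hw.mul hi) hj (vert φ k p)
  have h4 := mvfderiv_mul_apply hw hi (vert φ k p)
  have h5 := mvfderiv_comp_nonneg hu' (contMDiffAt_energy (g := g) hφ hp)
    (energy_nonneg g φ) (vert φ k p)
  have h6 := mvfderiv_comp_nonneg hw' (contMDiffAt_energy (g := g) hφ hp)
    (energy_nonneg g φ) (vert φ k p)
  rw [dVert, h0]
  refine h1.trans ((congrArg₂ (· + ·) h2 (h3.trans (congrArg₂ (· + ·) rfl
    (congrArg (gUp0 g φ j p * ·) h4)))).trans ?_)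
  rw [h5, h6, mvfderiv_energy_vert hφ hp, mvfderiv_gUp0_vert hφ hp, mvfderiv_gUp0_vert hφ hp,
    mvfderiv_proj_vert hφ hp (mdifferentiableAt_gUp hφ hp i j),
    deriv0_inv h (energy_nonneg g φ p)]
  simp only [Pi.mul_apply]
  ring

/-- The matrix `H^{ij}` is parallel in horizontal directions. -/
lemma mvfderiv_HUp_horiz (h : Admissible u v) (k i j : Fin n) :
    mvfderiv (cotModel n) (HUp g u v φ i j) p (horiz g φ k p)
      = -(∑ l, christoffel g φ i k l p.proj * HUp g u v φ l j p)
        - ∑ l, christoffel g φ j k l p.proj * HUp g u v φ i l p := by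
  refine inverse_parallel (G := fun i j => GLow g u v φ i j p)
    (H := fun i j => HUp g u v φ i j p)
    (dG := fun i j => mvfderiv (cotModel n) (GLow g u v φ i j) p (horiz g φ k p))
    (dH := fun i j => mvfderiv (cotModel n) (HUp g u v φ i j) p (horiz g φ k p))
    (Γ := fun i h => christoffel g φ i k h p.proj) (fun i j => GLow_symm g u v φ i j p)
    (HUp_mul_GLow hφ hp h) (fun i j => ?_) (fun i j => mvfderiv_GLow_horiz hφ hp h k i j) i j
  have hH := fun i j => contMDiffAt_HUp (g := g) hφ hp h i j
  have hG := fun i j => contMDiffAt_GLow (g := g) hφ hp h i j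
  have h1 := mvfderiv_congr_of_isOpen (I := cotModel n) (isOpen_cotangent_source φ) hp
    (fun y hy => HUp_mul_GLow (g := g) hφ hy h i j)
  have h2 : mvfderiv (cotModel n) (fun q => ∑ a, HUp g u v φ i a q * GLow g u v φ a j q) p
      (horiz g φ k p) = _ := mvfderiv_sum_apply (fun a => (hH i a).mul (hG a j)) _
  rw [h1, mvfderiv_const] at h2
  exact (Finset.sum_congr rfl fun a _ =>
    (mvfderiv_mul_apply (hH i a) (hG a j) _).symm).trans h2.symm

end

end NaturalLift

end

noncomputable section

namespace NaturalLift

/-! Contractions of arrays. -/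

section Arrays

variable {n : ℕ}

/-- The second derivatives of the change of coordinates enter dp_i through the product rule and Γ^0
through the Christoffel law; in Dp_i the two contributions cancel. -/
lemma Dp_change_aux {J D : Fin n → Fin n → ℝ} {Γ : Fin n → Fin n → Fin n → ℝ}
    {pc dp dx dy j : Fin n → ℝ} (hdy : ∀ d, dy d = ∑ b, J d b * dx b) :
    ∑ i, (pc i * (∑ b, D i b * dx b) + j i * dp i)
        - ∑ b, (∑ l, pc l * (D l b + ∑ c, ∑ d, j c * J d b * Γ l c d)) * dx b
      = ∑ i, j i * (dp i - ∑ d, (∑ l, pc l * Γ l i d) * dy d) := by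
  have h1 : ∑ b, (∑ l, pc l * (D l b + ∑ c, ∑ d, j c * J d b * Γ l c d)) * dx b
      = ∑ i, pc i * (∑ b, D i b * dx b)
        + ∑ i, j i * ∑ d, (∑ l, pc l * Γ l i d) * dy d := by
    have h2 : ∑ b, (∑ l, pc l * D l b) * dx b = ∑ i, pc i * (∑ b, D i b * dx b) := by
      simp only [Finset.mul_sum, Finset.sum_mul]
      rw [Finset.sum_comm]
      exact Finset.sum_congr rfl fun _ _ => Finset.sum_congr rfl fun _ _ => by ring
    have h3 : ∑ b, (∑ l, pc l * ∑ c, ∑ d, j c * J d b * Γ l c d) * dx b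
        = ∑ i, j i * ∑ d, (∑ l, pc l * Γ l i d) * dy d := by
      simp only [hdy, Finset.mul_sum, Finset.sum_mul]
      have e : ∀ b, ∑ l, ∑ c, ∑ d, pc l * (j c * J d b * Γ l c d) * dx b
          = ∑ c, ∑ d, ∑ l, pc l * (j c * J d b * Γ l c d) * dx b := fun b =>
        Finset.sum_comm.trans (Finset.sum_congr rfl fun c _ => Finset.sum_comm)
      rw [Finset.sum_congr rfl fun b _ => e b, Finset.sum_comm]
      refine Finset.sum_congr rfl fun c _ => ?_
      rw [Finset.sum_comm]
      refine Finset.sum_congr rfl fun d _ => Finset.sum_congr rfl fun b _ =>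
        Finset.sum_congr rfl fun l _ => ?_
      ring
    simp only [mul_add, Finset.sum_add_distrib, add_mul, h2, h3]
  rw [h1]
  simp only [mul_sub, Finset.sum_add_distrib, Finset.sum_sub_distrib]
  ring

/-- Change of the inverse matrix of a matrix of components of type `(0,2)`. -/
lemma inv_change {A B G G' : Fin n → Fin n → ℝ} (hAB : ∀ a b, ∑ i, A a i * B i b = kron a b)
    (hG : ∀ a b, G' a b = ∑ i, ∑ j, B i a * B j b * G i j) (a b : Fin n) :
    (Matrix.of G')⁻¹ a b = ∑ i, ∑ j, A a i * A b j * (Matrix.of G)⁻¹ i j := by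
  have h1 : Matrix.of G' = (Matrix.of B).transpose * Matrix.of G * Matrix.of B := by
    ext a b
    simp only [Matrix.mul_apply, Matrix.transpose_apply, Matrix.of_apply, hG, Finset.sum_mul]
    rw [Finset.sum_comm]
    exact Finset.sum_congr rfl fun _ _ => Finset.sum_congr rfl fun _ _ => by ring
  have h2 : (Matrix.of B)⁻¹ = Matrix.of A := by
    refine Matrix.inv_eq_left_inv ?_
    ext a b
    rw [Matrix.mul_apply, Matrix.one_apply]
    exact hAB a b
  rw [h1, Matrix.mul_inv_rev, Matrix.mul_inv_rev, ← Matrix.transpose_nonsing_inv, h2,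
    ← Matrix.mul_assoc]
  simp only [Matrix.mul_apply, Matrix.transpose_apply, Matrix.of_apply, Finset.sum_mul]
  rw [Finset.sum_comm]
  exact Finset.sum_congr rfl fun _ _ => Finset.sum_congr rfl fun _ _ => by ring

/-- Invariance of a contraction. -/
lemma bilinear_change {B G G' : Fin n → Fin n → ℝ} {x y x' y' : Fin n → ℝ}
    (hG : ∀ a b, G' a b = ∑ i, ∑ j, B i a * B j b * G i j)
    (hx : ∀ i, x i = ∑ a, B i a * x' a) (hy : ∀ i, y i = ∑ a, B i a * y' a) :
    ∑ a, ∑ b, G' a b * x' a * y' b = ∑ i, ∑ j, G i j * x i * y j := by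
  simp only [hG, hx, hy, Finset.mul_sum, Finset.sum_mul]
  have e : ∀ a, ∑ b, ∑ i, ∑ j, B i a * B j b * G i j * x' a * y' b
      = ∑ i, ∑ j, ∑ b, B i a * B j b * G i j * x' a * y' b := fun a =>
    Finset.sum_comm.trans (Finset.sum_congr rfl fun i _ => Finset.sum_comm)
  rw [Finset.sum_congr rfl fun a _ => e a, Finset.sum_comm]
  refine Finset.sum_congr rfl fun i _ => ?_
  rw [Finset.sum_comm]
  refine Finset.sum_congr rfl fun j _ => ?_
  rw [Finset.sum_comm]
  exact Finset.sum_congr rfl fun _ _ => Finset.sum_congr rfl fun _ _ => by ring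

end Arrays

variable {n : ℕ} {M : Type*} [TopologicalSpace M] [ChartedSpace (Model n) M]
  [IsManifold (𝓡 n) ∞ M] {φ ψ : Chart n M} {g : Metric n M} {u v : ℝ → ℝ} {p : Cotangent n M}

/-! Change of the induced charts. -/

lemma pCoord_change (hψ : ψ ∈ IsManifold.maximalAtlas (𝓡 n) ∞ M) (hp' : p.proj ∈ ψ.source)
    (φ : Chart n M) (i : Fin n) :
    pCoord φ i p = ∑ a, jac φ ψ a i p.proj * pCoord ψ a p := by
  rw [pCoord, coordField_jac hψ hp', map_sum]
  refine Finset.sum_congr rfl fun a _ => ?_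
  rw [map_smul]
  rfl

variable (hφ : φ ∈ IsManifold.maximalAtlas (𝓡 n) ∞ M) (hp : p.proj ∈ φ.source)
  (hψ : ψ ∈ IsManifold.maximalAtlas (𝓡 n) ∞ M) (hp' : p.proj ∈ ψ.source)
include hφ hp hψ hp'

lemma dq_change (a : Fin n) (X : TangentSpace (cotModel n) p) :
    dq ψ a p X = ∑ i, jac φ ψ a i p.proj * dq φ i p X :=
  mvfderiv_comp_proj hφ hp (mdifferentiableAt_chart_apply hψ hp' a) X

lemma contMDiffAt_jac_proj (a i : Fin n) : ContMDiffAt (cotModel n) 𝓘(ℝ) ∞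
    (fun q : Cotangent n M => jac φ ψ a i q.proj) p :=
  contMDiffAt_comp_proj (contMDiffAt_jac hφ hψ hp hp' a i)

lemma Dp_change (g : Metric n M) (a : Fin n) (X : TangentSpace (cotModel n) p) :
    Dp g φ a p X = ∑ i, jac φ ψ i a p.proj * Dp g ψ i p X := by
  have hJ := fun i => contMDiffAt_jac_proj hφ hp hψ hp' i a
  have hP := fun i => contMDiffAt_pCoord hψ hp' i
  have h1 := mvfderiv_congr_of_isOpen (I := cotModel n) (isOpen_cotangent_source ψ) hp'
    (fun q hq => pCoord_change hψ hq φ a)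
  have h2 : mvfderiv (cotModel n) (fun q => ∑ i, jac φ ψ i a q.proj * pCoord ψ i q) p X = _ :=
    mvfderiv_sum_apply (fun i => (hJ i).mul (hP i)) X
  have h3 : ∀ i, mvfderiv (cotModel n) (fun q => jac φ ψ i a q.proj * pCoord ψ i q) p X
      = pCoord ψ i p * (∑ b, partialBase φ b (jac φ ψ i a) p.proj * dq φ b p X)
        + jac φ ψ i a p.proj * mvfderiv (cotModel n) (pCoord ψ i) p X := fun i => by
    rw [mvfderiv_mul_apply (hJ i) (hP i), mvfderiv_comp_proj hφ hp
      ((contMDiffAt_jac hφ hψ hp hp' i a).mdifferentiableAt (by simp))]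
    exact add_comm _ _
  have h4 : ∀ b, christoffel0 g φ a b p = ∑ l, pCoord ψ l p *
      (partialBase φ b (jac φ ψ l a) p.proj + ∑ c, ∑ d, jac φ ψ c a p.proj * jac φ ψ d b p.proj
        * christoffel g ψ l c d p.proj) := fun b => by
    simp only [← christoffel_change hφ hψ hp hp', christoffel0, pCoord_change hψ hp' φ,
      Finset.sum_mul, Finset.mul_sum]
    rw [Finset.sum_comm]
    exact Finset.sum_congr rfl fun _ _ => Finset.sum_congr rfl fun _ _ => by ring
  rw [Dp, h1, h2.trans (Finset.sum_congr rfl fun i _ => h3 i)]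
  simp only [h4]
  exact Dp_change_aux (fun d => dq_change hφ hp hψ hp' d X)

lemma gUp_change (a b : Fin n) :
    gUp g ψ a b p.proj
      = ∑ i, ∑ j, jac φ ψ a i p.proj * jac φ ψ b j p.proj * gUp g φ i j p.proj :=
  inv_change (jac_mul_jac hφ hψ hp hp') (fun a b => gLow_change hφ hp ψ a b) a b

/-- t is the invariant contraction of g^{ij} with p twice, so u(t) and v(t) are chart independent as
well. -/
lemma energy_change : energy g ψ p = energy g φ p := by
  unfold energy
  rw [bilinear_change (gUp_change (g := g) hφ hp hψ hp') (x := fun i => pCoord φ i p)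
    (y := fun i => pCoord φ i p) (B := fun i a => jac φ ψ a i p.proj)
    (fun i => pCoord_change hψ hp' φ i) (fun i => pCoord_change hψ hp' φ i)]

lemma GLow_change (a b : Fin n) :
    GLow g u v ψ a b p
      = ∑ i, ∑ j, jac ψ φ i a p.proj * jac ψ φ j b p.proj * GLow g u v φ i j p := by
  rw [GLow, energy_change hφ hp hψ hp', gLow_change hφ hp ψ, pCoord_change hφ hp ψ a, pCoord_change hφ hp ψ b]
  simp only [GLow, Finset.mul_sum, Finset.sum_mul, mul_add, Finset.sum_add_distrib]
  congr 1
  · exact Finset.sum_congr rfl fun _ _ => Finset.sum_congr rfl fun _ _ => by ring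
  · rw [Finset.sum_comm]
    exact Finset.sum_congr rfl fun _ _ => Finset.sum_congr rfl fun _ _ => by ring

lemma HUp_change (a b : Fin n) :
    HUp g u v ψ a b p
      = ∑ i, ∑ j, jac φ ψ a i p.proj * jac φ ψ b j p.proj * HUp g u v φ i j p :=
  inv_change (jac_mul_jac hφ hψ hp hp') (fun a b => GLow_change hφ hp hψ hp' a b) a b

lemma diagonalForm_change (X Y : TangentSpace (cotModel n) p) :
    diagonalForm g u v ψ p X Y = diagonalForm g u v φ p X Y := by
  unfold diagonalForm
  rw [bilinear_change (B := fun i a => jac ψ φ i a p.proj) (GLow_change hφ hp hψ hp')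
      (fun i => dq_change hψ hp' hφ hp i X) (fun i => dq_change hψ hp' hφ hp i Y),
    bilinear_change (B := fun i a => jac φ ψ a i p.proj) (HUp_change hφ hp hψ hp')
      (fun i => Dp_change hφ hp hψ hp' g i X) (fun i => Dp_change hφ hp hψ hp' g i Y)]

omit hψ hp' in
/-- The lift metric may be computed in any chart. -/
lemma liftMetric_eq (X Y : TangentSpace (cotModel n) p) :
    liftMetric g u v p X Y = diagonalForm g u v φ p X Y :=
  diagonalForm_change hφ hp (IsManifold.chart_mem_maximalAtlas p.proj)
    (mem_chart_source (Model n) p.proj) X Y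

/-- The coefficients are read off with the dual coframe of `φ`, whose transformation law is already
known. -/
lemma vert_change (g : Metric n M) (a : Fin n) :
    vert ψ a p = ∑ i, jac φ ψ a i p.proj • vert φ i p := by
  rw [adapted_expand hφ hp g (vert ψ a p)]
  have h1 : ∀ i, dq φ i p (vert ψ a p) = 0 := fun i => by
    rw [dq_change hψ hp' hφ hp]
    simp [dq_vert hψ hp']
  have h2 : ∀ i, Dp g φ i p (vert ψ a p) = jac φ ψ a i p.proj := fun i => by
    rw [Dp_change hφ hp hψ hp']
    simp [Dp_vert hψ hp']
  simp only [h1, h2, zero_smul, Finset.sum_const_zero, zero_add]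

lemma horiz_change (g : Metric n M) (a : Fin n) :
    horiz g ψ a p = ∑ i, jac ψ φ i a p.proj • horiz g φ i p := by
  rw [adapted_expand hφ hp g (horiz g ψ a p)]
  have h1 : ∀ i, dq φ i p (horiz g ψ a p) = jac ψ φ i a p.proj := fun i => by
    rw [dq_change hψ hp' hφ hp]
    simp [dq_horiz hψ hp']
  have h2 : ∀ i, Dp g φ i p (horiz g ψ a p) = 0 := fun i => by
    rw [Dp_change hφ hp hψ hp']
    simp [Dp_horiz hψ hp']
  simp only [h1, h2, zero_smul, Finset.sum_const_zero, add_zero]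

end NaturalLift

end

noncomputable section

namespace NaturalLift

/-! The Levi-Civita connection of the lift metric in adapted frames. -/

/-! ### Linearity of forms given only as functions. -/

section Linear

variable {V : Type*} [AddCommGroup V] [Module ℝ V] [TopologicalSpace V] {n : ℕ}

lemma clm_sub (L : V →L[ℝ] ℝ) (x y : V) : L (x - y) = L x - L y := map_sub L x y

lemma clm_add (L : V →L[ℝ] ℝ) (x y : V) : L (x + y) = L x + L y := map_add L x y

lemma clm_sum_smul (L : V →L[ℝ] ℝ) (a : Fin n → ℝ) (v : Fin n → V) :
    L (∑ i, a i • v i) = ∑ i, a i * L (v i) := by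
  simp

lemma exists_clm_sub_sum (L : V →L[ℝ] ℝ) (a : Fin n → ℝ) (K : Fin n → V →L[ℝ] ℝ) :
    ∃ L' : V →L[ℝ] ℝ, ∀ x, L x - ∑ i, a i * K i x = L' x := by
  induction (Finset.univ : Finset (Fin n)) using Finset.induction_on with
  | empty => exact ⟨L, fun x => by simp⟩
  | insert i A hi ih =>
    obtain ⟨L', hL'⟩ := ih
    refine ⟨L' + (-a i) • K i, fun x => ?_⟩
    rw [Finset.sum_insert hi, add_apply, ← hL', smul_apply, smul_eq_mul]
    ring

end Linear

variable {n : ℕ} {M : Type*} [TopologicalSpace M] [ChartedSpace (Model n) M]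
  [IsManifold (𝓡 n) ∞ M] {φ ψ : Chart n M} {g : Metric n M} {u v : ℝ → ℝ} {p : Cotangent n M}

/-- `Dp` is a bare function of the tangent vector; this supplies the continuous linear form from
which its additivity is deduced. -/
lemma exists_clm_Dp (g : Metric n M) (φ : Chart n M) (i : Fin n) (p : Cotangent n M) :
    ∃ L : TangentSpace (cotModel n) p →L[ℝ] ℝ, ∀ X, Dp g φ i p X = L X :=
  exists_clm_sub_sum _ _ _

lemma dq_sub (φ : Chart n M) (i : Fin n) (p : Cotangent n M) (X Y : TangentSpace (cotModel n) p) :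
    dq φ i p (X - Y) = dq φ i p X - dq φ i p Y := clm_sub _ _ _

lemma dq_sum_smul (φ : Chart n M) (i : Fin n) (p : Cotangent n M) (a : Fin n → ℝ)
    (X : Fin n → TangentSpace (cotModel n) p) :
    dq φ i p (∑ h, a h • X h) = ∑ h, a h * dq φ i p (X h) := clm_sum_smul _ _ _

lemma Dp_sub (g : Metric n M) (φ : Chart n M) (i : Fin n) (p : Cotangent n M)
    (X Y : TangentSpace (cotModel n) p) :
    Dp g φ i p (X - Y) = Dp g φ i p X - Dp g φ i p Y := by
  obtain ⟨L, hL⟩ := exists_clm_Dp g φ i p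
  rw [hL, hL, hL, clm_sub]

lemma Dp_add (g : Metric n M) (φ : Chart n M) (i : Fin n) (p : Cotangent n M)
    (X Y : TangentSpace (cotModel n) p) :
    Dp g φ i p (X + Y) = Dp g φ i p X + Dp g φ i p Y := by
  obtain ⟨L, hL⟩ := exists_clm_Dp g φ i p
  rw [hL, hL, hL, clm_add]

lemma Dp_sum_smul (g : Metric n M) (φ : Chart n M) (i : Fin n) (p : Cotangent n M) (a : Fin n → ℝ)
    (X : Fin n → TangentSpace (cotModel n) p) :
    Dp g φ i p (∑ h, a h • X h) = ∑ h, a h * Dp g φ i p (X h) := by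
  obtain ⟨L, hL⟩ := exists_clm_Dp g φ i p
  simp only [hL]
  exact clm_sum_smul _ _ _

lemma liftMetric_sub_left (X Y Z : TangentSpace (cotModel n) p) :
    liftMetric g u v p (X - Y) Z = liftMetric g u v p X Z - liftMetric g u v p Y Z := by
  simp only [liftMetric, diagonalForm, dq_sub, Dp_sub, mul_sub, sub_mul, Finset.sum_sub_distrib]
  ring

lemma liftMetric_symm (X Y : TangentSpace (cotModel n) p) :
    liftMetric g u v p X Y = liftMetric g u v p Y X := by
  simp only [liftMetric, diagonalForm]
  congr 1
  · rw [Finset.sum_comm]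
    refine Finset.sum_congr rfl fun i _ => Finset.sum_congr rfl fun j _ => ?_
    rw [GLow_symm]
    ring
  · rw [Finset.sum_comm]
    refine Finset.sum_congr rfl fun i _ => Finset.sum_congr rfl fun j _ => ?_
    rw [HUp_symm]
    ring

lemma liftMetric_zero_left (Y : TangentSpace (cotModel n) p) : liftMetric g u v p 0 Y = 0 := by
  have := liftMetric_sub_left (g := g) (u := u) (v := v) 0 0 Y
  rwa [sub_self, sub_self] at this

lemma IsLeviCivita.sub_eq_mlieBracket
    {G : ∀ p : Cotangent n M, TangentSpace (cotModel n) p → TangentSpace (cotModel n) p → ℝ}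
    {nabla : Connection n M} (hnabla : IsLeviCivita G nabla)
    {X Y : ∀ q : Cotangent n M, TangentSpace (cotModel n) q}
    (hX : MDifferentiableAt (cotModel n) (cotModel n).tangent
      (fun q => (⟨q, X q⟩ : TangentBundle (cotModel n) (Cotangent n M))) p)
    (hY : MDifferentiableAt (cotModel n) (cotModel n).tangent
      (fun q => (⟨q, Y q⟩ : TangentBundle (cotModel n) (Cotangent n M))) p) :
    nabla Y p (X p) - nabla X p (Y p) = VectorField.mlieBracket (cotModel n) X Y p :=
  nabla.torsion_eq_zero_iff.1 hnabla.1 hX hY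

/-- The Koszul formula. -/
lemma koszul {nabla : Connection n M} (hnabla : IsLeviCivita (liftMetric g u v) nabla)
    {X Y Z : ∀ q : Cotangent n M, TangentSpace (cotModel n) q}
    (hX : MDifferentiableAt (cotModel n) (cotModel n).tangent
      (fun q => (⟨q, X q⟩ : TangentBundle (cotModel n) (Cotangent n M))) p)
    (hY : MDifferentiableAt (cotModel n) (cotModel n).tangent
      (fun q => (⟨q, Y q⟩ : TangentBundle (cotModel n) (Cotangent n M))) p)
    (hZ : MDifferentiableAt (cotModel n) (cotModel n).tangent
      (fun q => (⟨q, Z q⟩ : TangentBundle (cotModel n) (Cotangent n M))) p)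
    {d₁ d₂ d₃ b₁ b₂ b₃ : ℝ}
    (hd₁ : mvfderiv (cotModel n) (fun q => liftMetric g u v q (Y q) (Z q)) p (X p) = d₁)
    (hd₂ : mvfderiv (cotModel n) (fun q => liftMetric g u v q (X q) (Z q)) p (Y p) = d₂)
    (hd₃ : mvfderiv (cotModel n) (fun q => liftMetric g u v q (X q) (Y q)) p (Z p) = d₃)
    (hb₁ : liftMetric g u v p (VectorField.mlieBracket (cotModel n) X Y p) (Z p) = b₁)
    (hb₂ : liftMetric g u v p (VectorField.mlieBracket (cotModel n) X Z p) (Y p) = b₂)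
    (hb₃ : liftMetric g u v p (VectorField.mlieBracket (cotModel n) Y Z p) (X p) = b₃) :
    liftMetric g u v p (nabla Y p (X p)) (Z p)
      = (1 / 2) * (d₁ + d₂ - d₃ + b₁ - b₂ - b₃) := by
  -- Brackets become differences of covariant derivatives by vanishing torsion, and derivatives of
  -- scalar products split by metric compatibility. All terms but the wanted one then cancel in
  -- pairs.
  rw [← hnabla.sub_eq_mlieBracket hX hY, liftMetric_sub_left] at hb₁
  rw [← hnabla.sub_eq_mlieBracket hX hZ, liftMetric_sub_left] at hb₂
  rw [← hnabla.sub_eq_mlieBracket hY hZ, liftMetric_sub_left] at hb₃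
  rw [hnabla.2 p (X p) Y Z hY hZ, liftMetric_symm (Y p) (nabla Z p (X p))] at hd₁
  rw [hnabla.2 p (Y p) X Z hX hZ, liftMetric_symm (X p) (nabla Z p (Y p))] at hd₂
  rw [hnabla.2 p (Z p) X Y hX hY, liftMetric_symm (X p) (nabla Y p (Z p))] at hd₃
  rw [← hd₁, ← hd₂, ← hd₃, ← hb₁, ← hb₂, ← hb₃]
  ring

/-! ### The lift metric on the adapted frame. -/

variable (hφ : φ ∈ IsManifold.maximalAtlas (𝓡 n) ∞ M) (hp : p.proj ∈ φ.source)
include hφ hp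

lemma liftMetric_horiz_right (X : TangentSpace (cotModel n) p) (k : Fin n) :
    liftMetric g u v p X (horiz g φ k p) = ∑ i, GLow g u v φ k i p * dq φ i p X := by
  rw [liftMetric_eq hφ hp]
  simp only [diagonalForm, dq_horiz hφ hp, Dp_horiz hφ hp, mul_zero, Finset.sum_const_zero,
    add_zero, sum_mul_kron]
  exact Finset.sum_congr rfl fun i _ => by rw [GLow_symm]

lemma liftMetric_vert_right (X : TangentSpace (cotModel n) p) (k : Fin n) :
    liftMetric g u v p X (vert φ k p) = ∑ i, HUp g u v φ k i p * Dp g φ i p X := by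
  rw [liftMetric_eq hφ hp]
  simp only [diagonalForm, dq_vert hφ hp, Dp_vert hφ hp, mul_zero, Finset.sum_const_zero,
    zero_add, sum_mul_kron]
  exact Finset.sum_congr rfl fun i _ => by rw [HUp_symm]

lemma liftMetric_horiz_horiz (i j : Fin n) :
    liftMetric g u v p (horiz g φ i p) (horiz g φ j p) = GLow g u v φ i j p := by
  rw [liftMetric_horiz_right hφ hp, GLow_symm]
  simp [dq_horiz hφ hp]

lemma liftMetric_vert_vert (i j : Fin n) :
    liftMetric g u v p (vert φ i p) (vert φ j p) = HUp g u v φ i j p := by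
  rw [liftMetric_vert_right hφ hp, HUp_symm]
  simp [Dp_vert hφ hp]

lemma liftMetric_vert_horiz (i j : Fin n) :
    liftMetric g u v p (vert φ i p) (horiz g φ j p) = 0 := by
  rw [liftMetric_horiz_right hφ hp]
  simp [dq_vert hφ hp]

lemma liftMetric_horiz_vert (i j : Fin n) :
    liftMetric g u v p (horiz g φ i p) (vert φ j p) = 0 := by
  rw [liftMetric_symm, liftMetric_vert_horiz hφ hp]

lemma dq_sum_vert (a : Fin n → ℝ) (k : Fin n) :
    dq φ k p (∑ h, a h • vert φ h p) = 0 := by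
  rw [dq_sum_smul]
  simp [dq_vert hφ hp]

lemma dq_sum_horiz (a : Fin n → ℝ) (k : Fin n) :
    dq φ k p (∑ h, a h • horiz g φ h p) = a k := by
  rw [dq_sum_smul]
  simp [dq_horiz hφ hp]

lemma Dp_sum_vert (a : Fin n → ℝ) (k : Fin n) :
    Dp g φ k p (∑ h, a h • vert φ h p) = a k := by
  rw [Dp_sum_smul]
  simp [Dp_vert hφ hp]

lemma Dp_sum_horiz (a : Fin n → ℝ) (k : Fin n) :
    Dp g φ k p (∑ h, a h • horiz g φ h p) = 0 := by
  rw [Dp_sum_smul]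
  simp [Dp_horiz hφ hp]

lemma liftMetric_vert_of_eq_sum_vert {X : TangentSpace (cotModel n) p} {a : Fin n → ℝ}
    (hX : X = ∑ h, a h • vert φ h p) (k : Fin n) :
    liftMetric g u v p X (vert φ k p) = ∑ h, HUp g u v φ k h p * a h := by
  rw [liftMetric_vert_right hφ hp, hX]
  simp only [Dp_sum_vert hφ hp]

lemma liftMetric_horiz_of_eq_sum_vert {X : TangentSpace (cotModel n) p} {a : Fin n → ℝ}
    (hX : X = ∑ h, a h • vert φ h p) (k : Fin n) :
    liftMetric g u v p X (horiz g φ k p) = 0 := by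
  rw [liftMetric_horiz_right hφ hp, hX]
  simp [dq_sum_vert hφ hp]

omit hφ hp in
lemma liftMetric_of_eq_zero {X : TangentSpace (cotModel n) p} (hX : X = 0)
    (Y : TangentSpace (cotModel n) p) : liftMetric g u v p X Y = 0 := by
  rw [hX, liftMetric_zero_left]

lemma mlieBracket_horiz_vert (i j : Fin n) :
    VectorField.mlieBracket (cotModel n) (horiz g φ i) (vert φ j) p
      = ∑ h, (-christoffel g φ j i h p.proj) • vert φ h p := by
  rw [VectorField.mlieBracket_swap_apply, mlieBracket_vert_horiz hφ hp,
    ← Finset.sum_neg_distrib]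
  exact Finset.sum_congr rfl fun h _ => (neg_smul _ _).symm

lemma mvfderiv_liftMetric_vert_vert (i j : Fin n) :
    mvfderiv (cotModel n) (fun q => liftMetric g u v q (vert φ i q) (vert φ j q)) p
      = mvfderiv (cotModel n) (HUp g u v φ i j) p :=
  mvfderiv_congr_of_isOpen (isOpen_cotangent_source φ) hp
    fun _ hq => liftMetric_vert_vert hφ hq i j

lemma mvfderiv_liftMetric_horiz_horiz (i j : Fin n) :
    mvfderiv (cotModel n) (fun q => liftMetric g u v q (horiz g φ i q) (horiz g φ j q)) p
      = mvfderiv (cotModel n) (GLow g u v φ i j) p :=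
  mvfderiv_congr_of_isOpen (isOpen_cotangent_source φ) hp
    fun _ hq => liftMetric_horiz_horiz hφ hq i j

lemma mvfderiv_liftMetric_vert_horiz (i j : Fin n) (X : TangentSpace (cotModel n) p) :
    mvfderiv (cotModel n) (fun q => liftMetric g u v q (vert φ i q) (horiz g φ j q)) p X = 0 := by
  rw [mvfderiv_congr_of_isOpen (h := fun _ => 0) (isOpen_cotangent_source φ) hp
    fun _ hq => liftMetric_vert_horiz hφ hq i j, mvfderiv_const]
  rfl

lemma mvfderiv_liftMetric_horiz_vert (i j : Fin n) (X : TangentSpace (cotModel n) p) :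
    mvfderiv (cotModel n) (fun q => liftMetric g u v q (horiz g φ i q) (vert φ j q)) p X = 0 := by
  rw [mvfderiv_congr_of_isOpen (h := fun _ => 0) (isOpen_cotangent_source φ) hp
    fun _ hq => liftMetric_horiz_vert hφ hq i j, mvfderiv_const]
  rfl

/-- A tangent vector is determined by its scalar products with the adapted frame. -/
lemma eq_of_liftMetric (h : Admissible u v) {X : TangentSpace (cotModel n) p} {α β : Fin n → ℝ}
    (hv : ∀ k, liftMetric g u v p X (vert φ k p) = ∑ i, HUp g u v φ k i p * β i)
    (hh : ∀ k, liftMetric g u v p X (horiz g φ k p) = ∑ i, GLow g u v φ k i p * α i) :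
    X = ∑ i, α i • horiz g φ i p + ∑ i, β i • vert φ i p := by
  have h1 : ∀ i, dq φ i p X = α i :=
    eq_of_sum_mul_eq (A := fun k i => GLow g u v φ k i p) (HUp_mul_GLow hφ hp h) fun k => by
      rw [← hh k, liftMetric_horiz_right hφ hp]
  have h2 : ∀ i, Dp g φ i p X = β i :=
    eq_of_sum_mul_eq (A := fun k i => HUp g u v φ k i p) (GLow_mul_HUp hφ hp h) fun k => by
      rw [← hv k, liftMetric_vert_right hφ hp]
  conv_lhs => rw [adapted_expand hφ hp g X]
  simp only [h1, h2]

lemma eq_sum_vert_of_liftMetric (h : Admissible u v) {X : TangentSpace (cotModel n) p}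
    {β : Fin n → ℝ}
    (hv : ∀ k, liftMetric g u v p X (vert φ k p) = ∑ i, HUp g u v φ k i p * β i)
    (hh : ∀ k, liftMetric g u v p X (horiz g φ k p) = 0) : X = ∑ i, β i • vert φ i p := by
  have := eq_of_liftMetric (α := fun _ => 0) hφ hp h hv (fun k => by simp [hh k])
  simpa only [zero_smul, Finset.sum_const_zero, zero_add] using this

lemma eq_sum_horiz_of_liftMetric (h : Admissible u v) {X : TangentSpace (cotModel n) p}
    {α : Fin n → ℝ}
    (hv : ∀ k, liftMetric g u v p X (vert φ k p) = 0)
    (hh : ∀ k, liftMetric g u v p X (horiz g φ k p) = ∑ i, GLow g u v φ k i p * α i) :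
    X = ∑ i, α i • horiz g φ i p := by
  have := eq_of_liftMetric (β := fun _ => 0) hφ hp h (fun k => by simp [hv k]) hh
  simpa only [zero_smul, Finset.sum_const_zero, add_zero] using this

lemma mdifferentiableAt_vert (i : Fin n) :
    MDifferentiableAt (cotModel n) (cotModel n).tangent
      (fun q => (⟨q, vert φ i q⟩ : TangentBundle (cotModel n) (Cotangent n M))) p :=
  (contMDiffAt_vert hφ hp i).mdifferentiableAt (by simp)

/-- Q contracted with H, its inverse G cancelling: the right side of Koszul's formula for three
vertical fields, in the shape `eq_of_liftMetric` expects. The next two lemmas do the same for P and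
S. -/
lemma sum_HUp_mul_Qt (h : Admissible u v) (i j k : Fin n) :
    ∑ l, HUp g u v φ k l p * Qt g u v φ i j l p
      = (1 / 2) * (dVert φ i (HUp g u v φ j k) p + dVert φ j (HUp g u v φ i k) p
      - dVert φ k (HUp g u v φ i j) p) := by
  simp only [Qt, mul_left_comm _ (1 / 2 : ℝ), ← Finset.mul_sum]
  congr 1
  simp only [Finset.mul_sum]
  rw [Finset.sum_comm]
  simp only [← mul_assoc, ← Finset.sum_mul, HUp_mul_GLow hφ hp h, sum_kron_mul]

lemma sum_GLow_mul_Pt (h : Admissible u v) (i j k : Fin n) :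
    ∑ l, GLow g u v φ k l p * Pt g u v φ l i j p
      = (1 / 2) * (dVert φ i (GLow g u v φ j k) p
        - ∑ l, HUp g u v φ i l p * curvature0 g φ l j k p) := by
  simp only [Pt, mul_left_comm _ (1 / 2 : ℝ), ← Finset.mul_sum]
  congr 1
  simp only [Finset.mul_sum]
  rw [Finset.sum_comm]
  simp only [← mul_assoc, ← Finset.sum_mul, GLow_mul_HUp hφ hp h, sum_kron_mul]

lemma sum_HUp_mul_St (h : Admissible u v) (i j k : Fin n) :
    ∑ l, HUp g u v φ k l p * St g u v φ l i j p
      = -(1 / 2) * dVert φ k (GLow g u v φ i j) p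
        + (1 / 2) * ∑ l, HUp g u v φ k l p * curvature0 g φ l i j p := by
  simp only [St, mul_add, Finset.sum_add_distrib, mul_left_comm _ (1 / 2 : ℝ),
    mul_left_comm _ (-(1 / 2) : ℝ), ← Finset.mul_sum]
  congr 2
  simp only [Finset.mul_sum]
  rw [Finset.sum_comm]
  simp only [← mul_assoc, ← Finset.sum_mul, HUp_mul_GLow hφ hp h, sum_kron_mul]

/-! ### Koszul's formula on pairs of frame fields. -/

section Connection

variable (h : Admissible u v) {nabla : Connection n M}
  (hnabla : IsLeviCivita (liftMetric g u v) nabla)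
include h hnabla

/-- Along a fibre the frame commutes, so Koszul's formula is the usual Christoffel formula for the
metric H^ij. There is no horizontal part: the fibres are totally geodesic because H is parallel
along δ_k. -/
theorem nabla_vert_vert (i j : Fin n) :
    nabla (vert φ j) p (vert φ i p) = ∑ l, Qt g u v φ i j l p • vert φ l p := by
  have hV := fun i => mdifferentiableAt_vert hφ hp i
  have hH := fun i => mdifferentiableAt_horiz (g := g) hφ hp i
  have bV := fun i j => liftMetric_of_eq_zero (g := g) (u := u) (v := v)
    (mlieBracket_vert_vert hφ hp i j)
  have dV := fun i j k => congrArg (fun L => L (vert φ k p))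
    (mvfderiv_liftMetric_vert_vert (g := g) (u := u) (v := v) hφ hp i j)
  refine eq_sum_vert_of_liftMetric (g := g) hφ hp h (fun k => ?_) fun k => ?_
  · refine (koszul hnabla (hV i) (hV j) (hV k) (dV _ _ _) (dV _ _ _) (dV _ _ _) (bV _ _ _)
      (bV _ _ _) (bV _ _ _)).trans ?_
    rw [sum_HUp_mul_Qt hφ hp h]
    simp only [dVert]
    ring
  · have bH := fun i j => liftMetric_vert_of_eq_sum_vert (g := g) (u := u) (v := v) hφ hp
      (mlieBracket_vert_horiz (g := g) hφ hp i k) j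
    have dH := fun i j => mvfderiv_liftMetric_vert_horiz (g := g) (u := u) (v := v) hφ hp i k
      (vert φ j p)
    refine (koszul hnabla (hV i) (hV j) (hH k) (dH _ _) (dH _ _)
      (congrArg (fun L => L (horiz g φ k p)) (mvfderiv_liftMetric_vert_vert hφ hp i j))
      (bV _ _ _) (bH _ _) (bH _ _)).trans ?_
    -- δ_k H^ij is cancelled by the two brackets of ∂^i and ∂^j with δ_k.
    rw [mvfderiv_HUp_horiz hφ hp h]
    have e : ∑ l, HUp g u v φ j l p * christoffel g φ i k l p.proj
        = ∑ l, christoffel g φ i k l p.proj * HUp g u v φ l j p :=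
      Finset.sum_congr rfl fun l _ => by rw [HUp_symm, mul_comm]
    have e' : ∑ l, HUp g u v φ i l p * christoffel g φ j k l p.proj
        = ∑ l, christoffel g φ j k l p.proj * HUp g u v φ i l p :=
      Finset.sum_congr rfl fun l _ => by rw [mul_comm]
    rw [e, e']
    ring

/-- The vertical part vanishes since H is parallel along δ_j. The horizontal part collects ∂^i G_jk
and, through the bracket of δ_j and δ_k, the curvature. -/
theorem nabla_horiz_vert (i j : Fin n) :
    nabla (horiz g φ j) p (vert φ i p) = ∑ l, Pt g u v φ l i j p • horiz g φ l p := by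
  have hV := fun i => mdifferentiableAt_vert hφ hp i
  have hH := fun i => mdifferentiableAt_horiz (g := g) hφ hp i
  refine eq_sum_horiz_of_liftMetric (g := g) hφ hp h (fun k => ?_) fun k => ?_
  · refine (koszul hnabla (hV i) (hH j) (hV k)
      (mvfderiv_liftMetric_horiz_vert hφ hp _ _ _)
      (congrArg (fun L => L (horiz g φ j p)) (mvfderiv_liftMetric_vert_vert hφ hp i k))
      (mvfderiv_liftMetric_vert_horiz hφ hp _ _ _)
      (liftMetric_vert_of_eq_sum_vert hφ hp (mlieBracket_vert_horiz hφ hp _ _) _)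
      (liftMetric_of_eq_zero (mlieBracket_vert_vert hφ hp _ _) _)
      (liftMetric_vert_of_eq_sum_vert hφ hp (mlieBracket_horiz_vert hφ hp _ _) _)).trans ?_
    rw [mvfderiv_HUp_horiz hφ hp h]
    have e : ∑ l, HUp g u v φ k l p * christoffel g φ i j l p.proj
        = ∑ l, christoffel g φ i j l p.proj * HUp g u v φ l k p :=
      Finset.sum_congr rfl fun l _ => by rw [HUp_symm, mul_comm]
    have e' : ∑ l, HUp g u v φ i l p * -christoffel g φ k j l p.proj
        = -∑ l, christoffel g φ k j l p.proj * HUp g u v φ i l p := by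
      rw [← Finset.sum_neg_distrib]
      exact Finset.sum_congr rfl fun l _ => by ring
    rw [e, e']
    ring
  · refine (koszul hnabla (hV i) (hH j) (hH k)
      (congrArg (fun L => L (vert φ i p)) (mvfderiv_liftMetric_horiz_horiz hφ hp j k))
      (mvfderiv_liftMetric_vert_horiz hφ hp _ _ _)
      (mvfderiv_liftMetric_vert_horiz hφ hp _ _ _)
      (liftMetric_horiz_of_eq_sum_vert hφ hp (mlieBracket_vert_horiz hφ hp _ _) _)
      (liftMetric_horiz_of_eq_sum_vert hφ hp (mlieBracket_vert_horiz hφ hp _ _) _)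
      (liftMetric_vert_of_eq_sum_vert hφ hp (mlieBracket_horiz_horiz hφ hp _ _) _)).trans ?_
    rw [sum_GLow_mul_Pt hφ hp h]
    simp only [dVert]
    ring

/-- Vanishing torsion: this derivative differs from that of δ_i along ∂^j by the bracket of ∂^j and
δ_i, the source of the Christoffel term. -/
theorem nabla_vert_horiz (i j : Fin n) :
    nabla (vert φ j) p (horiz g φ i p)
      = -(∑ l, christoffel g φ j i l p.proj • vert φ l p)
        + ∑ l, Pt g u v φ l j i p • horiz g φ l p := by
  have ht := hnabla.sub_eq_mlieBracket (mdifferentiableAt_vert hφ hp j)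
    (mdifferentiableAt_horiz (g := g) hφ hp i)
  rw [mlieBracket_vert_horiz hφ hp, nabla_horiz_vert hφ hp h hnabla] at ht
  rw [← ht]
  abel

/-- G is parallel horizontally, so its three derivatives combine as those of g do on the base and
give Γ. The vertical part is −½ ∂^k G_ij plus half of the bracket of δ_i and δ_j. -/
theorem nabla_horiz_horiz (i j : Fin n) :
    nabla (horiz g φ j) p (horiz g φ i p)
      = ∑ l, christoffel g φ l i j p.proj • horiz g φ l p
        + ∑ l, St g u v φ l i j p • vert φ l p := by
  have hV := fun i => mdifferentiableAt_vert hφ hp i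
  have hH := fun i => mdifferentiableAt_horiz (g := g) hφ hp i
  refine eq_of_liftMetric (g := g) hφ hp h (fun k => ?_) fun k => ?_
  · refine (koszul hnabla (hH i) (hH j) (hV k)
      (mvfderiv_liftMetric_horiz_vert hφ hp _ _ _)
      (mvfderiv_liftMetric_horiz_vert hφ hp _ _ _)
      (congrArg (fun L => L (vert φ k p)) (mvfderiv_liftMetric_horiz_horiz hφ hp i j))
      (liftMetric_vert_of_eq_sum_vert hφ hp (mlieBracket_horiz_horiz hφ hp _ _) _)
      (liftMetric_horiz_of_eq_sum_vert hφ hp (mlieBracket_horiz_vert hφ hp _ _) _)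
      (liftMetric_horiz_of_eq_sum_vert hφ hp (mlieBracket_horiz_vert hφ hp _ _) _)).trans ?_
    rw [sum_HUp_mul_St hφ hp h]
    simp only [dVert]
    ring
  · have dH := fun i j k => (congrArg (fun L => L (horiz g φ k p))
      (mvfderiv_liftMetric_horiz_horiz (g := g) (u := u) (v := v) hφ hp i j)).trans
      (mvfderiv_GLow_horiz hφ hp h k i j)
    have bH := fun i j => liftMetric_horiz_of_eq_sum_vert (g := g) (u := u) (v := v) hφ hp
      (mlieBracket_horiz_horiz (g := g) hφ hp i j)
    refine (koszul hnabla (hH i) (hH j) (hH k) (dH _ _ _) (dH _ _ _) (dH _ _ _) (bH _ _ _)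
      (bH _ _ _) (bH _ _ _)).trans ?_
    have hs : ∀ a b c : Fin n, ∑ l, GLow g u v φ l a p * christoffel g φ l b c p.proj
        = ∑ l, GLow g u v φ a l p * christoffel g φ l b c p.proj := fun a b c =>
      Finset.sum_congr rfl fun l _ => by rw [GLow_symm]
    rw [hs, hs, hs]
    simp only [christoffel_symm g φ _ j i, christoffel_symm g φ _ k i, christoffel_symm g φ _ k j]
    ring

end Connection

end NaturalLift

end

noncomputable section

namespace NaturalLift

/-! The components of the connection form M-tensor fields. -/

/-- Peels off one index at a time, turning sums over multi-indices `Fin r → Fin n` in the definition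
of M-tensor fields into iterated sums. -/
lemma sum_fin_succ_arrow {m n : ℕ} (F : (Fin (m + 1) → Fin n) → ℝ) :
    ∑ f, F f = ∑ x, ∑ f : Fin m → Fin n, F (Fin.cons x f) := by
  rw [← (Fin.consEquiv fun _ : Fin (m + 1) => Fin n).sum_comp, Fintype.sum_prod_type]
  rfl

lemma sum_fin_zero_arrow {n : ℕ} (F : (Fin 0 → Fin n) → ℝ) : ∑ f, F f = F Fin.elim0 := by
  rw [Fintype.sum_unique]
  exact congrArg F (Subsingleton.elim _ _)

/-- The value of a linear form on the covariant derivative of a combination of vector fields. -/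
lemma clm_covariantDerivative_sum {E H X : Type*} [NormedAddCommGroup E] [NormedSpace ℝ E]
    [TopologicalSpace H] {I : ModelWithCorners ℝ E H} [TopologicalSpace X]
    [ChartedSpace H X]
    [IsManifold I ∞ X] {n : ℕ}
    (nabla : CovariantDerivative I E (TangentSpace I : X → Type _))
    {f : Fin n → X → ℝ} {V : Fin n → ∀ x : X, TangentSpace I x} {x : X}
    {Y : ∀ x : X, TangentSpace I x} {w : TangentSpace I x}
    {W : Fin n → TangentSpace I x} {a : Fin n → ℝ} (L : TangentSpace I x →L[ℝ] ℝ)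
    (hY : MDifferentiableAt I I.tangent (fun x => (⟨x, Y x⟩ : TangentBundle I X)) x)
    (hf : ∀ i, MDifferentiableAt I 𝓘(ℝ) (f i) x)
    (hV : ∀ i, MDifferentiableAt I I.tangent (fun x => (⟨x, V i x⟩ : TangentBundle I X)) x)
    (hYV : ∀ᶠ y in nhds x, Y y = ∑ i, f i y • V i y) (hw : w = ∑ i, a i • W i)
    (hL : ∀ i, mvfderiv I (f i) x w * L (V i x) = 0) :
    L (nabla Y x w) = ∑ i, ∑ j, a i * f j x * L (nabla (V j) x (W i)) := by
  -- A covariant derivative depends only on the germ of the field, so an expansion valid near `x`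
  -- suffices.
  have h1 : nabla Y x = nabla (∑ i, f i • V i) x := by
    refine nabla.isCovariantDerivativeOnUniv.congr_of_eventuallyEq hY
      (mdifferentiableAt_sum_smul (fun i _ => hf i) (fun i _ => hV i)) Filter.univ_mem ?_
    filter_upwards [hYV] with y hy
    simp only [hy, Finset.sum_apply, Pi.smul_apply']
  -- The inhomogeneous Leibniz terms are the ones removed by `hL`.
  rw [h1, covariantDerivative_sum_smul nabla (fun i _ => hf i) (fun i _ => hV i), map_sum]
  simp only [map_add, map_smul, smul_eq_mul, hL, zero_add]
  rw [Finset.sum_comm]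
  refine Finset.sum_congr rfl fun j _ => ?_
  rw [hw, map_sum, map_sum, Finset.mul_sum]
  refine Finset.sum_congr rfl fun i _ => ?_
  rw [map_smul, map_smul, smul_eq_mul]
  ring

variable {n : ℕ} {M : Type*} [TopologicalSpace M] [ChartedSpace (Model n) M]
  [IsManifold (𝓡 n) ∞ M] {φ ψ : Chart n M} {g : Metric n M} {u v : ℝ → ℝ} {p : Cotangent n M}

/-! ### Smoothness of the components Q, P, S. -/

section Smooth

variable (hφ : φ ∈ IsManifold.maximalAtlas (𝓡 n) ∞ M)
include hφ

lemma contMDiffOn_dVert {f : Cotangent n M → ℝ}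
    (hf : ContMDiffOn (cotModel n) 𝓘(ℝ) ∞ f {p | p.proj ∈ φ.source}) (i : Fin n) :
    ContMDiffOn (cotModel n) 𝓘(ℝ) ∞ (dVert φ i f) {p | p.proj ∈ φ.source} :=
  (isCoord_inducedChart hφ).contMDiffOn_mvfderiv hf _

lemma contMDiffOn_GLow (h : Admissible u v) (i j : Fin n) :
    ContMDiffOn (cotModel n) 𝓘(ℝ) ∞ (GLow g u v φ i j) {p | p.proj ∈ φ.source} :=
  fun _ hq => (contMDiffAt_GLow hφ hq h i j).contMDiffWithinAt

lemma contMDiffOn_HUp (h : Admissible u v) (i j : Fin n) :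
    ContMDiffOn (cotModel n) 𝓘(ℝ) ∞ (HUp g u v φ i j) {p | p.proj ∈ φ.source} :=
  fun _ hq => (contMDiffAt_HUp hφ hq h i j).contMDiffWithinAt

lemma contMDiffOn_curvature0 (k i j : Fin n) :
    ContMDiffOn (cotModel n) 𝓘(ℝ) ∞ (curvature0 g φ k i j) {p | p.proj ∈ φ.source} :=
  fun _ hq => (contMDiffAt_curvature0 hφ hq k i j).contMDiffWithinAt

lemma contMDiffOn_Qt (h : Admissible u v) (i j k : Fin n) :
    ContMDiffOn (cotModel n) 𝓘(ℝ) ∞ (Qt g u v φ i j k) {p | p.proj ∈ φ.source} := by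
  have hd := fun i j k => contMDiffOn_dVert hφ (contMDiffOn_HUp (g := g) hφ h i j) k
  exact contMDiffOn_const.mul (contMDiffOn_finsetSum fun l _ =>
    (contMDiffOn_GLow hφ h _ _).mul (((hd _ _ _).add (hd _ _ _)).sub (hd _ _ _)))

lemma contMDiffOn_Pt (h : Admissible u v) (i j k : Fin n) :
    ContMDiffOn (cotModel n) 𝓘(ℝ) ∞ (Pt g u v φ i j k) {p | p.proj ∈ φ.source} := by
  have hd := fun i j k => contMDiffOn_dVert hφ (contMDiffOn_GLow (g := g) hφ h i j) k
  exact contMDiffOn_const.mul (contMDiffOn_finsetSum fun l _ =>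
    (contMDiffOn_HUp hφ h _ _).mul ((hd _ _ _).sub (contMDiffOn_finsetSum fun m _ =>
      (contMDiffOn_HUp hφ h _ _).mul (contMDiffOn_curvature0 hφ _ _ _))))

lemma contMDiffOn_St (h : Admissible u v) (i j k : Fin n) :
    ContMDiffOn (cotModel n) 𝓘(ℝ) ∞ (St g u v φ i j k) {p | p.proj ∈ φ.source} := by
  have hd := fun i j k => contMDiffOn_dVert hφ (contMDiffOn_GLow (g := g) hφ h i j) k
  exact (contMDiffOn_const.mul (contMDiffOn_finsetSum fun l _ =>
    (contMDiffOn_GLow hφ h _ _).mul (hd _ _ _))).add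
    (contMDiffOn_const.mul (contMDiffOn_curvature0 hφ _ _ _))

end Smooth

/-! ### Transformation laws of Q, P, S. -/

section Change

variable (hφ : φ ∈ IsManifold.maximalAtlas (𝓡 n) ∞ M) (hp : p.proj ∈ φ.source)
  (hψ : ψ ∈ IsManifold.maximalAtlas (𝓡 n) ∞ M) (hp' : p.proj ∈ ψ.source)
include hφ hp hψ hp'

lemma Dp_vert_change (g : Metric n M) (c l : Fin n) :
    Dp g ψ c p (vert φ l p) = jac ψ φ l c p.proj := by
  rw [Dp_change hψ hp' hφ hp]
  simp [Dp_vert hφ hp]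

lemma Dp_horiz_change (g : Metric n M) (c l : Fin n) :
    Dp g ψ c p (horiz g φ l p) = 0 := by
  rw [Dp_change hψ hp' hφ hp]
  simp [Dp_horiz hφ hp]

lemma dq_horiz_change (g : Metric n M) (c l : Fin n) :
    dq ψ c p (horiz g φ l p) = jac φ ψ c l p.proj := by
  rw [dq_change hφ hp hψ hp']
  simp [dq_horiz hφ hp]

lemma vert_eventually_change (g : Metric n M) (a : Fin n) :
    ∀ᶠ q in nhds p, vert ψ a q = ∑ i, jac φ ψ a i q.proj • vert φ i q := by
  filter_upwards [(isOpen_cotangent_source φ).mem_nhds hp,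
    (isOpen_cotangent_source ψ).mem_nhds hp'] with q hq hq'
  exact vert_change hφ hq hψ hq' g a

lemma horiz_eventually_change (g : Metric n M) (a : Fin n) :
    ∀ᶠ q in nhds p, horiz g ψ a q = ∑ i, jac ψ φ i a q.proj • horiz g φ i q := by
  filter_upwards [(isOpen_cotangent_source φ).mem_nhds hp,
    (isOpen_cotangent_source ψ).mem_nhds hp'] with q hq hq'
  exact horiz_change hφ hq hψ hq' g a

/-- The Jacobian depends on the base point only, hence is constant along fibres. -/
lemma mvfderiv_jac_vert (a i b : Fin n) :
    mvfderiv (cotModel n) (fun q : Cotangent n M => jac φ ψ a i q.proj) p (vert ψ b p) = 0 :=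
  mvfderiv_proj_vert hψ hp'
    ((contMDiffAt_jac hφ hψ hp hp' a i).mdifferentiableAt (by simp)) b

section Connection

variable (h : Admissible u v) {nabla : Connection n M}
  (hnabla : IsLeviCivita (liftMetric g u v) nabla)
include h hnabla

/-- Q is the vertical component of `nabla` on vertical frame fields. These change by a Jacobian that
is constant along ∂^a, so no inhomogeneous term appears; no derivative of H has to be transformed.
-/
lemma Qt_change (a b c : Fin n) :
    Qt g u v ψ a b c p = ∑ i, ∑ j, ∑ l, jac φ ψ a i p.proj * jac φ ψ b j p.proj
      * jac ψ φ l c p.proj * Qt g u v φ i j l p := by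
  obtain ⟨L, hL⟩ := exists_clm_Dp g ψ c p
  have h1 : L (nabla (vert ψ b) p (vert ψ a p)) = Qt g u v ψ a b c p := by
    rw [← hL, nabla_vert_vert hψ hp' h hnabla, Dp_sum_vert hψ hp']
  have h2 := clm_covariantDerivative_sum nabla (f := fun j q => jac φ ψ b j q.proj)
    (V := fun j => vert φ j) L (mdifferentiableAt_vert hψ hp' b)
    (fun j => mdifferentiableAt_of_smooth (contMDiffAt_jac_proj hφ hp hψ hp' b j))
    (fun j => mdifferentiableAt_vert hφ hp j) (vert_eventually_change hφ hp hψ hp' g b)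
    (vert_change hφ hp hψ hp' g a)
    (fun j => by rw [mvfderiv_jac_vert hφ hp hψ hp', zero_mul])
  rw [← h1, h2]
  refine Finset.sum_congr rfl fun i _ => Finset.sum_congr rfl fun j _ => ?_
  rw [← hL, nabla_vert_vert hφ hp h hnabla, Dp_sum_smul, Finset.mul_sum]
  refine Finset.sum_congr rfl fun l _ => ?_
  rw [Dp_vert_change hφ hp hψ hp']
  ring

/-- As for Q: the frame field being differentiated is horizontal, but the direction is vertical,
along which the Jacobian does not vary. -/
lemma Pt_change (c a b : Fin n) :
    Pt g u v ψ c a b p = ∑ l, ∑ i, ∑ j, jac φ ψ c l p.proj * jac φ ψ a i p.proj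
      * jac ψ φ j b p.proj * Pt g u v φ l i j p := by
  have h1 : dq ψ c p (nabla (horiz g ψ b) p (vert ψ a p)) = Pt g u v ψ c a b p := by
    rw [nabla_horiz_vert hψ hp' h hnabla, dq_sum_horiz hψ hp']
  have h2 := clm_covariantDerivative_sum nabla (f := fun j q => jac ψ φ j b q.proj)
    (V := fun j => horiz g φ j) (mvfderiv (cotModel n) (qCoord ψ c) p)
    (mdifferentiableAt_horiz hψ hp' b)
    (fun j => mdifferentiableAt_of_smooth (contMDiffAt_jac_proj hψ hp' hφ hp j b))
    (fun j => mdifferentiableAt_horiz hφ hp j) (horiz_eventually_change hφ hp hψ hp' g b)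
    (vert_change hφ hp hψ hp' g a)
    (fun j => by
      rw [mvfderiv_proj_vert hψ hp'
        ((contMDiffAt_jac hψ hφ hp' hp j b).mdifferentiableAt (by simp)), zero_mul])
  rw [← h1]
  refine h2.trans ?_
  rw [← sum_rotate]
  refine Finset.sum_congr rfl fun i _ => Finset.sum_congr rfl fun j _ => ?_
  rw [nabla_horiz_vert hφ hp h hnabla]
  change _ * dq ψ c p _ = _
  rw [dq_sum_smul, Finset.mul_sum]
  refine Finset.sum_congr rfl fun l _ => ?_
  rw [dq_horiz_change hφ hp hψ hp']
  ring

/-- In a horizontal direction the Jacobian does vary, but its derivative multiplies δ_j, and Dp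
annihilates horizontal vectors. Only the Γ part of the covariant derivative has an inhomogeneous
law. -/
lemma St_change (c a b : Fin n) :
    St g u v ψ c a b p = ∑ l, ∑ i, ∑ j, jac ψ φ l c p.proj * jac ψ φ i a p.proj
      * jac ψ φ j b p.proj * St g u v φ l i j p := by
  obtain ⟨L, hL⟩ := exists_clm_Dp g ψ c p
  have h1 : L (nabla (horiz g ψ b) p (horiz g ψ a p)) = St g u v ψ c a b p := by
    rw [← hL, nabla_horiz_horiz hψ hp' h hnabla, Dp_add, Dp_sum_vert hψ hp', Dp_sum_horiz hψ hp',
      zero_add]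
  have h2 := clm_covariantDerivative_sum nabla (f := fun j q => jac ψ φ j b q.proj)
    (V := fun j => horiz g φ j) L (mdifferentiableAt_horiz hψ hp' b)
    (fun j => mdifferentiableAt_of_smooth (contMDiffAt_jac_proj hψ hp' hφ hp j b))
    (fun j => mdifferentiableAt_horiz hφ hp j) (horiz_eventually_change hφ hp hψ hp' g b)
    (horiz_change hφ hp hψ hp' g a)
    (fun j => by rw [← hL, Dp_horiz_change hφ hp hψ hp', mul_zero])
  rw [← h1, h2, ← sum_rotate]
  refine Finset.sum_congr rfl fun i _ => Finset.sum_congr rfl fun j _ => ?_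
  rw [← hL, nabla_horiz_horiz hφ hp h hnabla, Dp_add, Dp_sum_smul, Dp_sum_smul, mul_add,
    Finset.mul_sum, Finset.mul_sum]
  simp only [Dp_horiz_change hφ hp hψ hp', Dp_vert_change hφ hp hψ hp', mul_zero,
    Finset.sum_const_zero, zero_add]
  refine Finset.sum_congr rfl fun l _ => ?_
  ring

end Connection

end Change

/-! ### Q, P, S as M-tensor fields. -/

section MTensor

variable (h : Admissible u v) {nabla : Connection n M}
  (hnabla : IsLeviCivita (liftMetric g u v) nabla)
include h hnabla

theorem isMTensorField_Qt : IsMTensorField (n := n) (M := M) (r := 2) (s := 1)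
    (fun φ a b p => Qt g u v φ (a 0) (a 1) (b 0) p) := by
  refine ⟨fun φ hφ a b => contMDiffOn_Qt hφ h _ _ _, fun φ hφ ψ hψ p hp hp' a b => ?_⟩
  refine (Qt_change hφ hp hψ hp' h hnabla _ _ _).trans ?_
  simp only [sum_fin_succ_arrow, sum_fin_zero_arrow, Fin.prod_univ_two, Fin.prod_univ_one]
  rfl

theorem isMTensorField_Pt : IsMTensorField (n := n) (M := M) (r := 2) (s := 1)
    (fun φ a b p => Pt g u v φ (a 0) (a 1) (b 0) p) := by
  refine ⟨fun φ hφ a b => contMDiffOn_Pt hφ h _ _ _, fun φ hφ ψ hψ p hp hp' a b => ?_⟩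
  refine (Pt_change hφ hp hψ hp' h hnabla _ _ _).trans ?_
  simp only [sum_fin_succ_arrow, sum_fin_zero_arrow, Fin.prod_univ_two, Fin.prod_univ_one]
  rfl

theorem isMTensorField_St : IsMTensorField (n := n) (M := M) (r := 0) (s := 3)
    (fun φ _ b p => St g u v φ (b 0) (b 1) (b 2) p) := by
  refine ⟨fun φ hφ a b => contMDiffOn_St hφ h _ _ _, fun φ hφ ψ hψ p hp hp' a b => ?_⟩
  refine (St_change hφ hp hψ hp' h hnabla _ _ _).trans ?_
  simp only [sum_fin_succ_arrow, sum_fin_zero_arrow, Fin.prod_univ_three, Fin.prod_univ_zero,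
    one_mul]
  rfl

end MTensor

end NaturalLift

end

noncomputable section

namespace NaturalLift

/-! Explicit components over a base manifold of constant sectional curvature. -/

variable {n : ℕ} {M : Type*} [TopologicalSpace M] [ChartedSpace (Model n) M]
  [IsManifold (𝓡 n) ∞ M] {φ : Chart n M} {g : Metric n M} {u v : ℝ → ℝ} {p : Cotangent n M}

/-- Eliminates t from the formulas. This is where v ≠ 0 is needed, since it makes w nonzero. -/
lemma add_two_mul_mul_eq {t : ℝ} (hu : 0 < u t) (huv : 0 < u t + 2 * t * v t) (hv : v t ≠ 0) :
    wFun u v t ≠ 0 ∧ u t + 2 * t * v t = -v t / (u t * wFun u v t) := by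
  have hw : wFun u v t ≠ 0 := div_ne_zero (neg_ne_zero.2 hv) (mul_pos hu huv).ne'
  refine ⟨hw, ?_⟩
  rw [eq_div_iff (mul_ne_zero hu.ne' hw), wFun]
  field_simp

/-! ### Contractions of G and H with g and p. -/

variable (hφ : φ ∈ IsManifold.maximalAtlas (𝓡 n) ∞ M) (hp : p.proj ∈ φ.source)
include hφ hp

lemma sum_GLow_mul_gUp0 (h : Fin n) :
    ∑ k, GLow g u v φ h k p * gUp0 g φ k p
      = (u (energy g φ p) + 2 * energy g φ p * v (energy g φ p)) * pCoord φ h p := by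
  have h1 : ∀ k, GLow g u v φ h k p * gUp0 g φ k p
      = u (energy g φ p) * (gUp0 g φ k p * gLow g φ k h p.proj)
        + v (energy g φ p) * pCoord φ h p * (gUp0 g φ k p * pCoord φ k p) := fun k => by
    rw [GLow, gLow_symm]
    ring
  simp only [h1, Finset.sum_add_distrib, ← Finset.mul_sum, sum_gUp0_mul_gLow hφ hp,
    sum_gUp0_mul_pCoord]
  ring

lemma sum_GLow_mul_gUp (h j : Fin n) :
    ∑ k, GLow g u v φ h k p * gUp g φ k j p.proj
      = u (energy g φ p) * kron h j + v (energy g φ p) * pCoord φ h p * gUp0 g φ j p := by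
  have h1 : ∀ k, GLow g u v φ h k p * gUp g φ k j p.proj
      = u (energy g φ p) * (gLow g φ h k p.proj * gUp g φ k j p.proj)
        + v (energy g φ p) * pCoord φ h p * (pCoord φ k p * gUp g φ k j p.proj) := fun k => by
    rw [GLow]
    ring
  simp only [h1, Finset.sum_add_distrib, ← Finset.mul_sum, gLow_mul_gUp hφ hp]
  rfl

lemma sum_HUp_mul_gLow (h : Admissible u v) (i j : Fin n) :
    ∑ k, HUp g u v φ i k p * gLow g φ k j p.proj
      = kron i j / u (energy g φ p) + wFun u v (energy g φ p) * gUp0 g φ i p * pCoord φ j p := by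
  have h1 : ∀ k, HUp g u v φ i k p * gLow g φ k j p.proj
      = (u (energy g φ p))⁻¹ * (gUp g φ i k p.proj * gLow g φ k j p.proj)
        + wFun u v (energy g φ p) * gUp0 g φ i p * (gUp0 g φ k p * gLow g φ k j p.proj) :=
    fun k => by
      rw [HUp_eq hφ hp h]
      ring
  simp only [h1, Finset.sum_add_distrib, ← Finset.mul_sum, gUp_mul_gLow hφ hp,
    sum_gUp0_mul_gLow hφ hp]
  ring

/-- G sends g^{0k} to (u + 2tv) p, so its inverse H sends p to g^0/(u + 2tv). -/
lemma sum_HUp_mul_pCoord (h : Admissible u v) (i : Fin n) :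
    ∑ k, HUp g u v φ i k p * pCoord φ k p
      = gUp0 g φ i p / (u (energy g φ p) + 2 * energy g φ p * v (energy g φ p)) := by
  have h1 : ∀ k, HUp g u v φ i k p * pCoord φ k p
      = (u (energy g φ p))⁻¹ * (gUp g φ i k p.proj * pCoord φ k p)
        + wFun u v (energy g φ p) * gUp0 g φ i p * (gUp0 g φ k p * pCoord φ k p) := fun k => by
    rw [HUp_eq hφ hp h]
    ring
  simp only [h1, Finset.sum_add_distrib, ← Finset.mul_sum, sum_gUp_mul_pCoord,
    sum_gUp0_mul_pCoord]
  have hu := (h.pos _ (energy_nonneg g φ p)).ne'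
  have hD := (h.pos' _ (energy_nonneg g φ p)).ne'
  rw [eq_div_iff hD]
  linear_combination (2 * energy g φ p * gUp0 g φ i p)
    * wFun_mul (h.pos _ (energy_nonneg g φ p)) (h.pos' _ (energy_nonneg g φ p))
    + gUp0 g φ i p * mul_inv_cancel₀ hu

lemma curvature0_of_const {c : ℝ} (hc : HasConstantSectionalCurvature g c) (k i j : Fin n) :
    curvature0 g φ k i j p = c * (pCoord φ i p * gLow g φ k j p.proj
      - pCoord φ j p * gLow g φ k i p.proj) := by
  have h1 : ∀ h, pCoord φ h p * curvature g φ h k i j p.proj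
      = c * gLow g φ k j p.proj * (kron h i * pCoord φ h p)
        - c * gLow g φ k i p.proj * (kron h j * pCoord φ h p) := fun h => by
    rw [curvature_of_const hc hφ hp]
    ring
  simp only [curvature0, h1, Finset.sum_sub_distrib, ← Finset.mul_sum, sum_kron_mul']
  ring

/-! ### Explicit components of Q, P, S. -/

section Explicit

variable (h : Admissible u v) (hv : v (energy g φ p) ≠ 0)
include h hv

/-- The values of u, v, w and their derivatives are passed as real variables, here and in the next
two theorems, so that the closing algebra treats them as atoms. The curvature plays no role in Q. -/
theorem Qt_eq (i j k : Fin n) {U V W U' W' : ℝ} (hU : U = u (energy g φ p))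
    (hV : V = v (energy g φ p)) (hW : W = wFun u v (energy g φ p))
    (hU' : U' = deriv0 u (energy g φ p)) (hW' : W' = deriv0 (wFun u v) (energy g φ p)) :
    Qt g u v φ i j k p =
      -(U' / (2 * U)) * (kron i k * gUp0 g φ j p + kron j k * gUp0 g φ i p)
        - V * (U' + 2 * U ^ 2 * W) / (2 * U ^ 3 * W) * gUp g φ i j p.proj * pCoord φ k p
        - V * (2 * U' * W + U * W') / (2 * U ^ 2 * W)
          * gUp0 g φ i p * gUp0 g φ j p * pCoord φ k p := by
  -- Sorted by what G is contracted with: g^{lj}, g^{li} or g^{0l}. Each of these sums has a closed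
  -- form.
  have h1 : ∀ l, GLow g u v φ k l p *
      (dVert φ i (HUp g u v φ j l) p + dVert φ j (HUp g u v φ i l) p
        - dVert φ l (HUp g u v φ i j) p)
      = -U' / U ^ 2 * gUp0 g φ i p * (GLow g u v φ k l p * gUp g φ l j p.proj)
        + -U' / U ^ 2 * gUp0 g φ j p * (GLow g u v φ k l p * gUp g φ l i p.proj)
        + ((U' / U ^ 2 + 2 * W) * gUp g φ i j p.proj + W' * gUp0 g φ i p * gUp0 g φ j p)
          * (GLow g u v φ k l p * gUp0 g φ l p) := fun l => by
    rw [dVert_HUp hφ hp h, dVert_HUp hφ hp h, dVert_HUp hφ hp h, gUp_symm g φ j l,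
      gUp_symm g φ i l, gUp_symm g φ j i, ← hU, ← hW, ← hU', ← hW']
    ring
  have hu := h.pos _ (energy_nonneg g φ p)
  obtain ⟨hw0, hD⟩ := add_two_mul_mul_eq hu (h.pos' _ (energy_nonneg g φ p)) hv
  rw [← hU, ← hV, ← hW] at hD
  simp only [Qt, h1, Finset.sum_add_distrib, ← Finset.mul_sum, sum_GLow_mul_gUp hφ hp,
    sum_GLow_mul_gUp0 hφ hp, hD, kron_comm k, ← hU, ← hV]
  rw [← hU] at hu
  rw [← hW] at hw0
  field_simp
  ring

theorem Pt_eq {c : ℝ} (hc : HasConstantSectionalCurvature g c) (l i j : Fin n)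
    {U V W U' V' : ℝ} (hU : U = u (energy g φ p))
    (hV : V = v (energy g φ p)) (hW : W = wFun u v (energy g φ p))
    (hU' : U' = deriv0 u (energy g φ p)) (hV' : V' = deriv0 v (energy g φ p)) :
    Pt g u v φ l i j p =
      U' / (2 * U) * kron l j * gUp0 g φ i p
        - (c + U * V) * W / (2 * V) * kron i j * gUp0 g φ l p
        + (U * V - c) / (2 * U ^ 2) * gUp g φ i l p.proj * pCoord φ j p
        + (V * W * (U * V - c) + U * W * (U' * V - U * V')) / (2 * U * V)
          * gUp0 g φ i p * gUp0 g φ l p * pCoord φ j p := by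
  -- For constant curvature the rank-one terms of H cancel by antisymmetry in `j, k`, so only the
  -- 1/u part contributes.
  have hR : ∀ k, ∑ m, HUp g u v φ i m p * curvature0 g φ m j k p
      = c / U * (pCoord φ j p * kron i k - pCoord φ k p * kron i j) := fun k => by
    have e : ∀ m, HUp g u v φ i m p * curvature0 g φ m j k p
        = c * pCoord φ j p * (HUp g u v φ i m p * gLow g φ m k p.proj)
          - c * pCoord φ k p * (HUp g u v φ i m p * gLow g φ m j p.proj) := fun m => by
      rw [curvature0_of_const hφ hp hc]
      ring
    simp only [e, Finset.sum_sub_distrib, ← Finset.mul_sum, sum_HUp_mul_gLow hφ hp h, ← hU]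
    ring
  have h1 : ∀ k, HUp g u v φ l k p * (dVert φ i (GLow g u v φ j k) p
        - ∑ m, HUp g u v φ i m p * curvature0 g φ m j k p)
      = gUp0 g φ i p * U' * (HUp g u v φ l k p * gLow g φ k j p.proj)
        + (gUp0 g φ i p * V' * pCoord φ j p + (V + c / U) * kron i j)
          * (HUp g u v φ l k p * pCoord φ k p)
        + (V - c / U) * pCoord φ j p * (HUp g u v φ l k p * kron i k) := fun k => by
    rw [dVert_GLow hφ hp h, hR, gLow_symm g φ j k, ← hV, ← hU', ← hV']
    ring
  have hu := h.pos _ (energy_nonneg g φ p)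
  obtain ⟨hw0, hD⟩ := add_two_mul_mul_eq hu (h.pos' _ (energy_nonneg g φ p)) hv
  rw [← hU, ← hV, ← hW] at hD
  simp only [Pt, h1, Finset.sum_add_distrib, ← Finset.mul_sum, sum_HUp_mul_gLow hφ hp h,
    sum_HUp_mul_pCoord hφ hp h, sum_mul_kron, hD, ← hU, ← hV, ← hW]
  rw [HUp_eq hφ hp h, gUp_symm g φ l i, ← hU, ← hW]
  rw [← hU] at hu
  rw [← hW] at hw0
  rw [← hV] at hv
  field_simp
  ring

theorem St_eq {c : ℝ} (hc : HasConstantSectionalCurvature g c) (k i j : Fin n)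
    {U V W U' V' : ℝ} (hU : U = u (energy g φ p))
    (hV : V = v (energy g φ p)) (hW : W = wFun u v (energy g φ p))
    (hU' : U' = deriv0 u (energy g φ p)) (hV' : V' = deriv0 v (energy g φ p)) :
    St g u v φ k i j p =
      (c - U * V) / 2 * gLow g φ j k p.proj * pCoord φ i p
        - (c + U * V) / 2 * gLow g φ i k p.proj * pCoord φ j p
        + U' * V / (2 * U * W) * gLow g φ i j p.proj * pCoord φ k p
        + V * (V' - 2 * U * V * W) / (2 * U * W) * pCoord φ k p * pCoord φ i p * pCoord φ j p := by
  have h1 : ∀ l, GLow g u v φ k l p * dVert φ l (GLow g u v φ i j) p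
      = (U' * gLow g φ i j p.proj + V' * pCoord φ i p * pCoord φ j p)
          * (GLow g u v φ k l p * gUp0 g φ l p)
        + V * pCoord φ i p * (GLow g u v φ k l p * kron l j)
        + V * pCoord φ j p * (GLow g u v φ k l p * kron l i) := fun l => by
    rw [dVert_GLow hφ hp h, ← hV, ← hU', ← hV']
    ring
  have hu := h.pos _ (energy_nonneg g φ p)
  obtain ⟨hw0, hD⟩ := add_two_mul_mul_eq hu (h.pos' _ (energy_nonneg g φ p)) hv
  rw [← hU, ← hV, ← hW] at hD
  simp only [St, h1, Finset.sum_add_distrib, ← Finset.mul_sum, sum_GLow_mul_gUp0 hφ hp,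
    sum_mul_kron', curvature0_of_const hφ hp hc, hD, ← hU, ← hV]
  simp only [GLow, gLow_symm g φ k, ← hU, ← hV]
  rw [← hU] at hu
  rw [← hW] at hw0
  field_simp
  ring

end Explicit

end NaturalLift

end

theorem theorem7 (n : ℕ) (M : Type*) [TopologicalSpace M]
    [ChartedSpace (NaturalLift.Model n) M] [IsManifold (𝓡 n) ∞ M]
    (g : NaturalLift.Metric n M) (u v : ℝ → ℝ)
    (hu : ContDiffOn ℝ ∞ u (Set.Ici 0)) (hv : ContDiffOn ℝ ∞ v (Set.Ici 0))
    (hu_pos : ∀ t : ℝ, 0 ≤ t → 0 < u t)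
    (huv_pos : ∀ t : ℝ, 0 ≤ t → 0 < u t + 2 * t * v t)
    (nabla : NaturalLift.Connection n M)
    (hnabla : NaturalLift.IsLeviCivita (NaturalLift.liftMetric g u v) nabla) :
    -- the connection in the adapted frames
    (∀ φ ∈ IsManifold.maximalAtlas (𝓡 n) ∞ M,
      ∀ p : NaturalLift.Cotangent n M, p.proj ∈ φ.source → ∀ i j : Fin n,
        nabla (NaturalLift.vert φ j) p (NaturalLift.vert φ i p)
            = ∑ h, NaturalLift.Qt g u v φ i j h p • NaturalLift.vert φ h p ∧
        nabla (NaturalLift.vert φ j) p (NaturalLift.horiz g φ i p)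
            = -(∑ h, NaturalLift.christoffel g φ j i h p.proj • NaturalLift.vert φ h p)
              + ∑ h, NaturalLift.Pt g u v φ h j i p • NaturalLift.horiz g φ h p ∧
        nabla (NaturalLift.horiz g φ j) p (NaturalLift.vert φ i p)
            = ∑ h, NaturalLift.Pt g u v φ h i j p • NaturalLift.horiz g φ h p ∧
        nabla (NaturalLift.horiz g φ j) p (NaturalLift.horiz g φ i p)
            = ∑ h, NaturalLift.christoffel g φ h i j p.proj • NaturalLift.horiz g φ h p
              + ∑ h, NaturalLift.St g u v φ h i j p • NaturalLift.vert φ h p) ∧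
    -- `Q`, `P`, `S` are M-tensor fields of types (2,1), (2,1), (0,3)
    NaturalLift.IsMTensorField (n := n) (M := M) (r := 2) (s := 1)
      (fun φ a b p => NaturalLift.Qt g u v φ (a 0) (a 1) (b 0) p) ∧
    NaturalLift.IsMTensorField (n := n) (M := M) (r := 2) (s := 1)
      (fun φ a b p => NaturalLift.Pt g u v φ (a 0) (a 1) (b 0) p) ∧
    NaturalLift.IsMTensorField (n := n) (M := M) (r := 0) (s := 3)
      (fun φ _ b p => NaturalLift.St g u v φ (b 0) (b 1) (b 2) p) ∧
    -- the explicit expressions when the base manifold has constant sectional curvature `c`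
    (∀ c : ℝ, NaturalLift.HasConstantSectionalCurvature g c →
      ∀ φ ∈ IsManifold.maximalAtlas (𝓡 n) ∞ M,
      ∀ p : NaturalLift.Cotangent n M, p.proj ∈ φ.source →
      ∀ t U V W U' V' W' : ℝ, t = NaturalLift.energy g φ p →
        U = u t → V = v t → W = NaturalLift.wFun u v t →
        U' = NaturalLift.deriv0 u t → V' = NaturalLift.deriv0 v t →
        W' = NaturalLift.deriv0 (NaturalLift.wFun u v) t →
        V ≠ 0 → ∀ i j h : Fin n,
        NaturalLift.Qt g u v φ i j h p =
          -(U' / (2 * U)) * (NaturalLift.kron i h * NaturalLift.gUp0 g φ j p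
              + NaturalLift.kron j h * NaturalLift.gUp0 g φ i p)
            - V * (U' + 2 * U ^ 2 * W) / (2 * U ^ 3 * W)
              * NaturalLift.gUp g φ i j p.proj * NaturalLift.pCoord φ h p
            - V * (2 * U' * W + U * W') / (2 * U ^ 2 * W)
              * NaturalLift.gUp0 g φ i p * NaturalLift.gUp0 g φ j p * NaturalLift.pCoord φ h p ∧
        NaturalLift.Pt g u v φ h i j p =
          U' / (2 * U) * NaturalLift.kron h j * NaturalLift.gUp0 g φ i p
            - (c + U * V) * W / (2 * V) * NaturalLift.kron i j * NaturalLift.gUp0 g φ h p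
            + (U * V - c) / (2 * U ^ 2)
              * NaturalLift.gUp g φ i h p.proj * NaturalLift.pCoord φ j p
            + (V * W * (U * V - c) + U * W * (U' * V - U * V')) / (2 * U * V)
              * NaturalLift.gUp0 g φ i p * NaturalLift.gUp0 g φ h p * NaturalLift.pCoord φ j p ∧
        NaturalLift.St g u v φ h i j p =
          (c - U * V) / 2 * NaturalLift.gLow g φ j h p.proj * NaturalLift.pCoord φ i p
            - (c + U * V) / 2 * NaturalLift.gLow g φ i h p.proj * NaturalLift.pCoord φ j p
            + U' * V / (2 * U * W) * NaturalLift.gLow g φ i j p.proj * NaturalLift.pCoord φ h p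
            + V * (V' - 2 * U * V * W) / (2 * U * W)
              * NaturalLift.pCoord φ h p * NaturalLift.pCoord φ i p
              * NaturalLift.pCoord φ j p) := by
  have h : NaturalLift.Admissible u v := ⟨hu, hv, hu_pos, huv_pos⟩
  refine ⟨fun φ hφ p hp i j => ⟨NaturalLift.nabla_vert_vert hφ hp h hnabla i j,
    NaturalLift.nabla_vert_horiz hφ hp h hnabla i j,
    NaturalLift.nabla_horiz_vert hφ hp h hnabla i j,
    NaturalLift.nabla_horiz_horiz hφ hp h hnabla i j⟩,
    NaturalLift.isMTensorField_Qt h hnabla, NaturalLift.isMTensorField_Pt h hnabla,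
    NaturalLift.isMTensorField_St h hnabla, ?_⟩
  intro c hc φ hφ p hp t U V W U' V' W' ht hU hV hW hU' hV' hW' hV0 i j k
  subst ht
  have hv0 : v (NaturalLift.energy g φ p) ≠ 0 := hV ▸ hV0
  exact ⟨NaturalLift.Qt_eq hφ hp h hv0 i j k hU hV hW hU' hW',
    NaturalLift.Pt_eq hφ hp h hv0 hc k i j hU hV hW hU' hV',
    NaturalLift.St_eq hφ hp h hv0 hc k i j hU hV hW hU' hV'⟩
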